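/- **Setting.** A d-space is a topological space with a set of directed paths (d-paths) containing the constant paths and closed under concatenation and non-decreasing reparametrization; a d-map is a continuous map sending d-paths to d-paths. $\vec T(X)_x^y$ is the trace space (d-paths from $x$ to $y$ modulo reparametrization, quotient topology); $\vec\pi_1(X)_x^y$ is its set of path components. The extension category $E\vec\pi_1(X)$ has as objects the reachable pairs $(x,y)$, i.e. $\vec T(X)_x^y\neq\emptyset$, and as morphisms $(x,y)\to(x',y')$ the elements $(\sigma *,*\tau)$ of $\vec\pi_1(X)_{x'}^{x}\times\vec\pi_1(X)_{y}^{y'}$. Let $\mathcal F$ be a class of continuous maps that contains all homotopy equivalences and consists of maps inducing bijections on $\pi_0$. A d-map $f:X\to X$ is $+\mathcal F$-inessential if there is a d-map $H:X\times\vec I\to X$ with $H_0=\mathrm{id}$, $H_1=f$ such that every $H_t$ induces maps in $\mathcal F$ on all non-empty trace spaces. Let $\mathcal C$ be the category with the reachable pairs as objects, generated by $E\vec\pi_1(X)$ and the morphisms $f:(x,y)\to(fx,fy)$ for all $+\mathcal F$-inessential $f$ (composed as maps), subject to $((f\sigma)*,*(f\tau))\circ f=f\circ(\sigma *,*\tau)$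 and $*H(y)=H(x)*\circ f:(x,y)\to(x,fy)$ for each d-map $H:X\times\vec I\to X$ from $\mathrm{id}$ to an inessential $f$. The future pair component category $\vec\pi_0(X;+,\mathcal F)$ is the quotient of $\mathcal C$ in which all the morphisms $f$ become identities. $D$ is the cubical complex made of four squares $A,B_1,B_2,C$ (copies of $\vec I^2$) glued by $[A;(1,t)]=[B_1;(0,t)]$, $[A;(t,1)]=[B_2;(t,0)]$, $[B_1;(1,t)]=[C;(0,t)]$, $[B_2;(t,1)]=[C;(t,0)]$; its d-paths are the finite concatenations of coordinatewise non-decreasing paths in the squares. Put $a_1=\{[A;(1,t)]: t<1\}$, $a_2=\{[A;(t,1)]: t<1\}$, $a^+=[A;(1,1)]$, $\llcorner A=A\setminus(a_1\cup a_2\cup a^+)$; $b_1=\{[B_1;(t,1)]: t>0\}$, $b_2=\{[B_2;(1,t)]: t>0\}$, $B_i^\circ=B_i\setminus(a_i\cup b_i\cup a^+)$; $c_1=\{[C;(1,t)]: t<1\}$, $c_2=\{[C;(t,1)]: t<1\}$, $c^+=[C;(1,1)]$, $\llcorner C=C\setminus(c_1\cup c_2\cup c^+)$; $E=B_1^\circ\cup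 B_2^\circ\cup\llcorner C$. Points $[A;(s,t)]$ and $[C;(s,t)]$ have coordinates $(s,t)$; points $[B_1;(s,t)]\notin A$ have coordinates $(s-1,t)$, points $[B_2;(s,t)]\notin A$ have coordinates $(s,t-1)$. A decoration compares the indicated coordinate(s) of the start point with those of the end point. **Proposition.** For every such $\mathcal F$, the objects of $\vec\pi_0(D;+,\mathcal F)$ are exactly the following pairwise distinct, non-empty classes of reachable pairs (a class with no decoration mentioned consists of all reachable pairs in the given product): 1. $(\llcorner A,\llcorner A)$ with decorations $(==),(=<),(<=),(<<)$; 2. $(\llcorner A,a_1)$ with $=$, $<$ in the second coordinate; $(\llcorner A,a_2)$ with $=$, $<$ in the first coordinate; 3. $(\llcorner A,a^+)$; 4. $(a_1,a_1)$ with $=$, $<$ in the second coordinate; $(a_2,a_2)$ with $=$, $<$ in the first coordinate; 5. $(a_i,a^+)$, $i=1,2$; 6. $(a^+,a^+)$; 7. $(\llcorner A,\llcorner C)$ with decorations $(==),(=<),(<=),(<<)$; 8. $(\llcorner A,B_1^\circ\cup\llcorner C)$ with decorations $(><),(>=)$; 9. $(\llcorner A,B_2^\circ\cup\llcorner C)$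 with decorations $(<>),(=>)$; 10. $(\llcorner A,b_1\cup c_2)$ with $=,<,>$ in the first coordinate; $(\llcorner A,b_2\cup c_1)$ with $=,<,>$ in the second coordinate; 11. $(\llcorner A,c^+)$; 12. $(a_1,B_1^\circ\cup\llcorner C)$ with $=$, $<$ in the second coordinate; $(a_2,B_2^\circ\cup\llcorner C)$ with $=$, $<$ in the first coordinate; 13. $(a_1,b_1\cup c_2)$; $(a_2,b_2\cup c_1)$; $(a_1,b_2\cup c_1)$ with $=,<,>$ in the second coordinate; $(a_2,b_1\cup c_2)$ with $=,<,>$ in the first coordinate; $(a_i,c^+)$, $i=1,2$; 14. $(a^+,b_1\cup c_2)$, $(a^+,b_2\cup c_1)$, $(a^+,c^+)$; 15. $(E,E)$; 16. $(E,b_1\cup c_2)$, $(E,b_2\cup c_1)$; 17. $(E,c^+)$; 18. $(b_1\cup c_2,b_1\cup c_2)$, $(b_2\cup c_1,b_2\cup c_1)$; 19. $(b_1\cup c_2,c^+)$, $(b_2\cup c_1,c^+)$; 20. $(c^+,c^+)$. Every morphism of $\vec\pi_0(D;+,\mathcal F)$ is represented by an extension morphism between reachable pairs. The category has finitely many objects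 and finite morphism sets, and it is not equivalent to the category with one object and one morphism. It does not depend on $\mathcal F$: for any two such classes $\mathcal F,\mathcal F'$ there is an isomorphism of categories $\vec\pi_0(D;+,\mathcal F)\cong\vec\pi_0(D;+,\mathcal F')$ compatible with the canonical functors from $E\vec\pi_1(D)$. -/

import Mathlib

open CategoryTheory
open scoped unitInterval

noncomputable section

namespace DirTop

/-! ### Directed spaces, directed maps, trace spaces -/

/-- A d-space: a topological space together with a set of directed paths that contains the constant
paths and is closed under concatenation and under non-decreasing reparametrization. -/
class DSpace (X : Type) [TopologicalSpace X] where
  IsDPath : C(I, X) → Prop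
  isDPath_const : ∀ x : X, IsDPath (ContinuousMap.const I x)
  isDPath_trans : ∀ {x y z : X} (p : Path x y) (q : Path y z),
    IsDPath p.toContinuousMap → IsDPath q.toContinuousMap → IsDPath (p.trans q).toContinuousMap
  isDPath_comp : ∀ (p : C(I, X)) (φ : C(I, I)), Monotone φ → IsDPath p → IsDPath (p.comp φ)

open DSpace (IsDPath)

lemma monotone_trans {x y z : I} (p : Path x y) (q : Path y z) (hp : Monotone p)
    (hq : Monotone q) : Monotone (p.trans q) := by
  intro s t hst
  have hst' : (s : ℝ) ≤ t := hst
  simp only [Path.trans_apply]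
  split_ifs with h1 h2 h2
  · exact hp (by simpa using hst')
  · exact (hp unitInterval.le_one').trans (by
      rw [Path.target]
      exact q.source.symm.le.trans (hq unitInterval.nonneg'))
  · exact absurd (hst'.trans h2) h1
  · exact hq (by simpa using hst')

/-- The directed interval: its d-paths are the non-decreasing paths. -/
instance : DSpace I where
  IsDPath p := Monotone p
  isDPath_const _ := monotone_const
  isDPath_trans p q hp hq := monotone_trans p q hp hq
  isDPath_comp _ _ hφ hp := hp.comp hφ

/-- The product of two d-spaces: d-paths are the paths both of whose components are d-paths. -/
instance {X Y : Type} [TopologicalSpace X] [TopologicalSpace Y] [DSpace X] [DSpace Y] :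
    DSpace (X × Y) where
  IsDPath p := IsDPath (ContinuousMap.fst.comp p) ∧ IsDPath (ContinuousMap.snd.comp p)
  isDPath_const z := ⟨DSpace.isDPath_const z.1, DSpace.isDPath_const z.2⟩
  isDPath_trans p q hp hq := by
    constructor
    · have := DSpace.isDPath_trans (p.map continuous_fst) (q.map continuous_fst) hp.1 hq.1
      rwa [← Path.map_trans] at this
    · have := DSpace.isDPath_trans (p.map continuous_snd) (q.map continuous_snd) hp.2 hq.2
      rwa [← Path.map_trans] at this
  isDPath_comp p φ hφ hp := ⟨DSpace.isDPath_comp _ φ hφ hp.1, DSpace.isDPath_comp _ φ hφ hp.2⟩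

/-- A d-map: a continuous map that sends d-paths to d-paths. -/
structure DMap (X Y : Type) [TopologicalSpace X] [TopologicalSpace Y] [DSpace X] [DSpace Y]
    extends C(X, Y) where
  map_dpath : ∀ p : C(I, X), IsDPath p → IsDPath (toContinuousMap.comp p)

section

variable {X Y Z : Type} [TopologicalSpace X] [TopologicalSpace Y] [TopologicalSpace Z]
  [DSpace X] [DSpace Y] [DSpace Z]

instance : CoeFun (DMap X Y) (fun _ => X → Y) := ⟨fun f => f.toContinuousMap⟩

/-- The identity d-map. -/
def DMap.id (X : Type) [TopologicalSpace X] [DSpace X] : DMap X X :=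
  ⟨ContinuousMap.id X, fun _ hp => hp⟩

/-- The composite `g ∘ f` of two d-maps. -/
def DMap.comp (g : DMap Y Z) (f : DMap X Y) : DMap X Z :=
  ⟨g.toContinuousMap.comp f.toContinuousMap, fun p hp => g.map_dpath _ (f.map_dpath p hp)⟩

/-- The space of d-paths from `x` to `y`, with the compact-open topology. -/
def DPath (x y : X) : Type := {p : Path x y // IsDPath p.toContinuousMap}

instance (x y : X) : TopologicalSpace (DPath x y) :=
  inferInstanceAs (TopologicalSpace {p : Path x y // IsDPath p.toContinuousMap})

/-- The constant d-path. -/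
def DPath.refl (x : X) : DPath x x := ⟨Path.refl x, DSpace.isDPath_const x⟩

/-- Concatenation of d-paths. -/
def DPath.trans {x y z : X} (p : DPath x y) (q : DPath y z) : DPath x z :=
  ⟨p.1.trans q.1, DSpace.isDPath_trans p.1 q.1 p.2 q.2⟩

/-- The image of a d-path under a d-map. -/
def DPath.map (f : DMap X Y) {x y : X} (p : DPath x y) : DPath (f x) (f y) :=
  ⟨p.1.map f.toContinuousMap.continuous, f.map_dpath p.1.toContinuousMap p.2⟩

/-- `q` is a reparametrization `p ∘ φ` of `p`, for a continuous non-decreasing `φ : I → I` with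
`φ 0 = 0` and `φ 1 = 1` (equivalently, non-decreasing and surjective). -/
def Reparam {x y : X} (p q : DPath x y) : Prop :=
  ∃ φ : C(I, I), Monotone φ ∧ φ 0 = 0 ∧ φ 1 = 1 ∧ ∀ t, q.1 t = p.1 (φ t)

/-- The trace space: the quotient space of the space of d-paths by the equivalence relation
generated by reparametrization. -/
def Trace (x y : X) : Type := Quot (Reparam (x := x) (y := y))

instance (x y : X) : TopologicalSpace (Trace x y) :=
  inferInstanceAs (TopologicalSpace (Quot (Reparam (x := x) (y := y))))

/-- The trace of a d-path. -/
def DPath.trace {x y : X} (p : DPath x y) : Trace x y := Quot.mk _ p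

lemma continuous_trace {x y : X} : Continuous (DPath.trace : DPath x y → Trace x y) :=
  continuous_quot_mk

/-- The point `t / 2` of the unit interval. -/
def lowerHalf : C(I, I) :=
  ⟨fun t => ⟨t / 2, by constructor <;> linarith [t.2.1, t.2.2]⟩, by fun_prop⟩

/-- The point `(t + 1) / 2` of the unit interval. -/
def upperHalf : C(I, I) :=
  ⟨fun t => ⟨(t + 1) / 2, by constructor <;> linarith [t.2.1, t.2.2]⟩, by fun_prop⟩

lemma Reparam.trans {x y z : X} {p p' : DPath x y} {q q' : DPath y z} (hp : Reparam p p')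
    (hq : Reparam q q') : Reparam (p.trans q) (p'.trans q') := by
  obtain ⟨φ, hφ, hφ0, hφ1, hp⟩ := hp
  obtain ⟨ψ, hψ, hψ0, hψ1, hq⟩ := hq
  let m : I := lowerHalf 1
  let a : Path (0 : I) m := ⟨lowerHalf.comp φ, by ext; simp [hφ0, lowerHalf], by simp [hφ1, m]⟩
  let b : Path m (1 : I) := ⟨upperHalf.comp ψ, by ext; simp [hψ0, lowerHalf, upperHalf, m],
    by ext; simp [hψ1, upperHalf]⟩
  have ha : Monotone a := fun s t h => by
    have : (φ s : ℝ) ≤ φ t := hφ h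
    change (φ s : ℝ) / 2 ≤ φ t / 2
    linarith
  have hb : Monotone b := fun s t h => by
    have : (ψ s : ℝ) ≤ ψ t := hψ h
    change ((ψ s : ℝ) + 1) / 2 ≤ (ψ t + 1) / 2
    linarith
  refine ⟨(a.trans b).toContinuousMap, monotone_trans a b ha hb, (a.trans b).source,
    (a.trans b).target, fun t => ?_⟩
  change (p'.1.trans q'.1) t = (p.1.trans q.1) ((a.trans b) t)
  rw [Path.trans_apply, Path.trans_apply a b]
  split_ifs with h
  · set u : I := ⟨2 * t, (unitInterval.mul_pos_mem_iff zero_lt_two).2 ⟨t.2.1, h⟩⟩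
    rw [hp, Path.trans_apply, dif_pos]
    · congr 1
      ext
      change (φ u : ℝ) = 2 * (φ u / 2)
      ring
    · change (φ u : ℝ) / 2 ≤ 1 / 2
      linarith [(φ u).2.2]
  · set u : I := ⟨2 * t - 1, unitInterval.two_mul_sub_one_mem_iff.2 ⟨(not_le.1 h).le, t.2.2⟩⟩
    rw [hq]
    by_cases h' : ((ψ u : ℝ) + 1) / 2 ≤ 1 / 2
    · have h0 : ψ u = 0 := by ext; exact le_antisymm (by change (ψ u : ℝ) ≤ 0; linarith) (ψ u).2.1
      rw [Path.trans_apply, dif_pos (show ((b u : I) : ℝ) ≤ 1 / 2 from h'), h0, q.1.source]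
      have : (⟨2 * (b u : ℝ), (unitInterval.mul_pos_mem_iff zero_lt_two).2 ⟨(b u).2.1, h'⟩⟩ : I)
          = 1 := by
        ext
        change 2 * (((ψ u : ℝ) + 1) / 2) = 1
        rw [h0]; simp
      rw [this, p.1.target]
    · rw [Path.trans_apply, dif_neg (show ¬ ((b u : I) : ℝ) ≤ 1 / 2 from h')]
      congr 1
      ext
      change (ψ u : ℝ) = 2 * ((ψ u + 1) / 2) - 1
      ring

lemma Reparam.rfl {x y : X} (p : DPath x y) : Reparam p p :=
  ⟨ContinuousMap.id I, monotone_id, by simp, by simp, fun _ => by simp⟩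

lemma Reparam.map (f : DMap X Y) {x y : X} {p q : DPath x y} (h : Reparam p q) :
    Reparam (p.map f) (q.map f) := by
  obtain ⟨φ, hφ, h0, h1, h⟩ := h
  exact ⟨φ, hφ, h0, h1, fun t => congrArg f (h t)⟩

/-- Concatenation of traces. -/
def Trace.trans {x y z : X} : Trace x y → Trace y z → Trace x z :=
  Quot.map₂ DPath.trans (fun p _ _ h => (Reparam.rfl p).trans h)
    (fun _ _ q h => h.trans (Reparam.rfl q))

/-- The map of trace spaces `[p] ↦ [f ∘ p]` induced by a d-map `f`. -/
def Trace.map (f : DMap X Y) {x y : X} : Trace x y → Trace (f x) (f y) :=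
  Quot.map (DPath.map f) (fun _ _ h => h.map f)

lemma DPath.continuous_map (f : DMap X Y) {x y : X} :
    Continuous (DPath.map f : DPath x y → DPath (f x) (f y)) := by
  refine Continuous.subtype_mk ?_ _
  refine continuous_induced_rng.2 ?_
  exact (ContinuousMap.continuous_postcomp f.toContinuousMap).comp
    (continuous_induced_dom.comp continuous_subtype_val)

lemma DPath.continuous_trans {x y z : X} :
    Continuous (fun r : DPath x y × DPath y z => r.1.trans r.2) := by
  refine Continuous.subtype_mk ?_ _
  exact Path.continuous_trans.comp
    ((continuous_subtype_val.comp continuous_fst).prodMk (continuous_subtype_val.comp continuous_snd))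

lemma Trace.continuous_map (f : DMap X Y) {x y : X} :
    Continuous (Trace.map f : Trace x y → Trace (f x) (f y)) :=
  continuous_quot_lift _ (continuous_trace.comp (DPath.continuous_map f))

lemma Trace.continuous_trans_left {x y z : X} (b : Trace y z) :
    Continuous (fun a : Trace x y => a.trans b) := by
  induction b using Quot.ind with | mk q =>
  exact continuous_coinduced_dom.2 (continuous_trace.comp
    (DPath.continuous_trans.comp (Continuous.prodMk_left q)))

lemma Trace.continuous_trans_right {x y z : X} (a : Trace x y) :
    Continuous (fun b : Trace y z => a.trans b) := by
  induction a using Quot.ind with | mk p =>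
  exact continuous_coinduced_dom.2 (continuous_trace.comp
    (DPath.continuous_trans.comp (Continuous.prodMk_right p)))

lemma Trace.refl_trans {x y : X} (a : Trace x y) : (DPath.refl x).trace.trans a = a := by
  induction a using Quot.ind with | mk p =>
  refine (Quot.sound ?_).symm
  refine ⟨⟨fun t => ⟨max (2 * t - 1) 0, le_max_right _ _,
    max_le (by linarith [t.2.2]) zero_le_one⟩, by fun_prop⟩, ?_, ?_, ?_, ?_⟩
  · intro s t h
    have : (s : ℝ) ≤ t := h
    exact max_le_max (by change 2 * (s : ℝ) - 1 ≤ 2 * t - 1; linarith) le_rfl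
  · ext; simp
  · ext; norm_num
  · intro t
    change ((Path.refl x).trans p.1) t = _
    rw [Path.trans_apply]
    split_ifs with h
    · symm
      refine (congrArg p.1 (Subtype.ext ?_)).trans p.1.source
      exact max_eq_right (by linarith)
    · congr 1
      ext
      exact (max_eq_left (by linarith)).symm

lemma Trace.trans_refl {x y : X} (a : Trace x y) : a.trans (DPath.refl y).trace = a := by
  induction a using Quot.ind with | mk p =>
  refine (Quot.sound ?_).symm
  refine ⟨⟨fun t => ⟨min (2 * t) 1, le_min (by linarith [t.2.1]) zero_le_one,
    min_le_right _ _⟩, by fun_prop⟩, ?_, ?_, ?_, ?_⟩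
  · intro s t h
    have : (s : ℝ) ≤ t := h
    exact min_le_min (by change 2 * (s : ℝ) ≤ 2 * t; linarith) le_rfl
  · ext; simp
  · ext; norm_num
  · intro t
    change (p.1.trans (Path.refl y)) t = _
    rw [Path.trans_apply]
    split_ifs with h
    · congr 1
      ext
      exact (min_eq_left (by linarith)).symm
    · symm
      refine (congrArg p.1 (Subtype.ext ?_)).trans p.1.target
      exact min_eq_right (by linarith)

lemma Trace.trans_assoc {w x y z : X} (a : Trace w x) (b : Trace x y) (c : Trace y z) :
    (a.trans b).trans c = a.trans (b.trans c) := by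
  induction a using Quot.ind with | mk p =>
  induction b using Quot.ind with | mk q =>
  induction c using Quot.ind with | mk r =>
  refine (Quot.sound ?_).symm
  refine ⟨⟨fun t => ⟨_, Path.Homotopy.transAssocReparamAux_mem_I t⟩, by fun_prop⟩, ?_,
    Subtype.ext Path.Homotopy.transAssocReparamAux_zero,
    Subtype.ext Path.Homotopy.transAssocReparamAux_one, ?_⟩
  · intro s t h
    have : (s : ℝ) ≤ t := h
    change Path.Homotopy.transAssocReparamAux s ≤ Path.Homotopy.transAssocReparamAux t
    unfold Path.Homotopy.transAssocReparamAux
    split_ifs <;> linarith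
  · intro t
    exact congrArg (fun g => g t) (Path.Homotopy.trans_assoc_reparam p.1 q.1 r.1)

/-! ### Fundamental category and extension category -/

/-- The morphisms `x ⟶ y` of the fundamental category: path components of the trace space. -/
def Pi1 (x y : X) : Type := ZerothHomotopy (Trace x y)

/-- The class of a d-path in the fundamental category. -/
def DPath.cls {x y : X} (p : DPath x y) : Pi1 x y := ZerothHomotopy.mk p.trace

/-- Composition in the fundamental category. -/
def Pi1.trans {x y z : X} : Pi1 x y → Pi1 y z → Pi1 x z :=
  Quotient.map₂ Trace.trans (fun _ a' ha b _ hb =>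
    (Joined.map ha (Trace.continuous_trans_left b)).trans
      (Joined.map hb (Trace.continuous_trans_right a')))

/-- The map induced by a d-map on morphisms of the fundamental categories. -/
def Pi1.map (f : DMap X Y) {x y : X} : Pi1 x y → Pi1 (f x) (f y) :=
  Quotient.map (Trace.map f) (fun _ _ h => Joined.map h (Trace.continuous_map f))

lemma Pi1.refl_trans {x y : X} (a : Pi1 x y) : (DPath.refl x).cls.trans a = a := by
  induction a using Quotient.ind
  exact congrArg ZerothHomotopy.mk (Trace.refl_trans _)

lemma Pi1.trans_refl {x y : X} (a : Pi1 x y) : a.trans (DPath.refl y).cls = a := by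
  induction a using Quotient.ind
  exact congrArg ZerothHomotopy.mk (Trace.trans_refl _)

lemma Pi1.trans_assoc {w x y z : X} (a : Pi1 w x) (b : Pi1 x y) (c : Pi1 y z) :
    (a.trans b).trans c = a.trans (b.trans c) := by
  induction a using Quotient.ind
  induction b using Quotient.ind
  induction c using Quotient.ind
  exact congrArg ZerothHomotopy.mk (Trace.trans_assoc _ _ _)

end

section

variable (X : Type) [TopologicalSpace X] [DSpace X]

/-- The reachable pairs of points of `X`. -/
@[ext]
structure RPair where
  src : X
  tgt : X
  reach : Nonempty (DPath src tgt)

variable {X}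

/-- The image of a reachable pair under a d-map. -/
def RPair.map (f : DMap X X) (p : RPair X) : RPair X :=
  ⟨f p.src, f p.tgt, p.reach.map (DPath.map f)⟩

/-- Morphisms `(x, y) ⟶ (x', y')` of the extension category of the fundamental category: an
extension in the past, from `x'` to `x`, and an extension in the future, from `y` to `y'`. -/
@[ext]
structure Ext (p q : RPair X) where
  past : Pi1 q.src p.src
  fut : Pi1 p.tgt q.tgt

/-- The extension category of the fundamental category. -/
instance : Category (RPair X) where
  Hom := Ext
  id p := ⟨(DPath.refl p.src).cls, (DPath.refl p.tgt).cls⟩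
  comp e e' := ⟨e'.past.trans e.past, e.fut.trans e'.fut⟩
  id_comp _ := Ext.ext (Pi1.trans_refl _) (Pi1.refl_trans _)
  comp_id _ := Ext.ext (Pi1.refl_trans _) (Pi1.trans_refl _)
  assoc _ _ _ := Ext.ext (Pi1.trans_assoc _ _ _).symm (Pi1.trans_assoc _ _ _)

/-- The action of an endo-d-map on extension morphisms. -/
def Ext.map (f : DMap X X) {p q : RPair X} (e : p ⟶ q) : p.map f ⟶ q.map f :=
  ⟨Pi1.map f (Ext.past e), Pi1.map f (Ext.fut e)⟩

/-! ### Homotopy flows and inessential d-maps -/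

/-- The d-map `x ↦ (x, t)`. -/
def sliceAt (t : I) : DMap X (X × I) :=
  ⟨⟨fun x => (x, t), by fun_prop⟩, fun _ hp => ⟨hp, DSpace.isDPath_const (X := I) t⟩⟩

/-- The d-path `t ↦ (x, t)`. -/
lemma isDPath_fiber (x : X) : IsDPath (X := X × I) ⟨fun t => (x, t), by fun_prop⟩ :=
  ⟨DSpace.isDPath_const x, (monotone_id : Monotone (id : I → I))⟩

/-- A future homotopy flow from the identity to `f`: a d-map `H` on the product of `X` with the
directed interval such that `H ( · , 0)` is the identity and `H ( · , 1) = f`. -/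
structure FutureFlow (f : DMap X X) where
  H : DMap (X × I) X
  zero : ∀ x, H (x, 0) = x
  one : ∀ x, H (x, 1) = f x

/-- The level d-map `H_t` of a homotopy flow. -/
def FutureFlow.level {f : DMap X X} (h : FutureFlow f) (t : I) : DMap X X := h.H.comp (sliceAt t)

/-- The d-path `t ↦ H (x, t)` from `x` to `f x`. -/
def FutureFlow.line {f : DMap X X} (h : FutureFlow f) (x : X) : DPath x (f x) :=
  ⟨⟨⟨fun t => h.H (x, t), h.H.toContinuousMap.continuous.comp (by fun_prop)⟩, h.zero x, h.one x⟩,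
    h.H.map_dpath _ (isDPath_fiber x)⟩

/-- `f` is path space preserving with respect to the class `F` of maps: on all non-empty trace
spaces, `f` induces a map that belongs to `F`. -/
def IsPsp (F : MorphismProperty TopCat.{0}) (f : DMap X X) : Prop :=
  ∀ x y : X, Nonempty (DPath x y) →
    F (TopCat.ofHom ⟨(Trace.map f : Trace x y → Trace (f x) (f y)), Trace.continuous_map f⟩)

/-- `f` is future `F`-inessential: some future homotopy flow from the identity to `f` consists of
path space preserving d-maps. -/
def FutureInessential (F : MorphismProperty TopCat.{0}) (f : DMap X X) : Prop :=
  ∃ h : FutureFlow f, ∀ t, IsPsp F (h.level t)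

end

/-- The maps of topological spaces that are homotopy equivalences. -/
def homotopyEquivalences : MorphismProperty TopCat.{0} :=
  fun A B f => ∃ e : ContinuousMap.HomotopyEquiv A B, e.toFun = f.hom

/-- The maps of topological spaces that induce bijections on sets of path components. -/
def pi0Bijections : MorphismProperty TopCat.{0} :=
  fun A B f => Function.Bijective
    (Quotient.map f.hom (fun _ _ h => Joined.map h f.hom.continuous) :
      ZerothHomotopy A → ZerothHomotopy B)

/-! ### The quotient of a category by a class of morphisms -/

section

variable {C : Type} [Category.{0} C] (W : MorphismProperty C)

/-- The objects of the quotient category `C / W`: the classes of objects of `C` for the equivalence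
relation generated by the existence of a morphism in `W`. -/
def QuotObj : Type := Quot (fun a b : C => ∃ f : a ⟶ b, W f)

/-- A morphism of `C`, as an arrow between the classes of its source and target. -/
inductive QuotEdge : QuotObj W → QuotObj W → Type
  | mk {a b : C} (f : a ⟶ b) : QuotEdge (Quot.mk _ a) (Quot.mk _ b)

instance : Quiver (QuotObj W) := ⟨QuotEdge W⟩

/-- A morphism of `C`, in the free category on these arrows. -/
def quotGen {a b : C} (f : a ⟶ b) :
    (Paths.of (QuotObj W)).obj (Quot.mk _ a) ⟶ (Paths.of (QuotObj W)).obj (Quot.mk _ b) :=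
  (Paths.of (QuotObj W)).map (QuotEdge.mk f)

/-- The relations of `C / W`: those of `C`, and morphisms in `W` become identities. -/
inductive QuotRel : HomRel (Paths (QuotObj W))
  | id (a : C) : QuotRel (quotGen W (𝟙 a)) (𝟙 _)
  | comp {a b c : C} (f : a ⟶ b) (g : b ⟶ c) :
      QuotRel (quotGen W (f ≫ g)) (quotGen W f ≫ quotGen W g)
  | collapse {a b : C} (f : a ⟶ b) (hf : W f) :
      QuotRel (quotGen W f) (eqToHom (congrArg (Paths.of (QuotObj W)).obj (Quot.sound ⟨f, hf⟩)))

/-- The quotient category `C / W`, in which the morphisms in `W` become identities. -/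
abbrev QuotCat : Type := CategoryTheory.Quotient (QuotRel W)

/-- The quotient functor `C ⥤ C / W`. -/
def toQuotCat : C ⥤ QuotCat W where
  obj a := (CategoryTheory.Quotient.functor (QuotRel W)).obj ((Paths.of (QuotObj W)).obj (Quot.mk _ a))
  map f := (CategoryTheory.Quotient.functor (QuotRel W)).map (quotGen W f)
  map_id a := CategoryTheory.Quotient.sound _ (QuotRel.id a)
  map_comp f g := CategoryTheory.Quotient.sound _ (QuotRel.comp f g)

end

/-! ### The future pair component category -/

section

variable (X : Type) [TopologicalSpace X] [DSpace X] (F : MorphismProperty TopCat.{0})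

/-- The reachable pairs, as vertices of the quiver whose arrows are the extension morphisms and the
arrows `p ⟶ p.map f` for the future inessential d-maps `f`. -/
structure MixedPair (F : MorphismProperty TopCat.{0}) where
  pair : RPair X

/-- The arrows of this quiver. -/
inductive MixedEdge : MixedPair X F → MixedPair X F → Type
  | ext {p q : RPair X} (e : p ⟶ q) : MixedEdge ⟨p⟩ ⟨q⟩
  | act (f : DMap X X) (hf : FutureInessential F f) (p : RPair X) : MixedEdge ⟨p⟩ ⟨p.map f⟩

instance : Quiver (MixedPair X F) := ⟨MixedEdge X F⟩

variable {X}

/-- A reachable pair, as an object of the free category. -/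
def mixedObj (p : RPair X) : Paths (MixedPair X F) := (Paths.of (MixedPair X F)).obj ⟨p⟩

/-- An extension morphism, in the free category. -/
def extGen {p q : RPair X} (e : p ⟶ q) : mixedObj F p ⟶ mixedObj F q :=
  (Paths.of (MixedPair X F)).map (MixedEdge.ext e)

/-- The morphism given by an inessential d-map, in the free category. -/
def actGen (f : DMap X X) (hf : FutureInessential F f) (p : RPair X) :
    mixedObj F p ⟶ mixedObj F (p.map f) :=
  (Paths.of (MixedPair X F)).map (MixedEdge.act f hf p)

/-- The pair `(x, f y)`, for a future homotopy flow from the identity to `f`. -/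
def RPair.extendFlow {f : DMap X X} (h : FutureFlow f) (p : RPair X) : RPair X :=
  ⟨p.src, f p.tgt, p.reach.map fun c => c.trans (h.line p.tgt)⟩

/-- The extension `(x, y) ⟶ (x, f y)` along the flow line of `y`. -/
def FutureFlow.extFut {f : DMap X X} (h : FutureFlow f) (p : RPair X) : p ⟶ p.extendFlow h :=
  (⟨(DPath.refl p.src).cls, (h.line p.tgt).cls⟩ : Ext p (p.extendFlow h))

/-- The extension `(f x, f y) ⟶ (x, f y)` along the flow line of `x`. -/
def FutureFlow.extPast {f : DMap X X} (h : FutureFlow f) (p : RPair X) :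
    p.map f ⟶ p.extendFlow h :=
  (⟨(h.line p.src).cls, (DPath.refl (f p.tgt)).cls⟩ : Ext (p.map f) (p.extendFlow h))

/-- The relations between extension morphisms and inessential d-maps: the relations of the extension
category, those of the monoid of inessential d-maps, the functoriality of the action of inessential
d-maps on extension morphisms, and the commutation relation given by a future homotopy flow. -/
inductive MixedRel : HomRel (Paths (MixedPair X F))
  | ext_id (p : RPair X) : MixedRel (extGen F (𝟙 p)) (𝟙 _)
  | ext_comp {p q r : RPair X} (e : p ⟶ q) (e' : q ⟶ r) :
      MixedRel (extGen F (e ≫ e')) (extGen F e ≫ extGen F e')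
  | act_id (h : FutureInessential F (DMap.id X)) (p : RPair X) :
      MixedRel (actGen F (DMap.id X) h p) (𝟙 (mixedObj F p))
  | act_comp (f g : DMap X X) (hf : FutureInessential F f) (hg : FutureInessential F g)
      (hgf : FutureInessential F (g.comp f)) (p : RPair X) :
      MixedRel (actGen F (g.comp f) hgf p) (actGen F f hf p ≫ actGen F g hg (p.map f))
  | act_ext (f : DMap X X) (hf : FutureInessential F f) {p q : RPair X} (e : p ⟶ q) :
      MixedRel (actGen F f hf p ≫ extGen F (Ext.map f e)) (extGen F e ≫ actGen F f hf q)
  | flow (f : DMap X X) (hf : FutureInessential F f) (h : FutureFlow f) (p : RPair X) :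
      MixedRel (extGen F (h.extFut p)) (actGen F f hf p ≫ extGen F (h.extPast p))

variable (X)

/-- The category whose objects are the reachable pairs and whose morphisms are the finite
compositions of extension morphisms and future inessential d-maps, modulo the relations above. -/
abbrev MixedCat : Type := CategoryTheory.Quotient (MixedRel (X := X) F)

/-- The functor from the extension category to this category. -/
def extFunctor : RPair X ⥤ MixedCat X F where
  obj p := (CategoryTheory.Quotient.functor (MixedRel F)).obj (mixedObj F p)
  map e := (CategoryTheory.Quotient.functor (MixedRel F)).map (extGen F e)
  map_id p := CategoryTheory.Quotient.sound _ (MixedRel.ext_id p)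
  map_comp e e' := CategoryTheory.Quotient.sound _ (MixedRel.ext_comp e e')

/-- The morphisms of this category that are given by future inessential d-maps. -/
inductive Inessential : MorphismProperty (MixedCat X F)
  | act (f : DMap X X) (hf : FutureInessential F f) (p : RPair X) :
      Inessential ((CategoryTheory.Quotient.functor (MixedRel F)).map (actGen F f hf p))

/-- The future pair component category of `X` with respect to `F`. -/
abbrev FuturePairComponents : Type := QuotCat (Inessential X F)

/-- The canonical functor from the extension category to the future pair component category. It
sends a reachable pair to its component, and an extension morphism to the morphism that it
represents. -/
def componentFunctor : RPair X ⥤ FuturePairComponents X F :=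
  extFunctor X F ⋙ toQuotCat (Inessential X F)

end

/-! ### The cubical complex `D` -/

/-- The four two-dimensional cells `A`, `B₁`, `B₂`, `C`; the indices `1`, `2` are the elements `0`,
`1` of `Fin 2`. -/
inductive Cell
  | A
  | B (i : Fin 2)
  | C

/-- The disjoint union of four squares. -/
abbrev Squares : Type := (_ : Cell) × (Fin 2 → I)

instance : TopologicalSpace Cell := ⊥

/-- The identifications of the edges: the face `x i = 1` of `A` is glued to the face `x i = 0` of
`B i`, and the face `x i = 1` of `B i` is glued to the face `x i = 0` of `C`. -/
inductive Glue : Squares → Squares → Prop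
  | AB (i : Fin 2) (x : Fin 2 → I) :
      Glue ⟨.A, Function.update x i 1⟩ ⟨.B i, Function.update x i 0⟩
  | BC (i : Fin 2) (x : Fin 2 → I) :
      Glue ⟨.B i, Function.update x i 1⟩ ⟨.C, Function.update x i 0⟩

/-- The cubical complex `D`: four squares glued along edges, with the quotient topology. -/
def D : Type := Quot Glue

instance : TopologicalSpace D := inferInstanceAs (TopologicalSpace (Quot Glue))

/-- The point `[c; x]` of `D`. -/
def D.mk (c : Cell) (x : Fin 2 → I) : D := Quot.mk _ ⟨c, x⟩

/-- The map `p` is on `[a, b]` a finite concatenation of coordinatewise non-decreasing paths in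
cells. -/
inductive CellwiseDirected (p : I → D) : I → I → Prop
  | cell {a b : I} (hab : a ≤ b) (c : Cell) (q : I → Fin 2 → I)
      (hc : ContinuousOn q (Set.Icc a b)) (hm : MonotoneOn q (Set.Icc a b))
      (h : ∀ t ∈ Set.Icc a b, p t = D.mk c (q t)) : CellwiseDirected p a b
  | concat {a b c : I} : CellwiseDirected p a b → CellwiseDirected p b c → CellwiseDirected p a c

lemma CellwiseDirected.le {p : I → D} {a b : I} (h : CellwiseDirected p a b) : a ≤ b := by
  induction h with
  | cell hab => exact hab
  | concat _ _ h1 h2 => exact h1.trans h2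

lemma CellwiseDirected.comp {p : I → D} {a b : I} (h : CellwiseDirected p a b) {r : I → D}
    {φ : I → I} (hφ : Continuous φ) (hm : Monotone φ) {c d : I} (hcd : c ≤ d) (hc : a ≤ φ c)
    (hd : φ d ≤ b) (hr : ∀ t ∈ Set.Icc c d, r t = p (φ t)) : CellwiseDirected r c d := by
  induction h generalizing c d with
  | @cell a b hab k q hqc hqm hq =>
    have hmaps : Set.MapsTo φ (Set.Icc c d) (Set.Icc a b) :=
      fun t ht => ⟨hc.trans (hm ht.1), (hm ht.2).trans hd⟩
    exact .cell hcd k (q ∘ φ) (hqc.comp hφ.continuousOn hmaps)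
      (hqm.comp (hm.monotoneOn _) hmaps) (fun t ht => (hr t ht).trans (hq _ (hmaps ht)))
  | @concat a m b _ _ h1 h2 =>
    rcases le_total (φ d) m with hdm | hdm
    · exact h1 hcd hc hdm hr
    rcases le_total m (φ c) with hcm | hcm
    · exact h2 hcd hcm hd hr
    obtain ⟨e, he, hem⟩ := intermediate_value_Icc hcd hφ.continuousOn ⟨hcm, hdm⟩
    exact (h1 he.1 hc hem.le fun t ht => hr t ⟨ht.1, ht.2.trans he.2⟩).concat
      (h2 he.2 hem.ge hd fun t ht => hr t ⟨he.1.trans ht.1, ht.2⟩)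

/-- The d-structure of `D`: the d-paths are the cellwise directed paths. -/
instance : DSpace D where
  IsDPath p := CellwiseDirected p 0 1
  isDPath_const := by
    rintro ⟨c, x⟩
    exact .cell zero_le_one c (fun _ => x) continuousOn_const (fun _ _ _ _ _ => le_rfl)
      (fun _ _ => rfl)
  isDPath_trans p q hp hq := by
    have hm : (⟨1 / 2, by norm_num, by norm_num⟩ : I) ≤ 1 := unitInterval.le_one'
    refine CellwiseDirected.concat (b := ⟨1 / 2, by norm_num, by norm_num⟩) ?_ ?_
    · refine hp.comp (φ := fun t => Set.projIcc 0 1 zero_le_one (2 * t : ℝ))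
        (continuous_projIcc.comp (by fun_prop)) ?_ unitInterval.nonneg' unitInterval.nonneg'
        unitInterval.le_one' ?_
      · intro s t h
        have : (s : ℝ) ≤ t := h
        exact Set.monotone_projIcc _ (by linarith)
      · intro t ht
        have h : (t : ℝ) ≤ 1 / 2 := ht.2
        change (p.trans q) t = p _
        rw [Path.trans_apply, dif_pos h]
        congr 1
        exact (Set.projIcc_of_mem _ _).symm
    · refine hq.comp (φ := fun t => Set.projIcc 0 1 zero_le_one (2 * t - 1 : ℝ))
        (continuous_projIcc.comp (by fun_prop)) ?_ hm unitInterval.nonneg'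
        unitInterval.le_one' ?_
      · intro s t h
        have : (s : ℝ) ≤ t := h
        exact Set.monotone_projIcc _ (by linarith)
      · intro t ht
        have h : (1 / 2 : ℝ) ≤ t := ht.1
        change (p.trans q) t = q _
        rw [Path.trans_apply]
        split_ifs with h'
        · have e : (t : ℝ) = 1 / 2 := le_antisymm h' h
          have e1 : (⟨2 * (t : ℝ), (unitInterval.mul_pos_mem_iff zero_lt_two).2 ⟨t.2.1, h'⟩⟩ : I)
              = 1 := by ext; simp [e]
          have e2 : Set.projIcc (0 : ℝ) 1 zero_le_one (2 * t - 1 : ℝ) = (0 : I) := by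
            rw [e]; norm_num
          rw [e1, p.target]
          exact ((congrArg q e2).trans q.source).symm
        · congr 1
          exact (Set.projIcc_of_mem _ _).symm
  isDPath_comp p φ hφ hp :=
    hp.comp φ.continuous hφ zero_le_one unitInterval.nonneg' unitInterval.le_one' (fun _ _ => rfl)

/-- The coordinates of a point. Points `[A; x]` and `[C; x]` have coordinates `x`; on `B i` without
its face in `A`, the `i`-th coordinate is lowered by one, so that coordinates are compatible with
the identification of faces of `B i` and `C`. -/
def coordRep : Squares → Fin 2 → ℝ
  | ⟨.A, x⟩ => fun j => x j
  | ⟨.B i, x⟩ => fun j => if j = i then (if x i = 0 then 1 else (x i : ℝ) - 1) else x j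
  | ⟨.C, x⟩ => fun j => x j

/-- The coordinates of a point of `D`. -/
def coord : D → Fin 2 → ℝ :=
  Quot.lift coordRep (by
    rintro _ _ (⟨i, x⟩ | ⟨i, x⟩) <;> funext j <;> by_cases h : j = i <;>
      simp [coordRep, h])

/-- The closed cell `c` in `D`. -/
def cell (c : Cell) : Set D := Set.range (D.mk c)

/-- The vertex `a⁺ = [A; (1, 1)]`. -/
def aPlus : D := D.mk .A (fun _ => 1)

/-- The half-open edges `a₁ = {[A; (1, t)] | t < 1}` and `a₂ = {[A; (t, 1)] | t < 1}`. -/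
def edgeA (i : Fin 2) : Set D := {p | ∃ x : Fin 2 → I, x i = 1 ∧ x (1 - i) < 1 ∧ p = D.mk .A x}

/-- `⌞A = A \ (a₁ ∪ a₂ ∪ a⁺)`. -/
def lowA : Set D := cell .A \ (edgeA 0 ∪ edgeA 1 ∪ {aPlus})

/-- The half-open edges `b₁ = {[B₁; (t, 1)] | t > 0}` and `b₂ = {[B₂; (1, t)] | t > 0}`. -/
def edgeB (i : Fin 2) : Set D := {p | ∃ x : Fin 2 → I, x (1 - i) = 1 ∧ 0 < x i ∧ p = D.mk (.B i) x}

/-- `⌟B₁ = B₁ \ (a₁ ∪ b₁ ∪ a⁺)` and `⌜B₂ = B₂ \ (a₂ ∪ b₂ ∪ a⁺)`. -/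
def lowB (i : Fin 2) : Set D := cell (.B i) \ (edgeA i ∪ edgeB i ∪ {aPlus})

/-- The half-open edges `c₁ = {[C; (1, t)] | t < 1}` and `c₂ = {[C; (t, 1)] | t < 1}`. -/
def edgeC (i : Fin 2) : Set D := {p | ∃ x : Fin 2 → I, x i = 1 ∧ x (1 - i) < 1 ∧ p = D.mk .C x}

/-- The vertex `c⁺ = [C; (1, 1)]`. -/
def cPlus : D := D.mk .C (fun _ => 1)

/-- `⌞C = C \ (c₁ ∪ c₂ ∪ c⁺)`. -/
def lowC : Set D := cell .C \ (edgeC 0 ∪ edgeC 1 ∪ {cPlus})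

/-- The edges `b₁ ∪ c₂` and `b₂ ∪ c₁`. -/
def topEdge (i : Fin 2) : Set D := edgeB i ∪ edgeC (1 - i)

/-- The decorations `=` and `<`. -/
inductive Deco
  | eq
  | lt

/-- A decoration as a comparison result. -/
def Deco.ord : Deco → Ordering
  | .eq => .eq
  | .lt => .lt

/-- The `i`-th coordinates of the two points of a pair are in the relation `=`, `<` or `>`. -/
def Compare (i : Fin 2) (o : Ordering) : Set (D × D) :=
  {p | o.Compares (coord p.1 i) (coord p.2 i)}

/-- The list of the components. An index `i` stands for the numbers `1`, `2`; decorations range over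
`=`, `<` (`Deco`) or over `=`, `<`, `>` (`Ordering`). -/
inductive Label
  | AA (d : Fin 2 → Deco)
  | Aa (i : Fin 2) (d : Deco)
  | AaPlus
  | aa (i : Fin 2) (d : Deco)
  | aaPlus (i : Fin 2)
  | aPlusaPlus
  | AC (d : Fin 2 → Deco)
  | ABC (i : Fin 2) (d : Deco)
  | Abc (i : Fin 2) (o : Ordering)
  | AcPlus
  | aBC (i : Fin 2) (d : Deco)
  | abcSame (i : Fin 2)
  | abcOther (i : Fin 2) (o : Ordering)
  | acPlus (i : Fin 2)
  | aPlusbc (i : Fin 2)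
  | aPluscPlus
  | BCBC
  | BCbc (i : Fin 2)
  | BCcPlus
  | bcbc (i : Fin 2)
  | bccPlus (i : Fin 2)
  | cPluscPlus

/-- The set of pairs described by a label; a component consists of the reachable pairs in it. -/
def Label.pairs : Label → Set (D × D)
  | AA d => lowA ×ˢ lowA ∩ Compare 0 (d 0).ord ∩ Compare 1 (d 1).ord
  | Aa i d => lowA ×ˢ edgeA i ∩ Compare (1 - i) d.ord
  | AaPlus => lowA ×ˢ {aPlus}
  | aa i d => edgeA i ×ˢ edgeA i ∩ Compare (1 - i) d.ord
  | aaPlus i => edgeA i ×ˢ {aPlus}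
  | aPlusaPlus => {aPlus} ×ˢ {aPlus}
  | AC d => lowA ×ˢ lowC ∩ Compare 0 (d 0).ord ∩ Compare 1 (d 1).ord
  | ABC i d => lowA ×ˢ (lowB i ∪ lowC) ∩ Compare i .gt ∩ Compare (1 - i) d.ord
  | Abc i o => lowA ×ˢ topEdge i ∩ Compare i o
  | AcPlus => lowA ×ˢ {cPlus}
  | aBC i d => edgeA i ×ˢ (lowB i ∪ lowC) ∩ Compare (1 - i) d.ord
  | abcSame i => edgeA i ×ˢ topEdge i
  | abcOther i o => edgeA i ×ˢ topEdge (1 - i) ∩ Compare (1 - i) o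
  | acPlus i => edgeA i ×ˢ {cPlus}
  | aPlusbc i => {aPlus} ×ˢ topEdge i
  | aPluscPlus => {aPlus} ×ˢ {cPlus}
  | BCBC => (lowB 0 ∪ lowB 1 ∪ lowC) ×ˢ (lowB 0 ∪ lowB 1 ∪ lowC)
  | BCbc i => (lowB 0 ∪ lowB 1 ∪ lowC) ×ˢ topEdge i
  | BCcPlus => (lowB 0 ∪ lowB 1 ∪ lowC) ×ˢ {cPlus}
  | bcbc i => topEdge i ×ˢ topEdge i
  | bccPlus i => topEdge i ×ˢ {cPlus}
  | cPluscPlus => {cPlus} ×ˢ {cPlus}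

end DirTop

end

open DirTop

noncomputable section

namespace DirTop

open DirTop.DSpace (IsDPath)

/-! ### Functions and strips on `D` -/

/-! `D` is the union of two strips `A ∪ B i ∪ C`, each a copy of `[0, 3] × [0, 1]`, glued along `A`
and `C`. A d-path is the same thing as a coordinatewise monotone path in one strip (`isDPath_iff`):
a change of strip can only happen at a point of `A` or `C`, and then one of the two halves stays in
that square, hence lies in both strips. Monotone paths in a strip deform linearly to the straight
path between the same end points. Therefore each trace space is homotopy equivalent to the discrete
set of strips that are used; it has two components exactly between `[A; a]` and `[C; b]` with `a ≤
b`, and at most one otherwise (`exists_ne_iff`). For maps between such spaces, homotopy equivalence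
and bijectivity on path components coincide, so being inessential does not depend on `F`
(`isPsp_iff`), and independence of the whole category follows from its universal property
(`exists_lift`).

Invariance of the classes. An inessential `f` moves points forward and preserves and reflects the
property of having several classes of d-paths, that is, the order relation between `A` and `C`.
Together with continuity this forces `f` to act on `A` and `C` by the same strictly increasing
functions of the single coordinates; a point of `B i` stays there, or enters `C` strictly below the
image of the edge where `C` begins (`IsFutureMap.exists_actsBy`). Hence regions and the comparisons
recorded by the labels are preserved (`IsFutureMap.label_map`).

Transitivity. Conversely, suitable monotone functions `Φ 0`, `Φ 1` of the long coordinates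
(`Profile`) define inessential maps `moveMap`. They push any finite set of points into `A ∪ C`, and
make any two finite configurations there with the same order type coincide (`exists_moveMap_eq`).
This settles all labels whose pairs start in `A` or end in `c⁺`, because there the label determines
the order type.

In the remaining `Thin` classes, which involve only `E` and the two outer edges, the order type
varies, and the identifications come from extensions that represent identities. An extension in
direction `i` inside `C` is the image of an extension inside `B i` under one inessential map, while
another inessential map collapses that same extension to an identity (`arr_eq_id_of_coord_lt`). If
the end point lies on the boundary, it is fixed by a flow that moves the start point, and the flow
relation does the rest (`arr_eq_id_of_past`). Consequently a morphism into a thin component that is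
represented by an extension depends only on the labels of its source and target
(`arr_eq_of_label_eq`).

Morphisms. Two extensions composable in the quotient can be replaced by extensions that are really
composable: the middle pairs are moved together, or, in the thin case, the first extension is
replaced by another one between pairs with the same labels. So every morphism is an extension. After
moving into `A ∪ C` it is determined by the order type of four points and the strips of its two
parts, which is finite information. The category is not trivial since no d-path leads from `c⁺` to
`a⁺`. -/

lemma one_sub_ne (i : Fin 2) : 1 - i ≠ i := by fin_cases i <;> decide

lemma ne_one_sub (i : Fin 2) : i ≠ 1 - i := (one_sub_ne i).symm

lemma one_sub_one_sub (i : Fin 2) : 1 - (1 - i) = i := by fin_cases i <;> decide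

lemma eq_or_eq_one_sub (i k : Fin 2) : k = i ∨ k = 1 - i := by
  fin_cases i <;> fin_cases k <;> decide

lemma forall_fin_two_iff (i : Fin 2) {P : Fin 2 → Prop} : (∀ k, P k) ↔ P i ∧ P (1 - i) :=
  ⟨fun h => ⟨h _, h _⟩, fun h k => by rcases eq_or_eq_one_sub i k with rfl | rfl <;> simp [h]⟩

lemma glue_AB (i : Fin 2) (x : Fin 2 → I) :
    D.mk .A (Function.update x i 1) = D.mk (.B i) (Function.update x i 0) :=
  Quot.sound (Glue.AB i x)

lemma glue_BC (i : Fin 2) (x : Fin 2 → I) :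
    D.mk (.B i) (Function.update x i 1) = D.mk .C (Function.update x i 0) :=
  Quot.sound (Glue.BC i x)

/-- A real function on `D` given by compatible functions on the cells. -/
def D.real (g : Cell → (Fin 2 → I) → ℝ)
    (hAB : ∀ i x, g .A (Function.update x i 1) = g (.B i) (Function.update x i 0))
    (hBC : ∀ i x, g (.B i) (Function.update x i 1) = g .C (Function.update x i 0)) : D → ℝ :=
  Quot.lift (fun s => g s.1 s.2) (by
    rintro _ _ (⟨i, x⟩ | ⟨i, x⟩)
    · exact hAB i x
    · exact hBC i x)

lemma continuous_mk (c : Cell) : Continuous (D.mk c) :=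
  continuous_quot_mk.comp continuous_sigmaMk

lemma D.continuous_iff {Y : Type} [TopologicalSpace Y] {f : D → Y} :
    Continuous f ↔ ∀ c, Continuous fun x => f (D.mk c x) := by
  refine ⟨fun h c => h.comp (continuous_mk c), fun h => ?_⟩
  exact continuous_coinduced_dom.2 (continuous_sigma h)

/-- Height: `0` on `A`, `1` on `C`, and the transverse coordinate on `B i`. -/
def height : D → ℝ :=
  D.real (fun c x => match c with | .A => 0 | .B i => x i | .C => 1) (by simp) (by simp)

@[simp] lemma height_A (x : Fin 2 → I) : height (D.mk .A x) = 0 := rfl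
@[simp] lemma height_B (i : Fin 2) (x : Fin 2 → I) : height (D.mk (.B i) x) = x i := rfl
@[simp] lemma height_C (x : Fin 2 → I) : height (D.mk .C x) = 1 := rfl

lemma continuous_height : Continuous height := by
  rw [D.continuous_iff]
  rintro (_ | i | _)
  · simpa using! continuous_const
  · simp only [height_B]; fun_prop
  · simpa using! continuous_const

/-- A function that vanishes exactly outside the interior of `B i` and its two free edges. -/
def bulge (i : Fin 2) : D → ℝ :=
  D.real (fun c x => match c with
    | .A => 0 | .B k => if k = i then (x i : ℝ) * (1 - x i) else 0 | .C => 0)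
    (by intro k x; by_cases h : k = i <;> simp [h])
    (by intro k x; by_cases h : k = i <;> simp [h])

@[simp] lemma bulge_A (i : Fin 2) (x : Fin 2 → I) : bulge i (D.mk .A x) = 0 := rfl
lemma bulge_B (i k : Fin 2) (x : Fin 2 → I) :
    bulge i (D.mk (.B k) x) = if k = i then (x i : ℝ) * (1 - x i) else 0 := rfl
@[simp] lemma bulge_B_self (i : Fin 2) (x : Fin 2 → I) :
    bulge i (D.mk (.B i) x) = (x i : ℝ) * (1 - x i) := if_pos rfl
@[simp] lemma bulge_B_other (i : Fin 2) (x : Fin 2 → I) :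
    bulge (1 - i) (D.mk (.B i) x) = 0 := if_neg (ne_one_sub i)
@[simp] lemma bulge_C (i : Fin 2) (x : Fin 2 → I) : bulge i (D.mk .C x) = 0 := rfl

lemma continuous_bulge (i : Fin 2) : Continuous (bulge i) := by
  rw [D.continuous_iff]
  rintro (_ | k | _)
  · simpa using! continuous_const
  · by_cases h : k = i
    · simp only [bulge_B, if_pos h]; fun_prop
    · simpa only [bulge_B, if_neg h] using! continuous_const
  · simpa using! continuous_const

/-- The long coordinate on the strip `A ∪ B i ∪ C ≅ [0, 3] × [0, 1]`, extended to `D`. -/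
def long (i : Fin 2) : D → ℝ :=
  D.real (fun c x => match c with
    -- On the other square the value interpolates between `x i` on its edge in `A` and `x i + 2` on
    -- its edge in `C`. Off the strip only continuity matters.
    | .A => x i | .B k => if k = i then (x i : ℝ) + 1 else x i + 2 * x (1 - i) | .C => x i + 2)
    (by
      intro k x
      rcases eq_or_eq_one_sub i k with rfl | rfl
      · simp
      · simp [one_sub_ne, ne_one_sub])
    (by
      intro k x
      rcases eq_or_eq_one_sub i k with rfl | rfl
      · simp; norm_num
      · simp [one_sub_ne, ne_one_sub])

@[simp] lemma long_A (i : Fin 2) (x : Fin 2 → I) : long i (D.mk .A x) = x i := rfl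
lemma long_B (i k : Fin 2) (x : Fin 2 → I) :
    long i (D.mk (.B k) x) = if k = i then (x i : ℝ) + 1 else x i + 2 * x (1 - i) := rfl
@[simp] lemma long_B_self (i : Fin 2) (x : Fin 2 → I) :
    long i (D.mk (.B i) x) = x i + 1 := if_pos rfl
@[simp] lemma long_C (i : Fin 2) (x : Fin 2 → I) : long i (D.mk .C x) = x i + 2 := rfl

lemma continuous_long (i : Fin 2) : Continuous (long i) := by
  rw [D.continuous_iff]
  rintro (_ | k | _)
  · simp only [long_A]; fun_prop
  · by_cases h : k = i
    · simp only [long_B, if_pos h]; fun_prop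
    · simp only [long_B, if_neg h]; fun_prop
  · simp only [long_C]; fun_prop

/-- The short coordinate on the strip `A ∪ B i ∪ C ≅ [0, 3] × [0, 1]`, extended to `D`. -/
def short (i : Fin 2) : D → ℝ :=
  D.real (fun c x => match c with
    -- Off the strip the value is again only an interpolation, from `1` on the edge in `A` to `0` on
    -- the edge in `C`.
    | .A => x (1 - i) | .B k => if k = i then (x (1 - i) : ℝ) else 1 - x (1 - i)
    | .C => x (1 - i))
    (by
      intro k x
      rcases eq_or_eq_one_sub i k with rfl | rfl
      · simp [one_sub_ne]
      · simp [one_sub_ne])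
    (by
      intro k x
      rcases eq_or_eq_one_sub i k with rfl | rfl
      · simp [one_sub_ne]
      · simp [one_sub_ne])

@[simp] lemma short_A (i : Fin 2) (x : Fin 2 → I) : short i (D.mk .A x) = x (1 - i) := rfl
lemma short_B (i k : Fin 2) (x : Fin 2 → I) :
    short i (D.mk (.B k) x) = if k = i then (x (1 - i) : ℝ) else 1 - x (1 - i) := rfl
@[simp] lemma short_B_self (i : Fin 2) (x : Fin 2 → I) :
    short i (D.mk (.B i) x) = x (1 - i) := if_pos rfl
@[simp] lemma short_C (i : Fin 2) (x : Fin 2 → I) : short i (D.mk .C x) = x (1 - i) := rfl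

lemma continuous_short (i : Fin 2) : Continuous (short i) := by
  rw [D.continuous_iff]
  rintro (_ | k | _)
  · simp only [short_A]; fun_prop
  · by_cases h : k = i
    · simp only [short_B, if_pos h]; fun_prop
    · simp only [short_B, if_neg h]; fun_prop
  · simp only [short_C]; fun_prop

/-- The strip `A ∪ B i ∪ C`. -/
def strip (i : Fin 2) : Set D := {z | bulge (1 - i) z = 0}

/-- Closedness is used twice: to paste maps defined on the strips, and to see that the strip of a
d-path is locally constant. -/
lemma isClosed_strip (i : Fin 2) : IsClosed (strip i) :=
  isClosed_eq (continuous_bulge _) continuous_const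

@[simp] lemma A_mem_strip (i : Fin 2) (x : Fin 2 → I) : D.mk .A x ∈ strip i := bulge_A _ x
@[simp] lemma B_mem_strip (i : Fin 2) (x : Fin 2 → I) : D.mk (.B i) x ∈ strip i := bulge_B_other i x
@[simp] lemma C_mem_strip (i : Fin 2) (x : Fin 2 → I) : D.mk .C x ∈ strip i := bulge_C _ x

/-- Every point has a unique normal form `[A; x]`, `[C; x]` or `[B i; x]` with `0 < x i < 1`. -/
inductive Normal : D → Prop
  | A (x : Fin 2 → I) : Normal (D.mk .A x)
  | B (i : Fin 2) (x : Fin 2 → I) (h0 : 0 < x i) (h1 : x i < 1) : Normal (D.mk (.B i) x)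
  | C (x : Fin 2 → I) : Normal (D.mk .C x)

lemma mk_B_of_eq_zero {i : Fin 2} {x : Fin 2 → I} (h : x i = 0) :
    D.mk (.B i) x = D.mk .A (Function.update x i 1) := by
  rw [glue_AB, ← h, Function.update_eq_self]

lemma mk_B_of_eq_one {i : Fin 2} {x : Fin 2 → I} (h : x i = 1) :
    D.mk (.B i) x = D.mk .C (Function.update x i 0) := by
  rw [← glue_BC, ← h, Function.update_eq_self]

lemma normal (z : D) : Normal z := by
  obtain ⟨⟨c, x⟩⟩ := z
  change Normal (D.mk c x)
  rcases c with _ | i | _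
  · exact .A x
  · rcases eq_or_ne (x i) 0 with h | h
    · rw [mk_B_of_eq_zero h]; exact .A _
    rcases eq_or_ne (x i) 1 with h' | h'
    · rw [mk_B_of_eq_one h']; exact .C _
    exact .B i x (unitInterval.pos_iff_ne_zero.2 h) (unitInterval.lt_one_iff_ne_one.2 h')
  · exact .C x

lemma bulge_pos {i : Fin 2} {x : Fin 2 → I} (h0 : 0 < x i) (h1 : x i < 1) :
    0 < bulge i (D.mk (.B i) x) := by
  have h0 : (0 : ℝ) < x i := h0
  have h1 : (x i : ℝ) < 1 := h1
  rw [bulge_B_self]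
  exact mul_pos h0 (by linarith)

lemma mem_strip_B {i k : Fin 2} {x : Fin 2 → I} (h0 : 0 < x k) (h1 : x k < 1) :
    D.mk (.B k) x ∈ strip i ↔ k = i := by
  rcases eq_or_eq_one_sub i k with rfl | rfl
  · simp
  · exact iff_of_false (bulge_pos h0 h1).ne' (one_sub_ne i)

lemma strip_cases {i : Fin 2} {z : D} (h : z ∈ strip i) :
    (∃ x, z = D.mk .A x) ∨ (∃ x : Fin 2 → I, 0 < x i ∧ x i < 1 ∧ z = D.mk (.B i) x) ∨
      ∃ x, z = D.mk .C x := by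
  rcases normal z with x | ⟨k, x, h0, h1⟩ | x
  · exact .inl ⟨x, rfl⟩
  · obtain rfl := (mem_strip_B h0 h1).1 h
    exact .inr (.inl ⟨x, h0, h1, rfl⟩)
  · exact .inr (.inr ⟨x, rfl⟩)

lemma exists_mem_strip (z : D) : ∃ i, z ∈ strip i := by
  rcases normal z with x | ⟨k, x, h0, h1⟩ | x
  · exact ⟨0, by simp⟩
  · exact ⟨k, by simp⟩
  · exact ⟨0, by simp⟩

/-- The point of the cube with `i`-th coordinate `u` and other coordinate `v`, truncated. -/
def vec (i : Fin 2) (u v : ℝ) : Fin 2 → I :=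
  fun k => if k = i then Set.projIcc 0 1 zero_le_one u else Set.projIcc 0 1 zero_le_one v

@[simp] lemma vec_self (i : Fin 2) (u v : ℝ) : vec i u v i = Set.projIcc 0 1 zero_le_one u :=
  if_pos rfl

@[simp] lemma vec_other (i : Fin 2) (u v : ℝ) :
    vec i u v (1 - i) = Set.projIcc 0 1 zero_le_one v :=
  if_neg (one_sub_ne i)

lemma vec_coords (i : Fin 2) (x : Fin 2 → I) : vec i (x i) (x (1 - i)) = x := by
  funext k
  rcases eq_or_eq_one_sub i k with rfl | rfl <;> simp

lemma continuous_vec (i : Fin 2) : Continuous fun p : ℝ × ℝ => vec i p.1 p.2 := by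
  refine continuous_pi fun k => ?_
  rcases eq_or_eq_one_sub i k with rfl | rfl
  · simp only [vec_self]; exact continuous_projIcc.comp continuous_fst
  · simp only [vec_other]; exact continuous_projIcc.comp continuous_snd

lemma monotone_vec (i : Fin 2) : Monotone fun p : ℝ × ℝ => vec i p.1 p.2 := by
  intro p q h k
  rcases eq_or_eq_one_sub i k with rfl | rfl
  · simp only [vec_self]; exact Set.monotone_projIcc _ h.1
  · simp only [vec_other]; exact Set.monotone_projIcc _ h.2

/-- The parametrization of the strip `A ∪ B i ∪ C` by `[0, 3] × [0, 1]`, extended to the plane. -/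
def emb (i : Fin 2) (u v : ℝ) : D :=
  if u ≤ 1 then D.mk .A (vec i u v) else
    if u ≤ 2 then D.mk (.B i) (vec i (u - 1) v) else D.mk .C (vec i (u - 2) v)

lemma update_vec (i : Fin 2) (u v w : ℝ) :
    Function.update (vec i u v) i (Set.projIcc 0 1 zero_le_one w) = vec i w v := by
  funext k
  rcases eq_or_eq_one_sub i k with rfl | rfl
  · simp
  · simp [one_sub_ne]

lemma projIcc_I_one : Set.projIcc (0 : ℝ) 1 zero_le_one 1 = (1 : I) := Set.projIcc_right _

lemma projIcc_I_zero : Set.projIcc (0 : ℝ) 1 zero_le_one 0 = (0 : I) := Set.projIcc_left _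

lemma glue_AB_vec (i : Fin 2) (v : ℝ) : D.mk .A (vec i 1 v) = D.mk (.B i) (vec i 0 v) := by
  have := glue_AB i (vec i 0 v)
  rwa [← projIcc_I_one, ← projIcc_I_zero, update_vec, update_vec] at this

lemma glue_BC_vec (i : Fin 2) (v : ℝ) : D.mk (.B i) (vec i 1 v) = D.mk .C (vec i 0 v) := by
  have := glue_BC i (vec i 0 v)
  rwa [← projIcc_I_one, ← projIcc_I_zero, update_vec, update_vec] at this

lemma emb_A {i : Fin 2} {u v : ℝ} (h : u ≤ 1) : emb i u v = D.mk .A (vec i u v) := if_pos h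

/-- At `u = 1` the definition takes the branch of `A`; the gluing makes the two branches agree
there, so closed bounds are allowed. -/
lemma emb_B {i : Fin 2} {u v : ℝ} (h1 : 1 ≤ u) (h2 : u ≤ 2) :
    emb i u v = D.mk (.B i) (vec i (u - 1) v) := by
  rcases h1.eq_or_lt with rfl | h
  · rw [emb_A le_rfl, glue_AB_vec, sub_self]
  · rw [emb, if_neg h.not_ge, if_pos h2]

lemma emb_C {i : Fin 2} {u v : ℝ} (h2 : 2 ≤ u) : emb i u v = D.mk .C (vec i (u - 2) v) := by
  rcases h2.eq_or_lt with rfl | h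
  · rw [emb_B one_le_two le_rfl, sub_self, ← glue_BC_vec]; norm_num
  · rw [emb, if_neg (by linarith), if_neg h.not_ge]

lemma continuous_emb (i : Fin 2) : Continuous fun p : ℝ × ℝ => emb i p.1 p.2 := by
  have hv : ∀ c : ℝ, Continuous fun p : ℝ × ℝ => vec i (p.1 - c) p.2 := fun c =>
    (continuous_vec i).comp (f := fun p : ℝ × ℝ => (p.1 - c, p.2)) (by fun_prop)
  refine Continuous.if_le ((continuous_mk _).comp (continuous_vec i))
    (Continuous.if_le ((continuous_mk _).comp (hv 1)) ((continuous_mk _).comp (hv 2))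
      continuous_fst continuous_const ?_) continuous_fst continuous_const ?_
  · intro p hp
    simp only [hp, sub_self, ← glue_BC_vec]; norm_num
  · intro p hp
    simp only [hp, if_pos one_le_two, sub_self, ← glue_AB_vec]

lemma emb_mem_strip (i : Fin 2) (u v : ℝ) : emb i u v ∈ strip i := by
  unfold emb
  split_ifs <;> simp

lemma emb_coords {i : Fin 2} {z : D} (hz : z ∈ strip i) : emb i (long i z) (short i z) = z := by
  rcases strip_cases hz with ⟨x, rfl⟩ | ⟨x, -, -, rfl⟩ | ⟨x, rfl⟩
  · rw [emb_A (by exact (x i).2.2), long_A, short_A, vec_coords]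
  · rw [emb_B (by simpa using (x i).2.1) (by rw [long_B_self]; linarith [(x i).2.2]), long_B_self,
      short_B_self, add_sub_cancel_right, vec_coords]
  · rw [emb_C (by simpa using (x i).2.1), long_C, short_C, add_sub_cancel_right, vec_coords]

lemma coe_projIcc {u : ℝ} (h0 : 0 ≤ u) (h1 : u ≤ 1) :
    ((Set.projIcc 0 1 zero_le_one u : I) : ℝ) = u := by
  rw [Set.projIcc_of_mem _ ⟨h0, h1⟩]

lemma long_emb {i : Fin 2} {u v : ℝ} (h0 : 0 ≤ u) (h3 : u ≤ 3) : long i (emb i u v) = u := by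
  rcases le_total u 1 with h | h
  · rw [emb_A h, long_A, vec_self, coe_projIcc h0 h]
  rcases le_total u 2 with h' | h'
  · rw [emb_B h h', long_B_self, vec_self, coe_projIcc (by linarith) (by linarith)]; ring
  · rw [emb_C h', long_C, vec_self, coe_projIcc (by linarith) (by linarith)]; ring

lemma short_emb {i : Fin 2} {u v : ℝ} (h0 : 0 ≤ v) (h1 : v ≤ 1) : short i (emb i u v) = v := by
  unfold emb
  split_ifs <;> simp [coe_projIcc h0 h1]

lemma long_nonneg {i : Fin 2} {z : D} (hz : z ∈ strip i) : 0 ≤ long i z := by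
  rcases strip_cases hz with ⟨x, rfl⟩ | ⟨x, -, -, rfl⟩ | ⟨x, rfl⟩ <;> simp <;>
    linarith [(x i).2.1]

lemma long_le {i : Fin 2} {z : D} (hz : z ∈ strip i) : long i z ≤ 3 := by
  rcases strip_cases hz with ⟨x, rfl⟩ | ⟨x, -, -, rfl⟩ | ⟨x, rfl⟩ <;> simp <;>
    linarith [(x i).2.2]

lemma short_nonneg {i : Fin 2} {z : D} (hz : z ∈ strip i) : 0 ≤ short i z := by
  rcases strip_cases hz with ⟨x, rfl⟩ | ⟨x, -, -, rfl⟩ | ⟨x, rfl⟩ <;> simp <;>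
    linarith [(x (1 - i)).2.1]

lemma short_le {i : Fin 2} {z : D} (hz : z ∈ strip i) : short i z ≤ 1 := by
  rcases strip_cases hz with ⟨x, rfl⟩ | ⟨x, -, -, rfl⟩ | ⟨x, rfl⟩ <;> simp <;>
    linarith [(x (1 - i)).2.2]

lemma strip_ext {i : Fin 2} {z w : D} (hz : z ∈ strip i) (hw : w ∈ strip i)
    (h : long i z = long i w) (h' : short i z = short i w) : z = w := by
  rw [← emb_coords hz, h, h', emb_coords hw]

/-! ### Uniqueness of the normal form -/

lemma D.mk_A_inj {x y : Fin 2 → I} (h : D.mk .A x = D.mk .A y) : x = y := by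
  funext i; exact Subtype.ext (congrArg (long i) h)

lemma D.mk_C_inj {x y : Fin 2 → I} (h : D.mk .C x = D.mk .C y) : x = y := by
  funext i; exact Subtype.ext (add_right_cancel (congrArg (long i) h))

lemma D.mk_A_ne_C {x y : Fin 2 → I} : D.mk .A x ≠ D.mk .C y := fun h => by
  simpa using congrArg height h

lemma D.mk_B_inj {i k : Fin 2} {x y : Fin 2 → I} (h0 : 0 < x i) (h1 : x i < 1)
    (h : D.mk (.B i) x = D.mk (.B k) y) : i = k ∧ x = y := by
  have hk : i = k := (mem_strip_B (i := k) h0 h1).1 (by rw [h]; simp)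
  subst hk
  refine ⟨rfl, ?_⟩
  rw [← vec_coords i x, ← vec_coords i y]
  have h1 := congrArg (long i) h
  have h2 := congrArg (short i) h
  simp only [long_B_self, short_B_self, add_left_inj] at h1 h2
  rw [h1, h2]

/-! ### Directed paths in `D` -/

/-- The map `p` is a monotone path in the strip `A ∪ B i ∪ C` on the set `s`. -/
structure StripMono (i : Fin 2) (p : I → D) (s : Set I) : Prop where
  mem : ∀ t ∈ s, p t ∈ strip i
  monoLong : MonotoneOn (fun t => long i (p t)) s
  monoShort : MonotoneOn (fun t => short i (p t)) s

lemma StripMono.mono {i : Fin 2} {p : I → D} {s s' : Set I} (h : StripMono i p s) (hs : s' ⊆ s) :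
    StripMono i p s' :=
  ⟨fun t ht => h.mem t (hs ht), h.monoLong.mono hs, h.monoShort.mono hs⟩

lemma MonotoneOn.Icc_union_Icc {f : I → ℝ} {a b c : I} (hab : a ≤ b) (hbc : b ≤ c)
    (h1 : MonotoneOn f (Set.Icc a b)) (h2 : MonotoneOn f (Set.Icc b c)) :
    MonotoneOn f (Set.Icc a c) := by
  intro s hs t ht hst
  rcases le_total t b with htb | htb
  · exact h1 ⟨hs.1, hst.trans htb⟩ ⟨ht.1, htb⟩ hst
  rcases le_total s b with hsb | hsb
  · exact (h1 ⟨hs.1, hsb⟩ ⟨hab, le_rfl⟩ hsb).trans (h2 ⟨le_rfl, hbc⟩ ⟨htb, ht.2⟩ htb)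
  · exact h2 ⟨hsb, hs.2⟩ ⟨htb, ht.2⟩ hst

lemma StripMono.union {i : Fin 2} {p : I → D} {a b c : I} (hab : a ≤ b) (hbc : b ≤ c)
    (h1 : StripMono i p (Set.Icc a b)) (h2 : StripMono i p (Set.Icc b c)) :
    StripMono i p (Set.Icc a c) :=
  ⟨fun t ht => (le_total t b).elim (fun h => h1.mem t ⟨ht.1, h⟩) fun h => h2.mem t ⟨h, ht.2⟩,
    MonotoneOn.Icc_union_Icc hab hbc h1.monoLong h2.monoLong,
    MonotoneOn.Icc_union_Icc hab hbc h1.monoShort h2.monoShort⟩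

lemma stripMono_of_A {i : Fin 2} {p : I → D} {s : Set I} {q : I → Fin 2 → I}
    (hq : MonotoneOn q s) (h : ∀ t ∈ s, p t = D.mk .A (q t)) : StripMono i p s :=
  ⟨fun t ht => by simp [h t ht], fun t ht t' ht' htt => by simpa [h t ht, h t' ht'] using hq ht ht' htt i,
    fun t ht t' ht' htt => by simpa [h t ht, h t' ht'] using hq ht ht' htt (1 - i)⟩

lemma stripMono_of_B {i : Fin 2} {p : I → D} {s : Set I} {q : I → Fin 2 → I}
    (hq : MonotoneOn q s) (h : ∀ t ∈ s, p t = D.mk (.B i) (q t)) : StripMono i p s :=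
  ⟨fun t ht => by simp [h t ht], fun t ht t' ht' htt => by simpa [h t ht, h t' ht'] using hq ht ht' htt i,
    fun t ht t' ht' htt => by simpa [h t ht, h t' ht'] using hq ht ht' htt (1 - i)⟩

lemma stripMono_of_C {i : Fin 2} {p : I → D} {s : Set I} {q : I → Fin 2 → I}
    (hq : MonotoneOn q s) (h : ∀ t ∈ s, p t = D.mk .C (q t)) : StripMono i p s :=
  ⟨fun t ht => by simp [h t ht], fun t ht t' ht' htt => by simpa [h t ht, h t' ht'] using hq ht ht' htt i,
    fun t ht t' ht' htt => by simpa [h t ht, h t' ht'] using hq ht ht' htt (1 - i)⟩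

lemma exists_A_of_long_le {i : Fin 2} {z : D} (hz : z ∈ strip i) (h : long i z ≤ 1) :
    z = D.mk .A (vec i (long i z) (short i z)) := by
  rw [← emb_A h, emb_coords hz]

lemma exists_C_of_le_long {i : Fin 2} {z : D} (hz : z ∈ strip i) (h : 2 ≤ long i z) :
    z = D.mk .C (vec i (long i z - 2) (short i z)) := by
  rw [← emb_C h, emb_coords hz]

lemma vec_monotoneOn {i : Fin 2} {s : Set I} {u v : I → ℝ} (hu : MonotoneOn u s)
    (hv : MonotoneOn v s) (c : ℝ) : MonotoneOn (fun t => vec i (u t - c) (v t)) s :=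
  fun t ht t' ht' h => monotone_vec i (a := (u t - c, v t)) (b := (u t' - c, v t'))
    ⟨sub_le_sub_right (hu ht ht' h) c, hv ht ht' h⟩

/-- By monotonicity of the long coordinate the whole path lies in `A`, which belongs to both strips
and where both coordinate systems are the two coordinates of the square. -/
lemma StripMono.to_A {i k : Fin 2} {p : I → D} {a b : I} (hab : a ≤ b)
    (h : StripMono i p (Set.Icc a b)) (hb : long i (p b) ≤ 1) : StripMono k p (Set.Icc a b) := by
  refine stripMono_of_A (q := fun t => vec i (long i (p t) - 0) (short i (p t)))
    (vec_monotoneOn h.monoLong h.monoShort 0) fun t ht => ?_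
  rw [sub_zero]
  exact exists_A_of_long_le (h.mem t ht) ((h.monoLong ht ⟨hab, le_rfl⟩ ht.2).trans hb)

lemma StripMono.to_C {i k : Fin 2} {p : I → D} {a b : I} (hab : a ≤ b)
    (h : StripMono i p (Set.Icc a b)) (ha : 2 ≤ long i (p a)) : StripMono k p (Set.Icc a b) := by
  refine stripMono_of_C (q := fun t => vec i (long i (p t) - 2) (short i (p t)))
    (vec_monotoneOn h.monoLong h.monoShort 2) fun t ht => ?_
  exact exists_C_of_le_long (h.mem t ht) (ha.trans (h.monoLong ⟨le_rfl, hab⟩ ht ht.1))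

/-- If two consecutive pieces run in different strips, their common point lies in both strips, hence
in `A` or in `C`. In the first case the earlier piece stays in `A`, in the second the later piece
stays in `C`, so that it also runs in the strip of the other piece. -/
lemma CellwiseDirected.exists_stripMono {p : I → D} {a b : I} (h : CellwiseDirected p a b) :
    ∃ i, StripMono i p (Set.Icc a b) := by
  induction h with
  | cell hab c q hc hm h =>
    rcases c with _ | i | _
    · exact ⟨0, stripMono_of_A hm h⟩
    · exact ⟨i, stripMono_of_B hm h⟩
    · exact ⟨0, stripMono_of_C hm h⟩
  | @concat a b c h1 h2 ih1 ih2 =>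
    obtain ⟨i, hi⟩ := ih1
    obtain ⟨k, hk⟩ := ih2
    have hab := h1.le
    have hbc := h2.le
    rcases eq_or_eq_one_sub i k with rfl | rfl
    · exact ⟨k, hi.union hab hbc hk⟩
    have hb := hi.mem b ⟨hab, le_rfl⟩
    have hb' := hk.mem b ⟨le_rfl, hbc⟩
    rcases strip_cases hb with ⟨x, hx⟩ | ⟨x, h0, h1, hx⟩ | ⟨x, hx⟩
    · exact ⟨1 - i, (hi.to_A hab (by rw [hx]; exact (x i).2.2)).union hab hbc hk⟩
    · rw [hx] at hb'
      exact absurd ((mem_strip_B h0 h1).1 hb') (ne_one_sub i)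
    · exact ⟨i, hi.union hab hbc (hk.to_C hbc (by rw [hx]; simpa using (x (1 - i)).2.1))⟩

/-- The path is cut where its long coordinate takes the values `1` and `2`; the pieces lie in single
squares. -/
lemma StripMono.cellwiseDirected {i : Fin 2} {p : I → D} (hp : Continuous p) {a b : I}
    (hab : a ≤ b) (h : StripMono i p (Set.Icc a b)) : CellwiseDirected p a b := by
  have hu : Continuous fun t => long i (p t) := (continuous_long i).comp hp
  have hv : Continuous fun t => short i (p t) := (continuous_short i).comp hp
  have hq : ∀ c : ℝ, Continuous fun t => vec i (long i (p t) - c) (short i (p t)) :=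
    fun c => (continuous_vec i).comp ((hu.sub continuous_const).prodMk hv)
  have hA : ∀ {a b : I}, a ≤ b → StripMono i p (Set.Icc a b) → long i (p b) ≤ 1 →
      CellwiseDirected p a b := fun {a b} hab h hb =>
    .cell hab .A _ (hq 0).continuousOn (vec_monotoneOn h.monoLong h.monoShort 0) fun t ht => by
      rw [sub_zero]
      exact exists_A_of_long_le (h.mem t ht) ((h.monoLong ht ⟨hab, le_rfl⟩ ht.2).trans hb)
  have hC : ∀ {a b : I}, a ≤ b → StripMono i p (Set.Icc a b) → 2 ≤ long i (p a) →
      CellwiseDirected p a b := fun {a b} hab h ha =>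
    .cell hab .C _ (hq 2).continuousOn (vec_monotoneOn h.monoLong h.monoShort 2) fun t ht =>
      exists_C_of_le_long (h.mem t ht) (ha.trans (h.monoLong ⟨le_rfl, hab⟩ ht ht.1))
  have hB : ∀ {a b : I}, a ≤ b → StripMono i p (Set.Icc a b) → 1 ≤ long i (p a) →
      long i (p b) ≤ 2 → CellwiseDirected p a b := fun {a b} hab h ha hb =>
    .cell hab (.B i) _ (hq 1).continuousOn (vec_monotoneOn h.monoLong h.monoShort 1) fun t ht => by
      rw [← emb_B (ha.trans (h.monoLong ⟨le_rfl, hab⟩ ht ht.1))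
        ((h.monoLong ht ⟨hab, le_rfl⟩ ht.2).trans hb), emb_coords (h.mem t ht)]
  have hcut : ∀ (c : ℝ) {a b : I}, a ≤ b → long i (p a) ≤ c → c ≤ long i (p b) →
      ∃ m ∈ Set.Icc a b, long i (p m) = c := fun c {a b} hab ha hb =>
    intermediate_value_Icc hab hu.continuousOn ⟨ha, hb⟩
  have hAB : ∀ {a b : I}, a ≤ b → StripMono i p (Set.Icc a b) → long i (p b) ≤ 2 →
      CellwiseDirected p a b := by
    intro a b hab h hb
    rcases le_total (long i (p b)) 1 with h1 | h1
    · exact hA hab h h1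
    rcases le_total 1 (long i (p a)) with h2 | h2
    · exact hB hab h h2 hb
    obtain ⟨m, hm, hm1⟩ := hcut 1 hab h2 h1
    exact (hA hm.1 (h.mono (Set.Icc_subset_Icc_right hm.2)) hm1.le).concat
      (hB hm.2 (h.mono (Set.Icc_subset_Icc_left hm.1)) hm1.ge hb)
  rcases le_total (long i (p b)) 2 with h1 | h1
  · exact hAB hab h h1
  rcases le_total 2 (long i (p a)) with h2 | h2
  · exact hC hab h h2
  obtain ⟨m, hm, hm1⟩ := hcut 2 hab h2 h1
  exact (hAB hm.1 (h.mono (Set.Icc_subset_Icc_right hm.2)) hm1.le).concat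
    (hC hm.2 (h.mono (Set.Icc_subset_Icc_left hm.1)) hm1.ge)

lemma isDPath_iff {p : C(I, D)} : IsDPath p ↔ ∃ i, StripMono i p Set.univ := by
  have : Set.Icc (0 : I) 1 = Set.univ :=
    Set.eq_univ_of_forall fun t => ⟨unitInterval.nonneg', unitInterval.le_one'⟩
  constructor
  · intro h
    have := CellwiseDirected.exists_stripMono h
    simpa [‹Set.Icc (0 : I) 1 = Set.univ›] using this
  · rintro ⟨i, h⟩
    exact (h.mono (Set.subset_univ (Set.Icc 0 1))).cellwiseDirected p.continuous zero_le_one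

/-- The d-path `p` runs in the strip `A ∪ B i ∪ C`. -/
def DPath.InStrip (i : Fin 2) {x y : D} (p : DPath x y) : Prop := ∀ t, p.1 t ∈ strip i

lemma DPath.exists_inStrip {x y : D} (p : DPath x y) : ∃ i, p.InStrip i := by
  obtain ⟨i, h⟩ := isDPath_iff.1 p.2
  exact ⟨i, fun t => h.mem t trivial⟩

/-- A monotone path in one strip is monotone in the coordinates of the other, if it runs there. -/
lemma StripMono.of_mem {i k : Fin 2} {p : I → D} (hp : Continuous p)
    (h : StripMono i p Set.univ) (hk : ∀ t, p t ∈ strip k) : StripMono k p Set.univ := by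
  have hI : Set.Icc (0 : I) 1 = Set.univ :=
    Set.eq_univ_of_forall fun t => ⟨unitInterval.nonneg', unitInterval.le_one'⟩
  rcases eq_or_eq_one_sub i k with rfl | rfl
  · exact h
  -- A path that also runs in the other strip avoids the interior of `B i`, so its long coordinate
  -- never enters the interval between `1` and `2`.
  have key : ∀ t, long i (p t) ≤ 1 ∨ 2 ≤ long i (p t) := by
    intro t
    rcases strip_cases (h.mem t trivial) with ⟨x, hx⟩ | ⟨x, h0, h1, hx⟩ | ⟨x, hx⟩
    · exact .inl (by rw [hx]; exact (x i).2.2)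
    · have := hk t
      rw [hx] at this
      exact absurd ((mem_strip_B h0 h1).1 this) (ne_one_sub i)
    · exact .inr (by rw [hx]; simpa using (x i).2.1)
  rw [← hI] at h ⊢
  rcases key 1 with h1 | h1
  · exact h.to_A zero_le_one h1
  rcases key 0 with h0 | h0
  -- A path that starts below `1` and ends above `2` would attain the forbidden value `3 / 2`.
  · obtain ⟨m, -, hm⟩ := intermediate_value_Icc (zero_le_one : (0 : I) ≤ 1)
      ((continuous_long i).comp hp).continuousOn
      (show (3 / 2 : ℝ) ∈ _ from ⟨by simp only [Function.comp]; linarith,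
        by simp only [Function.comp]; linarith⟩)
    simp only [Function.comp] at hm
    rcases key m with h | h <;> linarith
  · exact h.to_C zero_le_one h0

lemma DPath.stripMono {x y : D} {p : DPath x y} {i : Fin 2} (h : p.InStrip i) :
    StripMono i p.1 Set.univ := by
  obtain ⟨k, hk⟩ := isDPath_iff.1 p.2
  exact StripMono.of_mem p.1.continuous hk h

/-- The relation that `y` is reachable from `x` in the strip `A ∪ B i ∪ C`. -/
structure StripLE (i : Fin 2) (x y : D) : Prop where
  left : x ∈ strip i
  right : y ∈ strip i
  leLong : long i x ≤ long i y
  leShort : short i x ≤ short i y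

lemma DPath.InStrip.stripLE {x y : D} {p : DPath x y} {i : Fin 2} (h : p.InStrip i) :
    StripLE i x y := by
  have hm := DPath.stripMono h
  have hl := hm.monoLong (Set.mem_univ 0) (Set.mem_univ 1) zero_le_one
  have hs := hm.monoShort (Set.mem_univ 0) (Set.mem_univ 1) zero_le_one
  have h0 := h 0
  have h1 := h 1
  simp only [Path.source, Path.target] at h0 h1 hl hs
  exact ⟨h0, h1, hl, hs⟩

lemma isDPath_emb {i : Fin 2} {p : C(I, D)} {u v : I → ℝ} (h : ∀ t, p t = emb i (u t) (v t))
    (hu : Monotone u) (hv : Monotone v) (hu0 : 0 ≤ u 0) (hu1 : u 1 ≤ 3) (hv0 : 0 ≤ v 0)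
    (hv1 : v 1 ≤ 1) : IsDPath p := by
  have hlu : ∀ t, long i (emb i (u t) (v t)) = u t := fun t =>
    long_emb (hu0.trans (hu unitInterval.nonneg')) ((hu unitInterval.le_one').trans hu1)
  have hlv : ∀ t, short i (emb i (u t) (v t)) = v t := fun t =>
    short_emb (hv0.trans (hv unitInterval.nonneg')) ((hv unitInterval.le_one').trans hv1)
  refine isDPath_iff.2 ⟨i, fun t _ => ?_, fun s _ t _ hst => ?_, fun s _ t _ hst => ?_⟩
  · rw [h]; exact emb_mem_strip _ _ _
  · simp only [h, hlu]; exact hu hst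
  · simp only [h, hlv]; exact hv hst

lemma monotone_affine {a b : ℝ} (h : a ≤ b) : Monotone fun t : I => a + t * (b - a) :=
  fun s t hst => by
    have : (s : ℝ) ≤ t := hst
    have := mul_le_mul_of_nonneg_right this (sub_nonneg.2 h)
    simp only; linarith

/-- The straight path in a strip. -/
def StripLE.path {x y : D} {i : Fin 2} (h : StripLE i x y) : DPath x y :=
  ⟨⟨⟨fun t => emb i (long i x + t * (long i y - long i x))
      (short i x + t * (short i y - short i x)),
    (continuous_emb i).comp (f := fun t : I => ((long i x + t * (long i y - long i x) : ℝ),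
      (short i x + t * (short i y - short i x) : ℝ))) (by fun_prop)⟩,
    by simp [emb_coords h.left], by simp [emb_coords h.right]⟩,
    isDPath_emb (fun _ => rfl) (monotone_affine h.leLong) (monotone_affine h.leShort)
      (by simpa using long_nonneg h.left) (by simpa using long_le h.right)
      (by simpa using short_nonneg h.left) (by simpa using short_le h.right)⟩

lemma StripLE.path_inStrip {x y : D} {i : Fin 2} (h : StripLE i x y) : h.path.InStrip i :=
  fun _ => emb_mem_strip _ _ _

/-- Since strips are convex in their coordinates, the straight path witnesses reachability. -/
lemma nonempty_dpath_iff {x y : D} : Nonempty (DPath x y) ↔ ∃ i, StripLE i x y :=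
  ⟨fun ⟨p⟩ => p.exists_inStrip.imp fun _ h => h.stripLE,
    fun ⟨_, h⟩ => ⟨h.path⟩⟩

/-! ### Trace spaces of `D` -/

lemma exists_eq_of_monotone_endpoints {φ : C(I, I)} (h0 : φ 0 = 0) (h1 : φ 1 = 1) (t : I) :
    ∃ s, φ s = t := by
  obtain ⟨s, -, hs⟩ := intermediate_value_Icc (zero_le_one : (0 : I) ≤ 1) φ.continuous.continuousOn
    (show t ∈ _ from ⟨h0.le.trans unitInterval.nonneg', unitInterval.le_one'.trans h1.ge⟩)
  exact ⟨s, hs⟩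

/-- A reparametrization is surjective by the intermediate value theorem, so it does not change the
set of points visited. -/
lemma Reparam.inStrip_iff {x y : D} {p q : DPath x y} (h : Reparam p q) (i : Fin 2) :
    p.InStrip i ↔ q.InStrip i := by
  obtain ⟨φ, -, h0, h1, h⟩ := h
  constructor
  · intro hp t; rw [h]; exact hp _
  · intro hq t
    obtain ⟨s, rfl⟩ := exists_eq_of_monotone_endpoints h0 h1 t
    rw [← h]; exact hq s

/-- A path from `A` to `C` passes through height `1 / 2`, that is, through a point of some `B i`
that lies in only one strip. -/
lemma not_inStrip_both {x y : D} (hx : height x = 0) (hy : height y = 1) {p : DPath x y} {i : Fin 2}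
    (h : p.InStrip i) : ¬ p.InStrip (1 - i) := by
  intro h'
  have hc : Continuous fun t => height (p.1 t) := continuous_height.comp p.1.continuous
  obtain ⟨t, -, ht⟩ := intermediate_value_Icc (zero_le_one : (0 : I) ≤ 1) hc.continuousOn
    (show (1 / 2 : ℝ) ∈ _ by simp [hx, hy]; norm_num)
  simp only at ht
  rcases strip_cases (h t) with ⟨a, ha⟩ | ⟨a, h0, h1, ha⟩ | ⟨a, ha⟩
  · norm_num [ha] at ht
  · have := h' t
    rw [ha] at this
    exact absurd ((mem_strip_B h0 h1).1 this) (ne_one_sub i)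
  · norm_num [ha] at ht

lemma DPath.InStrip.of_A {x y : D} {p : DPath x y} {i : Fin 2} (h : p.InStrip i) {a : Fin 2 → I}
    (hy : y = D.mk .A a) (k : Fin 2) : p.InStrip k := by
  intro t
  have h1 := (DPath.stripMono h).monoLong (Set.mem_univ t) (Set.mem_univ 1) unitInterval.le_one'
  simp only [Path.target, hy, long_A] at h1
  rw [exists_A_of_long_le (h t) (h1.trans (a i).2.2)]
  simp

lemma DPath.InStrip.of_C {x y : D} {p : DPath x y} {i : Fin 2} (h : p.InStrip i) {a : Fin 2 → I}
    (hx : x = D.mk .C a) (k : Fin 2) : p.InStrip k := by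
  intro t
  have h1 := (DPath.stripMono h).monoLong (Set.mem_univ 0) (Set.mem_univ t) unitInterval.nonneg'
  simp only [Path.source, hx, long_C] at h1
  rw [exists_C_of_le_long (h t) (by linarith [(a i).2.1])]
  simp

/-- If another path with the same end points used the other strip, both end points would lie in `A ∪
C`. Ending in `A` or starting in `C` confines the path to one square, which is in both strips;
starting in `A` and ending in `C` is excluded. -/
lemma inStrip_congr {x y : D} (hxy : ¬ (height x = 0 ∧ height y = 1)) {p q : DPath x y} {i : Fin 2}
    (h : p.InStrip i) : q.InStrip i := by
  obtain ⟨k, hk⟩ := q.exists_inStrip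
  rcases eq_or_eq_one_sub i k with rfl | rfl
  · exact hk
  have key : ∀ z, z ∈ strip i → z ∈ strip (1 - i) →
      (∃ a, z = D.mk .A a) ∨ ∃ a, z = D.mk .C a := by
    intro z hz hz'
    rcases strip_cases hz with h | ⟨a, h0, h1, rfl⟩ | h
    · exact .inl h
    · exact absurd ((mem_strip_B h0 h1).1 hz') (ne_one_sub i)
    · exact .inr h
  rcases key y h.stripLE.right hk.stripLE.right with ⟨b, hb⟩ | ⟨b, hb⟩
  · exact hk.of_A hb i
  rcases key x h.stripLE.left hk.stripLE.left with ⟨a, ha⟩ | ⟨a, ha⟩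
  · exact absurd ⟨by simp [ha], by simp [hb]⟩ hxy
  · exact hk.of_C ha i

open Classical in
/-- The number of a strip in which the d-path runs. -/
def DPath.route {x y : D} (p : DPath x y) : Fin 2 := if p.InStrip 0 then 0 else 1

lemma DPath.inStrip_route {x y : D} (p : DPath x y) : p.InStrip p.route := by
  unfold DPath.route
  split_ifs with h
  · exact h
  · obtain ⟨i, hi⟩ := p.exists_inStrip
    fin_cases i
    · exact absurd hi h
    · exact hi

lemma Reparam.route_eq {x y : D} {p q : DPath x y} (h : Reparam p q) : p.route = q.route := by
  classical
  unfold DPath.route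
  by_cases hp : p.InStrip 0
  · rw [if_pos hp, if_pos ((h.inStrip_iff 0).1 hp)]
  · rw [if_neg hp, if_neg fun hq => hp ((h.inStrip_iff 0).2 hq)]

/-- The route of a path that runs in both strips is `0` by convention. This shows that the
convention assigns the same route to all paths in a common strip with the same end points. -/
lemma inStrip_zero_of_common {x y : D} {p q : DPath x y} {i : Fin 2} (hp : p.InStrip i)
    (hq : q.InStrip i) (h : p.InStrip 0) : q.InStrip 0 := by
  fin_cases i
  · exact hq
  · exact inStrip_congr (fun hxy => not_inStrip_both hxy.1 hxy.2 h hp) h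

lemma DPath.route_eq_of_inStrip {x y : D} {p q : DPath x y} {i : Fin 2} (hp : p.InStrip i)
    (hq : q.InStrip i) : p.route = q.route := by
  classical
  unfold DPath.route
  by_cases h : p.InStrip 0
  · rw [if_pos h, if_pos (inStrip_zero_of_common hp hq h)]
  · rw [if_neg h, if_neg fun h' => h (inStrip_zero_of_common hq hp h')]

lemma isClosed_inStrip {x y : D} (i : Fin 2) : IsClosed {p : DPath x y | p.InStrip i} := by
  have : {p : DPath x y | p.InStrip i} = ⋂ t : I, {p | p.1 t ∈ strip i} := by
    ext p; simp [DPath.InStrip]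
  rw [this]
  refine isClosed_iInter fun t => (isClosed_strip i).preimage ?_
  exact (continuous_eval_const t).comp continuous_subtype_val

/-- Between `A` and `C` the paths in strip `0` are the complement of the closed set of paths in
strip `1`; otherwise either all paths or none run in strip `0`. -/
lemma isOpen_inStrip_zero {x y : D} : IsOpen {p : DPath x y | p.InStrip 0} := by
  by_cases hxy : height x = 0 ∧ height y = 1
  · have : {p : DPath x y | p.InStrip 0} = {p : DPath x y | p.InStrip 1}ᶜ := by
      ext p
      refine ⟨fun h => not_inStrip_both hxy.1 hxy.2 h, fun h => ?_⟩
      obtain ⟨i, hi⟩ := p.exists_inStrip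
      fin_cases i
      · exact hi
      · exact absurd hi h
    rw [this]
    exact (isClosed_inStrip 1).isOpen_compl
  · by_cases h : ∃ p : DPath x y, p.InStrip 0
    · obtain ⟨p, hp⟩ := h
      have : {p : DPath x y | p.InStrip 0} = Set.univ :=
        Set.eq_univ_of_forall fun q => inStrip_congr hxy hp
      rw [this]; exact isOpen_univ
    · have : {p : DPath x y | p.InStrip 0} = ∅ :=
        Set.eq_empty_of_forall_notMem fun q hq => h ⟨q, hq⟩
      rw [this]; exact isOpen_empty

lemma continuous_route {x y : D} : Continuous (DPath.route : DPath x y → Fin 2) := by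
  have h0 : (DPath.route : DPath x y → Fin 2) ⁻¹' {0} = {p | p.InStrip 0} := by
    ext p; simp [DPath.route]
  have h1 : (DPath.route : DPath x y → Fin 2) ⁻¹' {1} = {p | p.InStrip 0}ᶜ := by
    ext p; simp [DPath.route]
  rw [continuous_discrete_rng]
  intro i
  fin_cases i
  · exact h0 ▸ isOpen_inStrip_zero
  · exact h1 ▸ (isClosed_inStrip 0).isOpen_compl

/-- The relative position of `z` between `x` and `y`, along the strip `A ∪ B i ∪ C`. -/
def progress (i : Fin 2) (x y z : D) : ℝ :=
  (long i z + short i z - (long i x + short i x)) / (long i y + short i y - (long i x + short i x))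

/-- The deformation of the strip `A ∪ B i ∪ C` into the segment from `x` to `y`. -/
def deform (x y : D) (i : Fin 2) (s : I) (z : D) : D :=
  emb i ((1 - s) * long i z + s * (long i x + progress i x y z * (long i y - long i x)))
    ((1 - s) * short i z + s * (short i x + progress i x y z * (short i y - short i x)))

lemma continuous_progress (i : Fin 2) (x y : D) : Continuous (progress i x y) := by
  have := continuous_long i
  have := continuous_short i
  unfold progress
  fun_prop

lemma continuous_deform (x y : D) :
    Continuous fun q : Fin 2 × (I × D) => deform x y q.1 q.2.1 q.2.2 := by
  rw [continuous_prod_of_discrete_left]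
  intro i
  have := continuous_long i
  have := continuous_short i
  have := continuous_progress i x y
  exact (continuous_emb i).comp (f := fun q : I × D =>
    ((1 - q.1 : ℝ) * long i q.2 + q.1 * (long i x + progress i x y q.2 * (long i y - long i x)),
      (1 - q.1 : ℝ) * short i q.2 +
        q.1 * (short i x + progress i x y q.2 * (short i y - short i x)))) (by fun_prop)

lemma StripLE.deform_left {x y : D} {i : Fin 2} (h : StripLE i x y) (s : I) :
    deform x y i s x = x := by
  have : progress i x y x = 0 := by simp [progress]
  rw [deform, this]
  convert emb_coords h.left using 2 <;> ring

lemma StripLE.progress_right {x y : D} {i : Fin 2} (h : StripLE i x y) (hne : x ≠ y) :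
    progress i x y y = 1 := by
  refine div_self fun h0 => hne (strip_ext h.left h.right ?_ ?_) <;>
    linarith [h.leLong, h.leShort]

/-- For `x = y` the quotient `progress` has denominator `0` and the default value `0`, but it is
then multiplied by `0`. -/
lemma StripLE.progress_mul_right {x y : D} {i : Fin 2} (h : StripLE i x y) :
    long i x + progress i x y y * (long i y - long i x) = long i y ∧
      short i x + progress i x y y * (short i y - short i x) = short i y := by
  rcases eq_or_ne x y with rfl | hne
  · simp
  · simp [h.progress_right hne]

lemma StripLE.deform_right {x y : D} {i : Fin 2} (h : StripLE i x y) (s : I) :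
    deform x y i s y = y := by
  rw [deform, h.progress_mul_right.1, h.progress_mul_right.2]
  convert emb_coords h.right using 2 <;> ring

lemma StripLE.progress_mono {x y z w : D} {i : Fin 2} (h : StripLE i x y)
    (hl : long i z ≤ long i w) (hs : short i z ≤ short i w) :
    progress i x y z ≤ progress i x y w :=
  div_le_div_of_nonneg_right (by linarith) (by linarith [h.leLong, h.leShort])

lemma convex_mono {s a b c d m n : ℝ} (h0 : 0 ≤ s) (h1 : s ≤ 1) (hab : a ≤ b) (hcd : c ≤ d)
    (hmn : m ≤ n) :
    (1 - s) * a + s * (c + m * (d - c)) ≤ (1 - s) * b + s * (c + n * (d - c)) := by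
  have := mul_le_mul_of_nonneg_right hmn (sub_nonneg.2 hcd)
  exact add_le_add (mul_le_mul_of_nonneg_left hab (by linarith))
    (mul_le_mul_of_nonneg_left (by linarith) h0)

/-- The deformation of a d-path into a straight path. -/
def DPath.deform {x y : D} (p : DPath x y) (s : I) : DPath x y :=
  have h := p.inStrip_route.stripLE
  have hc : Continuous fun t => DirTop.deform x y p.route s (p.1 t) :=
    (continuous_deform x y).comp (f := fun t => (p.route, s, p.1 t)) (by fun_prop)
  ⟨⟨⟨fun t => DirTop.deform x y p.route s (p.1 t), hc⟩, by simp [h.deform_left],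
    by simp [h.deform_right]⟩, by
    have hm := DPath.stripMono p.inStrip_route
    have hl : ∀ ⦃t t'⦄, t ≤ t' → long p.route (p.1 t) ≤ long p.route (p.1 t') :=
      fun t t' ht => hm.monoLong trivial trivial ht
    have hs : ∀ ⦃t t'⦄, t ≤ t' → short p.route (p.1 t) ≤ short p.route (p.1 t') :=
      fun t t' ht => hm.monoShort trivial trivial ht
    have hp : ∀ ⦃t t'⦄, t ≤ t' →
        progress p.route x y (p.1 t) ≤ progress p.route x y (p.1 t') :=
      fun t t' ht => h.progress_mono (hl ht) (hs ht)
    have e0 : progress p.route x y x = 0 := by simp [progress]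
    refine isDPath_emb (i := p.route) (fun t => rfl)
      (fun t t' ht => convex_mono s.2.1 s.2.2 (hl ht) h.leLong (hp ht))
      (fun t t' ht => convex_mono s.2.1 s.2.2 (hs ht) h.leShort (hp ht)) ?_ ?_ ?_ ?_
    · rw [p.1.source, e0]; linarith [long_nonneg h.left]
    · rw [p.1.target, h.progress_mul_right.1]; linarith [long_le h.right]
    · rw [p.1.source, e0]; linarith [short_nonneg h.left]
    · rw [p.1.target, h.progress_mul_right.2]; linarith [short_le h.right]⟩

lemma DPath.deform_apply {x y : D} (p : DPath x y) (s t : I) :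
    (p.deform s).1 t = DirTop.deform x y p.route s (p.1 t) := rfl

lemma DPath.ext {x y : D} {p q : DPath x y} (h : ∀ t, p.1 t = q.1 t) : p = q :=
  Subtype.ext (Path.ext (funext h))

lemma DPath.deform_zero {x y : D} (p : DPath x y) : p.deform 0 = p := by
  refine DPath.ext fun t => ?_
  rw [DPath.deform_apply, DirTop.deform]
  simpa using emb_coords (p.inStrip_route t)

/-- The deformation acts on points and depends on the path only through its end points and its
route, so it is compatible with precomposition. -/
lemma Reparam.deform {x y : D} {p q : DPath x y} (h : Reparam p q) (s : I) :
    Reparam (p.deform s) (q.deform s) := by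
  have hr := h.route_eq
  obtain ⟨φ, hφ, h0, h1, h⟩ := h
  refine ⟨φ, hφ, h0, h1, fun t => ?_⟩
  rw [DPath.deform_apply, DPath.deform_apply, h, hr]

/-- Joint continuity rests on continuity of the evaluation of paths and on local constancy of the
route. -/
lemma DPath.continuous_deform {x y : D} :
    Continuous fun q : I × DPath x y => q.2.deform q.1 := by
  refine Continuous.subtype_mk ?_ _
  refine continuous_induced_rng.2 (ContinuousMap.continuous_of_continuous_uncurry _ ?_)
  have he : Continuous fun q : (I × DPath x y) × I => q.1.2.1 q.2 :=
    (continuous_subtype_val.comp (continuous_snd.comp continuous_fst)).eval continuous_snd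
  exact (DirTop.continuous_deform x y).comp
    (f := fun q : (I × DPath x y) × I => (q.1.2.route, q.1.1, q.1.2.1 q.2))
    ((continuous_route.comp (continuous_snd.comp continuous_fst)).prodMk
      ((continuous_fst.comp continuous_fst).prodMk he))

/-- At the end of the deformation all points lie on the straight path, at parameter `progress`,
which increases from `0` to `1` unless the end points coincide. In that exceptional case both paths
are constant. -/
lemma DPath.reparam_deform_one {x y : D} (p : DPath x y) :
    Reparam p.inStrip_route.stripLE.path (p.deform 1) := by
  have h := p.inStrip_route.stripLE
  have hm := DPath.stripMono p.inStrip_route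
  have hp : ∀ ⦃t t'⦄, t ≤ t' →
      progress p.route x y (p.1 t) ≤ progress p.route x y (p.1 t') :=
    fun t t' ht => h.progress_mono (hm.monoLong trivial trivial ht)
      (hm.monoShort trivial trivial ht)
  have e0 : progress p.route x y (p.1 0) = 0 := by simp [progress]
  have hf : ∀ t, (p.deform 1).1 t = emb p.route
      (long p.route x + progress p.route x y (p.1 t) * (long p.route y - long p.route x))
      (short p.route x + progress p.route x y (p.1 t) * (short p.route y - short p.route x)) := by
    intro t
    rw [DPath.deform_apply, DirTop.deform]
    simp
  by_cases hxy : x = y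
  · refine ⟨ContinuousMap.id I, monotone_id, rfl, rfl, fun t => ?_⟩
    rw [hf]
    change _ = emb _ _ _
    simp [← hxy]
  have e1 : progress p.route x y (p.1 1) = 1 := by
    rw [p.1.target, h.progress_right hxy]
  refine ⟨⟨fun t => ⟨progress p.route x y (p.1 t), e0 ▸ hp unitInterval.nonneg',
    e1 ▸ hp unitInterval.le_one'⟩, ?_⟩, fun t t' ht => hp ht, Subtype.ext e0, Subtype.ext e1,
    fun t => hf t⟩
  exact ((continuous_progress _ _ _).comp p.1.continuous).subtype_mk _

lemma DPath.trace_deform_one {x y : D} {p q : DPath x y} (h : p.route = q.route) :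
    (p.deform 1).trace = (q.deform 1).trace := by
  have hp : (p.deform 1).trace = p.inStrip_route.stripLE.path.trace :=
    (Quot.sound p.reparam_deform_one).symm
  have hq : (q.deform 1).trace = q.inStrip_route.stripLE.path.trace :=
    (Quot.sound q.reparam_deform_one).symm
  rw [hp, hq]
  congr 2

/-- The number of a strip in which a trace runs. -/
def Trace.route {x y : D} : Trace x y → Fin 2 := Quot.lift DPath.route fun _ _ h => h.route_eq

lemma Trace.continuous_route {x y : D} : Continuous (Trace.route : Trace x y → Fin 2) :=
  continuous_quot_lift _ DirTop.continuous_route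

/-- The deformation of a trace. -/
def Trace.deform {x y : D} (s : I) : Trace x y → Trace x y :=
  Quot.map (fun p => p.deform s) fun _ _ h => h.deform s

/-- The product of a quotient map with the locally compact unit interval is again a quotient map, so
continuity can be tested on d-paths. -/
lemma Trace.continuous_deform {x y : D} :
    Continuous fun q : I × Trace x y => Trace.deform q.1 q.2 :=
  (isQuotientMap_quot_mk (r := Reparam (x := x) (y := y))).continuous_lift_prod_right
    (continuous_trace.comp DPath.continuous_deform)

lemma Trace.deform_zero {x y : D} (a : Trace x y) : a.deform 0 = a := by
  induction a using Quot.ind with | mk p =>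
  exact congrArg DPath.trace p.deform_zero

lemma Trace.deform_one {x y : D} {a b : Trace x y} (h : a.route = b.route) :
    a.deform 1 = b.deform 1 := by
  induction a using Quot.ind with | mk p =>
  induction b using Quot.ind with | mk q =>
  exact DPath.trace_deform_one h

lemma Trace.joined_deform {x y : D} (a : Trace x y) : Joined a (a.deform 1) :=
  ⟨⟨⟨fun s => a.deform s, Trace.continuous_deform.comp (Continuous.prodMk_left a)⟩,
    a.deform_zero, rfl⟩⟩

/-! ### Homotopy type of the trace spaces -/

lemma Joined.eq_of_discrete {X : Type} [TopologicalSpace X] [DiscreteTopology X] {x y : X}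
    (h : Joined x y) : x = y := by
  obtain ⟨γ⟩ := h
  have := (IsLocallyConstant.iff_continuous γ).2 γ.continuous
  simpa using this.apply_eq_of_isPreconnected isPreconnected_univ (Set.mem_univ 0) (Set.mem_univ 1)

lemma Trace.joined_iff {x y : D} {a b : Trace x y} : Joined a b ↔ a.route = b.route := by
  refine ⟨fun h => Joined.eq_of_discrete (h.map Trace.continuous_route), fun h => ?_⟩
  have := a.joined_deform
  rw [Trace.deform_one h] at this
  exact this.trans b.joined_deform.symm

/-- A space that is homotopy equivalent to a discrete space. -/
def HomotopyDiscrete (T : Type) [TopologicalSpace T] : Prop :=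
  ∃ (R : Type) (_ : TopologicalSpace R) (_ : DiscreteTopology R),
    Nonempty (ContinuousMap.HomotopyEquiv T R)

/-- The discrete model is the set of routes that occur. A choice of one trace for each route is a
homotopy inverse: the identity and the round trip are both homotopic to the final stage of the
deformation, which depends only on the route. -/
lemma Trace.homotopyDiscrete {x y : D} : HomotopyDiscrete (Trace x y) := by
  let R := Set.range (Trace.route : Trace x y → Fin 2)
  let f : C(Trace x y, R) := ⟨Set.rangeFactorization Trace.route,
    Trace.continuous_route.subtype_mk _⟩
  let g : C(R, Trace x y) := ⟨fun r => r.2.choose, continuous_of_discreteTopology⟩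
  have hg : ∀ r : R, (g r).route = r := fun r => r.2.choose_spec
  have hfg : f.comp g = ContinuousMap.id R := by ext r; exact congrArg _ (hg r)
  refine ⟨R, inferInstance, inferInstance, ⟨⟨f, g, ?_, hfg ▸ .refl _⟩⟩⟩
  have h1 : (ContinuousMap.id (Trace x y)).Homotopic
      ⟨fun a => a.deform 1, Trace.continuous_deform.comp (Continuous.prodMk_right 1)⟩ :=
    ⟨⟨⟨fun q => Trace.deform q.1 q.2, Trace.continuous_deform⟩, fun a => a.deform_zero,
      fun _ => rfl⟩⟩
  have h2 : (g.comp f).Homotopic ⟨fun a => a.deform 1,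
      Trace.continuous_deform.comp (Continuous.prodMk_right 1)⟩ := by
    refine ⟨⟨⟨fun q => Trace.deform q.1 (g (f q.2)), ?_⟩, fun a => Trace.deform_zero _,
      fun a => Trace.deform_one (hg _)⟩⟩
    exact Trace.continuous_deform.comp (f := fun q : I × Trace x y => (q.1, g (f q.2)))
      (by fun_prop)
  exact h2.trans h1.symm

/-- Conjugating with the equivalences to discrete spaces turns the map into a bijection of discrete
spaces; the inverse of this bijection, conjugated back, is the homotopy inverse. -/
lemma exists_homotopyEquiv_of_bijective {T T' : Type} [TopologicalSpace T] [TopologicalSpace T']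
    (hT : HomotopyDiscrete T) (hT' : HomotopyDiscrete T') (f : C(T, T'))
    (hf : Function.Bijective (Quotient.map f (fun _ _ h => Joined.map h f.continuous) :
      ZerothHomotopy T → ZerothHomotopy T')) :
    ∃ e : ContinuousMap.HomotopyEquiv T T', e.toFun = f := by
  obtain ⟨R, _, _, ⟨e⟩⟩ := hT
  obtain ⟨R', _, _, ⟨e'⟩⟩ := hT'
  have homotopic_joined : ∀ {X Y : Type} [TopologicalSpace X] [TopologicalSpace Y] {a b : C(X, Y)},
      a.Homotopic b → ∀ x, Joined (a x) (b x) := by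
    rintro X Y _ _ a b ⟨H⟩ x
    exact ⟨H.evalAt x⟩
  have hr : ∀ r, e.toFun (e.invFun r) = r := fun r =>
    Joined.eq_of_discrete (homotopic_joined e.right_inv r)
  have hr' : ∀ r, e'.toFun (e'.invFun r) = r := fun r =>
    Joined.eq_of_discrete (homotopic_joined e'.right_inv r)
  let g : R → R' := fun r => e'.toFun (f (e.invFun r))
  have hinj : Function.Injective g := by
    intro r s hrs
    have h1 : Joined (f (e.invFun r)) (f (e.invFun s)) := by
      have h2 := homotopic_joined e'.left_inv (f (e.invFun r))
      have h3 := homotopic_joined e'.left_inv (f (e.invFun s))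
      have h4 : e'.toFun (f (e.invFun r)) = e'.toFun (f (e.invFun s)) := hrs
      simp only [ContinuousMap.comp_apply, ContinuousMap.id_apply] at h2 h3
      rw [h4] at h2
      exact h2.symm.trans h3
    have h2 : (Quotient.mk (pathSetoid T) (e.invFun r)) = Quotient.mk _ (e.invFun s) :=
      hf.1 (Quotient.sound h1)
    have h3 := Joined.eq_of_discrete (Joined.map (Quotient.exact h2) e.toFun.continuous)
    rwa [hr, hr] at h3
  have hsurj : Function.Surjective g := by
    intro r'
    obtain ⟨a, ha⟩ := hf.2 (Quotient.mk _ (e'.invFun r'))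
    induction a using Quotient.ind with | _ a =>
    have h1 : Joined (f a) (e'.invFun r') := Quotient.exact ha
    refine ⟨e.toFun a, ?_⟩
    have h2 : Joined (e.invFun (e.toFun a)) a := homotopic_joined e.left_inv a
    have h3 := Joined.eq_of_discrete
      (((h2.map f.continuous).trans h1).map e'.toFun.continuous)
    rwa [hr'] at h3
  let E : R ≃ R' := Equiv.ofBijective g ⟨hinj, hsurj⟩
  let G : C(R, R') := ⟨g, continuous_of_discreteTopology⟩
  let K : C(R', R) := ⟨E.symm, continuous_of_discreteTopology⟩
  have hGK : G.comp K = ContinuousMap.id R' := by ext r; exact E.apply_symm_apply r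
  have hKG : K.comp G = ContinuousMap.id R := by ext r; exact E.symm_apply_apply r
  have hG : (e'.toFun.comp f).comp e.invFun = G := rfl
  refine ⟨⟨f, (e.invFun.comp K).comp e'.toFun, ?_, ?_⟩, rfl⟩
  · have h1 : ((((e.invFun.comp K).comp e'.toFun).comp f).comp (e.invFun.comp e.toFun)).Homotopic
        (((e.invFun.comp K).comp e'.toFun).comp f) := by
      simpa using ContinuousMap.Homotopic.comp (.refl (((e.invFun.comp K).comp e'.toFun).comp f))
        e.left_inv
    have h2 : (((e.invFun.comp K).comp e'.toFun).comp f).comp (e.invFun.comp e.toFun) =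
        e.invFun.comp e.toFun := by
      change (e.invFun.comp (K.comp G)).comp e.toFun = _
      rw [hKG]; rfl
    rw [h2] at h1
    exact h1.symm.trans e.left_inv
  · have h1 : ((e'.invFun.comp e'.toFun).comp (f.comp ((e.invFun.comp K).comp e'.toFun))).Homotopic
        (f.comp ((e.invFun.comp K).comp e'.toFun)) := by
      simpa using ContinuousMap.Homotopic.comp e'.left_inv
        (.refl (f.comp ((e.invFun.comp K).comp e'.toFun)))
    have h2 : (e'.invFun.comp e'.toFun).comp (f.comp ((e.invFun.comp K).comp e'.toFun)) =
        e'.invFun.comp e'.toFun := by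
      change (e'.invFun.comp (G.comp K)).comp e'.toFun = _
      rw [hGK]; rfl
    rw [h2] at h1
    exact h1.symm.trans e'.left_inv

/-- `f` induces bijections on the path components of non-empty trace spaces. -/
def PreservesComponents {X : Type} [TopologicalSpace X] [DSpace X] (f : DMap X X) : Prop :=
  ∀ x y : X, Nonempty (DPath x y) →
    Function.Bijective (Pi1.map f : Pi1 x y → Pi1 (f x) (f y))

/-- On the trace spaces of `D` the smallest and the largest admissible classes impose the same
condition, so everything between them does too. -/
lemma isPsp_iff {F : MorphismProperty TopCat.{0}} (h1 : homotopyEquivalences ≤ F)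
    (h2 : F ≤ pi0Bijections) {f : DMap D D} : IsPsp F f ↔ PreservesComponents f :=
  ⟨fun h x y hxy => h2 _ (h x y hxy), fun h x y hxy => h1 _ (exists_homotopyEquiv_of_bijective
    Trace.homotopyDiscrete Trace.homotopyDiscrete _ (h x y hxy))⟩

/-! ### The fundamental category of `D` -/

lemma DPath.cls_eq_iff {x y : D} {p q : DPath x y} : p.cls = q.cls ↔ p.route = q.route :=
  Quotient.eq.trans Trace.joined_iff

/-- The class `a` is represented by a d-path in the strip `A ∪ B i ∪ C`. -/
def Pi1.InStrip (i : Fin 2) {x y : D} (a : Pi1 x y) : Prop := ∃ p : DPath x y, p.cls = a ∧ p.InStrip i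

lemma Pi1.exists_rep {x y : D} (a : Pi1 x y) : ∃ p : DPath x y, p.cls = a := by
  induction a using Quotient.ind with | _ a =>
  induction a using Quot.ind with | mk p =>
  exact ⟨p, rfl⟩

lemma Pi1.exists_inStrip {x y : D} (a : Pi1 x y) : ∃ i, a.InStrip i := by
  obtain ⟨p, rfl⟩ := a.exists_rep
  exact p.exists_inStrip.imp fun i hi => ⟨p, rfl, hi⟩

lemma Pi1.InStrip.eq {x y : D} {i : Fin 2} {a b : Pi1 x y} (ha : a.InStrip i) (hb : b.InStrip i) :
    a = b := by
  obtain ⟨p, rfl, hp⟩ := ha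
  obtain ⟨q, rfl, hq⟩ := hb
  exact DPath.cls_eq_iff.2 (DPath.route_eq_of_inStrip hp hq)

lemma Pi1.InStrip.stripLE {x y : D} {i : Fin 2} {a : Pi1 x y} (ha : a.InStrip i) :
    StripLE i x y := by
  obtain ⟨p, -, hp⟩ := ha
  exact hp.stripLE

/-- Away from pairs that start in `A` and end in `C`, any strip that carries one d-path carries all
others with the same end points. -/
lemma Pi1.eq_of_not {x y : D} (hxy : ¬ (height x = 0 ∧ height y = 1)) (a b : Pi1 x y) : a = b := by
  obtain ⟨p, rfl⟩ := a.exists_rep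
  obtain ⟨q, rfl⟩ := b.exists_rep
  exact DPath.cls_eq_iff.2 (DPath.route_eq_of_inStrip p.inStrip_route
    (inStrip_congr hxy p.inStrip_route))

lemma stripLE_AA {i : Fin 2} {x y : Fin 2 → I} :
    StripLE i (D.mk .A x) (D.mk .A y) ↔ x ≤ y := by
  rw [Pi.le_def, forall_fin_two_iff i]
  exact ⟨fun h => ⟨h.leLong, h.leShort⟩, fun h => ⟨by simp, by simp, h.1, h.2⟩⟩

lemma stripLE_CC {i : Fin 2} {x y : Fin 2 → I} :
    StripLE i (D.mk .C x) (D.mk .C y) ↔ x ≤ y := by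
  rw [Pi.le_def, forall_fin_two_iff i]
  exact ⟨fun h => ⟨by simpa using h.leLong, h.leShort⟩,
    fun h => ⟨by simp, by simp, by simpa using h.1, h.2⟩⟩

lemma stripLE_AC {i : Fin 2} {x y : Fin 2 → I} :
    StripLE i (D.mk .A x) (D.mk .C y) ↔ x (1 - i) ≤ y (1 - i) :=
  ⟨fun h => h.leShort, fun h => ⟨by simp, by simp,
    by rw [long_A, long_C]; linarith [(x i).2.2, (y i).2.1], h⟩⟩

lemma height_eq_zero_iff {z : D} : height z = 0 ↔ ∃ x, z = D.mk .A x := by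
  constructor
  · intro h
    rcases normal z with x | ⟨k, x, h0, h1⟩ | x
    · exact ⟨x, rfl⟩
    · exact absurd (Subtype.ext h) h0.ne'
    · simp at h
  · rintro ⟨x, rfl⟩; simp

lemma height_eq_one_iff {z : D} : height z = 1 ↔ ∃ x, z = D.mk .C x := by
  constructor
  · intro h
    rcases normal z with x | ⟨k, x, h0, h1⟩ | x
    · simp at h
    · exact absurd (Subtype.ext h) h1.ne
    · exact ⟨x, rfl⟩
  · rintro ⟨x, rfl⟩; simp

/-- There are several classes of d-paths exactly between points `[A; x]` and `[C; y]` with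
`x ≤ y`. -/
lemma exists_ne_iff {x y : D} : (∃ a b : Pi1 x y, a ≠ b) ↔
    ∃ a b, x = D.mk .A a ∧ y = D.mk .C b ∧ a ≤ b := by
  constructor
  · rintro ⟨a, b, hab⟩
    by_cases hxy : height x = 0 ∧ height y = 1
    · obtain ⟨x, rfl⟩ := height_eq_zero_iff.1 hxy.1
      obtain ⟨y, rfl⟩ := height_eq_one_iff.1 hxy.2
      obtain ⟨i, hi⟩ := a.exists_inStrip
      obtain ⟨k, hk⟩ := b.exists_inStrip
      rcases eq_or_eq_one_sub i k with rfl | rfl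
      · exact absurd (hi.eq hk) hab
      -- Each of the two strips contributes the inequality of its short coordinates, and together
      -- these are both coordinates of the square.
      · refine ⟨x, y, rfl, rfl, ?_⟩
        rw [Pi.le_def, forall_fin_two_iff i]
        have := stripLE_AC.1 hk.stripLE
        rw [one_sub_one_sub] at this
        exact ⟨this, stripLE_AC.1 hi.stripLE⟩
    · exact absurd (Pi1.eq_of_not hxy a b) hab
  · rintro ⟨x, y, rfl, rfl, h⟩
    have h0 : StripLE 0 (D.mk .A x) (D.mk .C y) := stripLE_AC.2 (h _)
    have h1 : StripLE 1 (D.mk .A x) (D.mk .C y) := stripLE_AC.2 (h _)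
    refine ⟨h0.path.cls, h1.path.cls, fun he => ?_⟩
    have hr := DPath.cls_eq_iff.1 he
    have := h1.path.inStrip_route
    rw [← hr] at this
    have e : h0.path.route = 0 := by unfold DPath.route; rw [if_pos h0.path_inStrip]
    rw [e] at this
    exact not_inStrip_both (by simp) (by simp) this h1.path_inStrip

/-! ### A family of inessential maps -/

/-- The conditions on a function `[0, 3] → [0, 3]` under which it describes the action of an
inessential map on the long coordinate of a strip. -/
structure Profile (Φ : ℝ → ℝ) : Prop where
  cont : Continuous Φ
  mono : Monotone Φ
  -- Points only move forward, so the convex combinations with the identity increase with time and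
  -- form a directed homotopy.
  le : ∀ u, 0 ≤ u → u ≤ 3 → u ≤ Φ u
  one : Φ 1 = 1
  three : Φ 3 = 3
  -- The action on `C` is the translate of that on `A`; this makes the maps on the two strips agree
  -- on `C`.
  shift : ∀ u, 0 ≤ u → u ≤ 1 → Φ (u + 2) = Φ u + 2
  -- This condition and the next one ensure that no new pairs from `A` to `C` with increasing
  -- coordinates arise; they are needed for surjectivity on path components.
  strict : StrictMonoOn Φ (Set.Icc 0 1)
  lt_two : ∀ u, u < 2 → Φ u < Φ 2

/-- The convex combination of the identity and `Φ`. -/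
def blend (t : I) (Φ : ℝ → ℝ) (u : ℝ) : ℝ := (1 - t) * u + t * Φ u

lemma profile_id : Profile id :=
  ⟨continuous_id, monotone_id, fun _ _ _ => le_rfl, rfl, rfl, fun _ _ _ => rfl,
    strictMono_id.strictMonoOn _, fun _ h => h⟩

lemma convex_lt {t a b c d : ℝ} (h0 : 0 ≤ t) (h1 : t ≤ 1) (hab : a < b) (hcd : c < d) :
    (1 - t) * a + t * c < (1 - t) * b + t * d := by
  rcases h0.eq_or_lt with rfl | h
  · simpa using hab
  · exact add_lt_add_of_le_of_lt (mul_le_mul_of_nonneg_left hab.le (by linarith))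
      (mul_lt_mul_of_pos_left hcd h)

lemma Profile.blend {Φ : ℝ → ℝ} (h : Profile Φ) (t : I) : Profile (blend t Φ) where
  cont := by have := h.cont; unfold DirTop.blend; fun_prop
  mono u v huv := add_le_add (mul_le_mul_of_nonneg_left huv (by linarith [t.2.2]))
    (mul_le_mul_of_nonneg_left (h.mono huv) t.2.1)
  le u h0 h3 := by
    have := mul_le_mul_of_nonneg_left (h.le u h0 h3) t.2.1
    unfold DirTop.blend; linarith
  one := by simp [DirTop.blend, h.one]
  three := by simp only [DirTop.blend, h.three]; ring
  shift u h0 h1 := by simp only [DirTop.blend, h.shift u h0 h1]; ring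
  strict u hu v hv huv := convex_lt t.2.1 t.2.2 huv (h.strict hu hv huv)
  lt_two u hu := convex_lt t.2.1 t.2.2 hu (h.lt_two u hu)

lemma Profile.nonneg {Φ : ℝ → ℝ} (h : Profile Φ) {u : ℝ} (hu : 0 ≤ u) : 0 ≤ Φ u :=
  (h.le 0 le_rfl (by norm_num)).trans (h.mono hu)

lemma Profile.le_one {Φ : ℝ → ℝ} (h : Profile Φ) {u : ℝ} (hu : u ≤ 1) : Φ u ≤ 1 :=
  (h.mono hu).trans h.one.le

lemma Profile.le_three {Φ : ℝ → ℝ} (h : Profile Φ) {u : ℝ} (hu : u ≤ 3) : Φ u ≤ 3 :=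
  (h.mono hu).trans h.three.le

/-- The coordinatewise action of two functions on the square. -/
def squareMap (Φ : Fin 2 → ℝ → ℝ) (x : Fin 2 → I) : Fin 2 → I :=
  fun k => Set.projIcc 0 1 zero_le_one (Φ k (x k))

lemma squareMap_coe {Φ : Fin 2 → ℝ → ℝ} (h : ∀ i, Profile (Φ i)) (x : Fin 2 → I) (k : Fin 2) :
    (squareMap Φ x k : ℝ) = Φ k (x k) :=
  coe_projIcc ((h k).nonneg (x k).2.1) ((h k).le_one (x k).2.2)

lemma vec_eq_squareMap (Φ : Fin 2 → ℝ → ℝ) (x : Fin 2 → I) (i : Fin 2) :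
    vec i (Φ i (x i)) (Φ (1 - i) (x (1 - i))) = squareMap Φ x := by
  funext k
  rcases eq_or_eq_one_sub i k with rfl | rfl <;> simp [squareMap]

/-- The map of a strip that acts on the coordinates by `Φ i` and `Φ (1 - i)`. -/
def stripMap (Φ : Fin 2 → ℝ → ℝ) (i : Fin 2) (z : D) : D :=
  emb i (Φ i (long i z)) (Φ (1 - i) (short i z))

open Classical in
/-- The self-map of `D` that acts on the coordinates of strips by `Φ 0` and `Φ 1`. -/
def move (Φ : Fin 2 → ℝ → ℝ) (z : D) : D := if z ∈ strip 0 then stripMap Φ 0 z else stripMap Φ 1 z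

lemma stripMap_A {Φ : Fin 2 → ℝ → ℝ} (h : ∀ i, Profile (Φ i)) (i : Fin 2) (x : Fin 2 → I) :
    stripMap Φ i (D.mk .A x) = D.mk .A (squareMap Φ x) := by
  rw [stripMap, long_A, short_A, emb_A ((h i).le_one (x i).2.2), vec_eq_squareMap]

lemma stripMap_C {Φ : Fin 2 → ℝ → ℝ} (h : ∀ i, Profile (Φ i)) (i : Fin 2) (x : Fin 2 → I) :
    stripMap Φ i (D.mk .C x) = D.mk .C (squareMap Φ x) := by
  rw [stripMap, long_C, short_C, (h i).shift _ (x i).2.1 (x i).2.2,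
    emb_C (by linarith [(h i).nonneg (x i).2.1]), add_sub_cancel_right, vec_eq_squareMap]

/-- The strips meet in `A ∪ C`, where both strip maps are given by `squareMap Φ`. -/
lemma move_eq {Φ : Fin 2 → ℝ → ℝ} (h : ∀ i, Profile (Φ i)) {i : Fin 2} {z : D}
    (hz : z ∈ strip i) : move Φ z = stripMap Φ i z := by
  unfold move
  rcases strip_cases hz with ⟨x, rfl⟩ | ⟨x, h0, h1, rfl⟩ | ⟨x, rfl⟩
  · simp [stripMap_A h]
  · fin_cases i
    · exact if_pos hz
    · exact if_neg fun h => absurd ((mem_strip_B h0 h1).1 h) (by decide)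
  · simp [stripMap_C h]

lemma move_A {Φ : Fin 2 → ℝ → ℝ} (h : ∀ i, Profile (Φ i)) (x : Fin 2 → I) :
    move Φ (D.mk .A x) = D.mk .A (squareMap Φ x) :=
  (move_eq h (A_mem_strip 0 x)).trans (stripMap_A h 0 x)

lemma move_C {Φ : Fin 2 → ℝ → ℝ} (h : ∀ i, Profile (Φ i)) (x : Fin 2 → I) :
    move Φ (D.mk .C x) = D.mk .C (squareMap Φ x) :=
  (move_eq h (C_mem_strip 0 x)).trans (stripMap_C h 0 x)

lemma move_B {Φ : Fin 2 → ℝ → ℝ} (h : ∀ i, Profile (Φ i)) (i : Fin 2) (x : Fin 2 → I) :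
    move Φ (D.mk (.B i) x) = emb i (Φ i (x i + 1)) (Φ (1 - i) (x (1 - i))) := by
  rw [move_eq h (B_mem_strip i x), stripMap, long_B_self, short_B_self]

lemma move_mem_strip {Φ : Fin 2 → ℝ → ℝ} (h : ∀ i, Profile (Φ i)) {i : Fin 2} {z : D}
    (hz : z ∈ strip i) : move Φ z ∈ strip i := by
  rw [move_eq h hz]; exact emb_mem_strip _ _ _

lemma long_move {Φ : Fin 2 → ℝ → ℝ} (h : ∀ i, Profile (Φ i)) {i : Fin 2} {z : D}
    (hz : z ∈ strip i) : long i (move Φ z) = Φ i (long i z) := by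
  rw [move_eq h hz]
  exact long_emb ((h i).nonneg (long_nonneg hz)) ((h i).le_three (long_le hz))

lemma move_id (z : D) : move (fun _ => id) z = z := by
  obtain ⟨i, hi⟩ := exists_mem_strip z
  rw [move_eq (fun _ => profile_id) hi]
  exact emb_coords hi

lemma continuous_move_blend {Φ : Fin 2 → ℝ → ℝ} (h : ∀ i, Profile (Φ i)) :
    Continuous fun q : D × I => move (fun i => blend q.2 (Φ i)) q.1 := by
  have hs : ∀ i, Continuous fun q : D × I => stripMap (fun i => blend q.2 (Φ i)) i q.1 := by
    intro i
    have := continuous_long i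
    have := continuous_short i
    have := (h i).cont
    have := (h (1 - i)).cont
    exact (continuous_emb i).comp (f := fun q : D × I =>
      (blend q.2 (Φ i) (long i q.1), blend q.2 (Φ (1 - i)) (short i q.1)))
      (by unfold blend; fun_prop)
  have hu : (Set.univ : Set (D × I)) = Prod.fst ⁻¹' strip 0 ∪ Prod.fst ⁻¹' strip 1 := by
    symm
    refine Set.eq_univ_of_forall fun q => ?_
    obtain ⟨i, hi⟩ := exists_mem_strip q.1
    fin_cases i
    · exact .inl hi
    · exact .inr hi
  rw [← continuousOn_univ, hu]
  refine ContinuousOn.union_of_isClosed ?_ ?_ ((isClosed_strip 0).preimage continuous_fst)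
    ((isClosed_strip 1).preimage continuous_fst)
  · exact (hs 0).continuousOn.congr fun q hq => move_eq (fun i => (h i).blend q.2) hq
  · exact (hs 1).continuousOn.congr fun q hq => move_eq (fun i => (h i).blend q.2) hq

/-- Monotonicity in time comes from `u ≤ Φ u`; it is what makes the homotopy a d-map on the product
with the directed interval. -/
lemma blend_mono {Φ : ℝ → ℝ} (h : Profile Φ) {t t' : I} {u u' : ℝ} (ht : t ≤ t') (hu : u ≤ u')
    (h0 : 0 ≤ u) (h3 : u ≤ 3) : blend t Φ u ≤ blend t' Φ u' := by
  refine le_trans ?_ ((h.blend t').mono hu)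
  have : (t : ℝ) ≤ t' := ht
  have := mul_le_mul_of_nonneg_right this (sub_nonneg.2 (h.le u h0 h3))
  unfold blend
  linarith

/-- The flow from the identity to `move Φ`. -/
def moveHomotopy {Φ : Fin 2 → ℝ → ℝ} (h : ∀ i, Profile (Φ i)) : DMap (D × I) D where
  toFun q := move (fun i => blend q.2 (Φ i)) q.1
  continuous_toFun := continuous_move_blend h
  map_dpath p hp := by
    obtain ⟨i, hi⟩ := isDPath_iff.1 hp.1
    have ht : Monotone fun s => (p s).2 := hp.2
    have hm : ∀ s, (p s).1 ∈ strip i := fun s => hi.mem s trivial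
    refine isDPath_emb (i := i) (u := fun s => blend (p s).2 (Φ i) (long i (p s).1))
      (v := fun s => blend (p s).2 (Φ (1 - i)) (short i (p s).1))
      (fun s => move_eq (fun i => (h i).blend _) (hm s))
      (fun s s' hs => blend_mono (h i) (ht hs) (hi.monoLong trivial trivial hs)
        (long_nonneg (hm s)) (long_le (hm s)))
      (fun s s' hs => blend_mono (h _) (ht hs) (hi.monoShort trivial trivial hs)
        (short_nonneg (hm s)) ((short_le (hm s)).trans (by norm_num))) ?_ ?_ ?_ ?_
    · exact ((h i).blend _).nonneg (long_nonneg (hm 0))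
    · exact ((h i).blend _).le_three (long_le (hm 1))
    · exact ((h _).blend _).nonneg (short_nonneg (hm 0))
    · exact ((h _).blend _).le_one (short_le (hm 1))

/-- The d-map `move Φ`. -/
def moveMap {Φ : Fin 2 → ℝ → ℝ} (h : ∀ i, Profile (Φ i)) : DMap D D :=
  (moveHomotopy h).comp (sliceAt 1)

lemma moveMap_apply {Φ : Fin 2 → ℝ → ℝ} (h : ∀ i, Profile (Φ i)) (z : D) :
    moveMap h z = move Φ z := by
  change move (fun i => blend 1 (Φ i)) z = _
  congr 1
  funext i u
  simp [blend]

/-- The flow from the identity to `move Φ`. -/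
def moveFlow {Φ : Fin 2 → ℝ → ℝ} (h : ∀ i, Profile (Φ i)) : FutureFlow (moveMap h) where
  H := moveHomotopy h
  zero z := by
    change move (fun i => blend 0 (Φ i)) z = z
    rw [← move_id z]
    congr 1
    · funext i u; simp [blend]
    · rw [move_id]
  one z := rfl

/-- Representatives may differ, but they have the same route, and a path from `A` to `C` runs in no
other strip than that of its route. -/
lemma Pi1.not_inStrip_both {x y : D} (hx : height x = 0) (hy : height y = 1) {a : Pi1 x y}
    {i : Fin 2} (h : a.InStrip i) : ¬ a.InStrip (1 - i) := by
  rintro ⟨q, rfl, hq⟩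
  obtain ⟨p, hpq, hp⟩ := h
  have hr := DPath.cls_eq_iff.1 hpq
  have h1 := p.inStrip_route
  have h2 := q.inStrip_route
  rw [← hr] at h2
  rcases eq_or_eq_one_sub i p.route with hi | hi
  · rw [hi] at h2; exact DirTop.not_inStrip_both hx hy h2 hq
  · rw [hi] at h1; exact DirTop.not_inStrip_both hx hy hp h1

/-! ### Moves preserve the path components of trace spaces -/

section

variable {Φ : Fin 2 → ℝ → ℝ} {g : DMap D D}

lemma Pi1.InStrip.map_of_move (h : ∀ i, Profile (Φ i)) (hg : ∀ z, g z = move Φ z) {x y : D} {i : Fin 2}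
    {a : Pi1 x y} (ha : a.InStrip i) : (Pi1.map g a).InStrip i := by
  obtain ⟨p, rfl, hp⟩ := ha
  refine ⟨p.map g, rfl, fun t => ?_⟩
  change g (p.1 t) ∈ _
  rw [hg]
  exact move_mem_strip h (hp t)

lemma exists_of_move_eq_A (h : ∀ i, Profile (Φ i)) {x : D} {a : Fin 2 → I}
    (hx : move Φ x = D.mk .A a) : ∃ b, x = D.mk .A b := by
  rcases normal x with b | ⟨i, b, h0, h1⟩ | b
  · exact ⟨b, rfl⟩
  · have h2 := long_move h (B_mem_strip i b)
    have h0' : (0 : ℝ) < b i := h0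
    have h1' : (b i : ℝ) ≤ 1 := (b i).2.2
    have h3 := (h i).le (b i + 1) (by linarith) (by linarith)
    rw [hx, long_A, long_B_self] at h2
    linarith [(a i).2.2]
  · rw [move_C h] at hx
    exact absurd hx.symm D.mk_A_ne_C

/-- A point `y` in the interior of `B i` cannot reach such a point of `C`: by `lt_two` its image has
long coordinate below `Φ i 2 = Φ i 0 + 2`, whereas the image of a point of `A` has `i`-th coordinate
at least `Φ i 0`. On `C` the inequalities can be pulled back since the action is strictly monotone.
-/
lemma le_of_move (h : ∀ i, Profile (Φ i)) {x y : D} {a b : Fin 2 → I}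
    (hx : move Φ x = D.mk .A a)
    (hy : move Φ y = D.mk .C b) (hab : a ≤ b) :
    ∃ a b, x = D.mk .A a ∧ y = D.mk .C b ∧ a ≤ b := by
  obtain ⟨a', rfl⟩ := exists_of_move_eq_A h hx
  rw [move_A h] at hx
  obtain rfl := D.mk_A_inj hx
  rcases normal y with b' | ⟨i, b', h0, h1⟩ | b'
  · rw [move_A h] at hy
    exact absurd hy D.mk_A_ne_C
  · have h2 := long_move h (B_mem_strip i b')
    have h1' : (b' i : ℝ) < 1 := h1
    have h3 := (h i).lt_two (b' i + 1) (by linarith)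
    have h4 := (h i).shift 0 le_rfl zero_le_one
    have h5 : (squareMap Φ a' i : ℝ) ≤ b i := hab i
    rw [squareMap_coe h] at h5
    have h6 := (h i).mono (a' i).2.1
    rw [zero_add] at h4
    rw [hy, long_C, long_B_self] at h2
    linarith
  · rw [move_C h] at hy
    obtain rfl := D.mk_C_inj hy
    refine ⟨a', b', rfl, rfl, fun i => ?_⟩
    have h5 : (squareMap Φ a' i : ℝ) ≤ squareMap Φ b' i := hab i
    rw [squareMap_coe h, squareMap_coe h] at h5
    exact ((h i).strict.le_iff_le (a' i).2 (b' i).2).1 h5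

/-- Moves preserve strips. Distinct classes go from `A` to `C` in distinct strips, and so do their
images, which gives injectivity. If a class is missed by the image of one path, there are several
classes between the image points, hence by `le_of_move` d-paths in both strips between the original
points, and one of them is sent to the missed class. -/
lemma preservesComponents_of_move (h : ∀ i, Profile (Φ i))
    (hg : ∀ z, g z = move Φ z) : PreservesComponents g := by
  intro x y hxy
  constructor
  · intro a b hab
    by_contra hne
    obtain ⟨x, y, rfl, rfl, -⟩ := exists_ne_iff.1 ⟨a, b, hne⟩
    obtain ⟨i, hi⟩ := a.exists_inStrip
    obtain ⟨k, hk⟩ := b.exists_inStrip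
    rcases eq_or_eq_one_sub i k with rfl | rfl
    · exact hne (hi.eq hk)
    have h1 := hi.map_of_move h hg
    have h2 := hk.map_of_move h hg
    rw [← hab] at h2
    refine Pi1.not_inStrip_both ?_ ?_ h1 h2
    · rw [hg, move_A h, height_A]
    · rw [hg, move_C h, height_C]
  · intro c
    obtain ⟨p⟩ := hxy
    by_cases hc : Pi1.map g p.cls = c
    · exact ⟨_, hc⟩
    obtain ⟨a, b, ha, hb, hab⟩ := exists_ne_iff.1 ⟨_, _, hc⟩
    rw [hg] at ha hb
    obtain ⟨a, b, rfl, rfl, hab⟩ := le_of_move h ha hb hab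
    obtain ⟨i, hi⟩ := c.exists_inStrip
    have hs : StripLE i (D.mk .A a) (D.mk .C b) := stripLE_AC.2 (hab _)
    have hs' : Pi1.InStrip i hs.path.cls := ⟨_, rfl, hs.path_inStrip⟩
    exact ⟨_, (hs'.map_of_move h hg).eq hi⟩

end

/-- Each level of the flow is again a move, for a convex combination of the profiles with the
identity. -/
lemma futureInessential_moveMap {F : MorphismProperty TopCat.{0}} (h1 : homotopyEquivalences ≤ F)
    (h2 : F ≤ pi0Bijections) {Φ : Fin 2 → ℝ → ℝ} (h : ∀ i, Profile (Φ i)) :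
    FutureInessential F (moveMap h) :=
  ⟨moveFlow h, fun t => (isPsp_iff h1 h2).2
    (preservesComponents_of_move (fun i => (h i).blend t) fun _ => rfl)⟩

/-! ### Construction of profiles -/

/-- Truncation to the unit interval. -/
def clamp (u : ℝ) : ℝ := (Set.projIcc 0 1 zero_le_one u : I)

lemma clamp_of_mem {u : ℝ} (h0 : 0 ≤ u) (h1 : u ≤ 1) : clamp u = u := coe_projIcc h0 h1

lemma clamp_of_nonpos {u : ℝ} (h : u ≤ 0) : clamp u = 0 :=
  congrArg Subtype.val (Set.projIcc_of_le_left zero_le_one h)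

lemma clamp_of_one_le {u : ℝ} (h : 1 ≤ u) : clamp u = 1 :=
  congrArg Subtype.val (Set.projIcc_of_right_le zero_le_one h)

lemma clamp_mem (u : ℝ) : clamp u ∈ Set.Icc (0 : ℝ) 1 := Subtype.prop _

lemma continuous_clamp : Continuous clamp := continuous_subtype_val.comp continuous_projIcc

lemma monotone_clamp : Monotone clamp := fun _ _ h => Set.monotone_projIcc _ h

/-- The action of an inessential map on the coordinates of the squares `A` and `C`. -/
structure SquareProfile (φ : ℝ → ℝ) : Prop where
  cont : Continuous φ
  strict : StrictMonoOn φ (Set.Icc 0 1)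
  one : φ 1 = 1
  le : ∀ s, 0 ≤ s → s ≤ 1 → s ≤ φ s

/-- The function `[0, 1] → [0, 1]` that is constant with value `c` on `[c / K, c]`, and otherwise
as small as possible. -/
def plateau (c K s : ℝ) : ℝ := max s (min c (K * s))

/-- The function on `[0, 3]` that restricts to `φ` on the squares `A` and `C`, and stretches the
square between them according to `θ`. -/
def profile (φ θ : ℝ → ℝ) (u : ℝ) : ℝ :=
  -- The three summands account for the growth over the three unit intervals. The middle one runs
  -- from `1` to `2 + φ 0`, where the image of `C` begins, hence the factor `1 + φ 0`.
  φ (clamp u) + (1 + φ 0) * θ (clamp (u - 1)) + (φ (clamp (u - 2)) - φ 0)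

/-- The bound `c < 1` ends the plateau before the edge of `C`, which gives `lt_two`; a nonnegative
slope keeps the function monotone. -/
structure PlateauBounds (c K : ℝ) : Prop where
  nonneg : 0 ≤ c
  lt_one : c < 1
  slope : 0 ≤ K

lemma plateau_zero {c K : ℝ} (h : PlateauBounds c K) : plateau c K 0 = 0 := by
  simp [plateau, h.nonneg]

lemma plateau_one {c K : ℝ} (h : PlateauBounds c K) : plateau c K 1 = 1 :=
  max_eq_left ((min_le_left _ _).trans h.lt_one.le)

section

variable {φ : ℝ → ℝ} {c K : ℝ}

lemma profile_A (hc : PlateauBounds c K) {u : ℝ} (h0 : 0 ≤ u) (h1 : u ≤ 1) : profile φ (plateau c K) u = φ u := by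
  rw [profile, clamp_of_mem h0 h1, clamp_of_nonpos (by linarith), clamp_of_nonpos (by linarith),
    plateau_zero hc]
  ring

lemma profile_B (h : SquareProfile φ) {u : ℝ} (h1 : 1 ≤ u) (h2 : u ≤ 2) :
    profile φ (plateau c K) u = 1 + (1 + φ 0) * plateau c K (u - 1) := by
  rw [profile, clamp_of_one_le h1, clamp_of_mem (by linarith) (by linarith),
    clamp_of_nonpos (by linarith), h.one]
  ring

lemma profile_C (h : SquareProfile φ) (hc : PlateauBounds c K) {u : ℝ} (h2 : 2 ≤ u)
    (h3 : u ≤ 3) : profile φ (plateau c K) u = 2 + φ (u - 2) := by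
  rw [profile, clamp_of_one_le (by linarith), clamp_of_one_le (by linarith),
    clamp_of_mem (by linarith) (by linarith), h.one, plateau_one hc]
  ring

lemma profile_profile (h : SquareProfile φ) (hc : PlateauBounds c K) :
    Profile (profile φ (plateau c K)) where
  cont := by
    have := h.cont
    have := continuous_clamp
    unfold profile plateau
    fun_prop
  mono u v huv := by
    have hφ : ∀ {a b : ℝ}, a ≤ b → φ (clamp a) ≤ φ (clamp b) := fun hab =>
      h.strict.monotoneOn (clamp_mem _) (clamp_mem _) (monotone_clamp hab)
    have hθ : plateau c K (clamp (u - 1)) ≤ plateau c K (clamp (v - 1)) := by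
      have := monotone_clamp (sub_le_sub_right huv 1)
      exact max_le_max this (min_le_min le_rfl (mul_le_mul_of_nonneg_left this hc.slope))
    exact add_le_add (add_le_add (hφ huv) (mul_le_mul_of_nonneg_left hθ
      (by linarith [h.le 0 le_rfl zero_le_one]))) (sub_le_sub_right (hφ (by linarith)) _)
  le u h0 h3 := by
    rcases le_total u 1 with h1 | h1
    · rw [profile_A hc h0 h1]; exact h.le u h0 h1
    rcases le_total u 2 with h2 | h2
    · rw [profile_B h h1 h2]
      have hp : u - 1 ≤ plateau c K (u - 1) := le_max_left _ _
      have := mul_nonneg (h.le 0 le_rfl zero_le_one) (show 0 ≤ plateau c K (u - 1) by linarith)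
      linarith
    · rw [profile_C h hc h2 h3]
      linarith [h.le (u - 2) (by linarith) (by linarith)]
  one := by rw [profile_A hc zero_le_one le_rfl, h.one]
  three := by rw [profile_C h hc (by norm_num) le_rfl]; norm_num [h.one]
  shift u h0 h1 := by
    rw [profile_C h hc (by linarith) (by linarith), profile_A hc h0 h1]; ring_nf
  strict u hu v hv huv := by
    rw [profile_A hc hu.1 hu.2, profile_A hc hv.1 hv.2]; exact h.strict hu hv huv
  lt_two u hu := by
    have hφ0 := h.le 0 le_rfl zero_le_one
    rw [profile_C h hc le_rfl (by norm_num), sub_self]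
    rcases le_total u 1 with h1 | h1
    · rw [profile, clamp_of_nonpos (by linarith : u - 1 ≤ 0),
        clamp_of_nonpos (by linarith : u - 2 ≤ 0), plateau_zero hc]
      have := h.strict.monotoneOn (clamp_mem u) (Set.right_mem_Icc.2 zero_le_one) (clamp_mem u).2
      rw [h.one] at this
      linarith
    · rw [profile_B h h1 hu.le]
      have : plateau c K (u - 1) < 1 := max_lt (by linarith) ((min_le_left _ _).trans_lt hc.lt_one)
      have := mul_lt_mul_of_pos_left this (show 0 < 1 + φ 0 by linarith)
      linarith

end

/-- These values are the case without a plateau: the stretching function is the identity on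
nonnegative numbers. -/
lemma plateauBounds_zero : PlateauBounds 0 0 := ⟨le_rfl, zero_lt_one, le_rfl⟩

lemma plateau_zero_zero {s : ℝ} (h : 0 ≤ s) : plateau 0 0 s = s := by simp [plateau, h]

lemma squareProfile_id : SquareProfile id :=
  ⟨continuous_id, strictMono_id.strictMonoOn _, rfl, fun _ _ _ => le_rfl⟩

lemma squareProfile_affine {a : ℝ} (h0 : 0 ≤ a) (h1 : a < 1) :
    SquareProfile fun s => a + (1 - a) * s where
  cont := by fun_prop
  strict s _ t _ hst := by
    have := mul_lt_mul_of_pos_left hst (sub_pos.2 h1)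
    simp only; linarith
  one := by ring
  le s hs0 hs1 := by
    have := mul_nonneg h0 (sub_nonneg.2 hs1)
    linarith

/-- This supplies the small constants below: a positive number below all positive members of a
finite family, irrespective of the others. -/
lemma exists_pos_le {ι : Type} [Finite ι] (c : ι → ℝ) :
    ∃ ε : ℝ, 0 < ε ∧ ε ≤ 1 ∧ ∀ i, 0 < c i → ε ≤ c i := by
  have h1 : ∀ᶠ ε : ℝ in nhdsWithin 0 (Set.Ioi 0), ε ≤ 1 :=
    Filter.mem_of_superset (Ioc_mem_nhdsGT zero_lt_one) fun x hx => hx.2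
  have h2 : ∀ᶠ ε : ℝ in nhdsWithin 0 (Set.Ioi 0), ∀ i, 0 < c i → ε ≤ c i :=
    Filter.eventually_all.2 fun i => by
      by_cases hi : 0 < c i
      · exact Filter.mem_of_superset (Ioc_mem_nhdsGT hi) fun x hx _ => hx.2
      · exact Filter.Eventually.of_forall fun x h => absurd h hi
  obtain ⟨ε, ⟨h3, h4⟩, h5⟩ := ((h1.and h2).and self_mem_nhdsWithin).exists
  exact ⟨ε, h5, h3, h4⟩

/-- Interpolation by a square profile. -/
lemma exists_squareProfile {ι : Type} [Fintype ι] (v u : ι → ℝ) (h0 : ∀ k, 0 ≤ v k)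
    (hvu : ∀ k, v k ≤ u k) (hu : ∀ k, u k ≤ 1) (hlt : ∀ k l, v k < v l → u k < u l)
    (heq : ∀ k l, v k = v l → u k = u l) (h1 : ∀ k, v k < 1 → u k < 1) :
    ∃ φ, SquareProfile φ ∧ ∀ k, φ (v k) = u k := by
  -- The final `ε` is below all gaps between distinct values `u`, all gaps between distinct nodes
  -- `v`, and all distances of values `u` from `1`.
  obtain ⟨ε₁, hε₁, hε₁', hgap⟩ := exists_pos_le fun p : ι × ι => u p.2 - u p.1
  obtain ⟨ε₂, hε₂, hε₂', hgap'⟩ := exists_pos_le fun p : ι × ι => v p.2 - v p.1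
  obtain ⟨ε₃, hε₃, hε₃', htop⟩ := exists_pos_le fun k => 1 - u k
  obtain ⟨ε, hε, hε', hle⟩ := exists_pos_le ![ε₁, ε₂, ε₃]
  have hl1 : ε ≤ ε₁ := hle 0 hε₁
  have hl2 : ε ≤ ε₂ := hle 1 hε₂
  have hl3 : ε ≤ ε₃ := hle 2 hε₃
  -- The profile is the maximum of the identity and of one function for each node, through `(v k, u
  -- k)`, of slope `ε⁻¹` to the left and `ε` to the right. To the right it gains less than the gap
  -- to the next value, to the left it has dropped by at least `1` at the previous node, so it never
  -- exceeds the prescribed values.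
  let g : Option ι → ℝ → ℝ := fun o s =>
    o.elim s fun k => u k + min (ε * (s - v k)) (ε⁻¹ * (s - v k))
  have hgc : ∀ o, Continuous (g o) := by
    rintro (_ | k)
    · exact continuous_id
    · simp only [g, Option.elim]; fun_prop
  have hgs : ∀ o, StrictMono (g o) := by
    rintro (_ | k) s t hst
    · exact hst
    · simp only [g, Option.elim]
      have hst' : s - v k < t - v k := by linarith
      have := min_lt_min (mul_lt_mul_of_pos_left hst' hε)
        (mul_lt_mul_of_pos_left hst' (inv_pos.2 hε))
      linarith
  have hgv : ∀ o l, g o (v l) ≤ u l := by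
    rintro (_ | k) l
    · exact hvu l
    · simp only [g, Option.elim]
      rcases lt_trichotomy (v k) (v l) with h | h | h
      · have h2 := hgap (k, l) (sub_pos.2 (hlt _ _ h))
        have h3 : ε * (v l - v k) ≤ ε * 1 :=
          mul_le_mul_of_nonneg_left (by linarith [h0 k, hvu l, hu l]) hε.le
        have := min_le_left (ε * (v l - v k)) (ε⁻¹ * (v l - v k))
        simp only at h2
        linarith
      · rw [h, heq _ _ h]; simp
      · have h2 := hgap' (l, k) (sub_pos.2 h)
        simp only at h2
        have h3 : 1 ≤ ε⁻¹ * (v k - v l) := by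
          rw [← inv_mul_cancel₀ hε.ne']
          exact mul_le_mul_of_nonneg_left (by linarith) (inv_pos.2 hε).le
        have := min_le_right (ε * (v l - v k)) (ε⁻¹ * (v l - v k))
        have := h0 l
        have := hvu l
        have := hu k
        linarith
  have hg1 : ∀ o, g o 1 ≤ 1 := by
    rintro (_ | k)
    · exact le_rfl
    · simp only [g, Option.elim]
      have h2 := min_le_left (ε * (1 - v k)) (ε⁻¹ * (1 - v k))
      rcases ((hvu k).trans (hu k)).lt_or_eq with h | h
      · have := htop k (sub_pos.2 (h1 k h))
        have h3 : ε * (1 - v k) ≤ ε * 1 :=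
          mul_le_mul_of_nonneg_left (by linarith [h0 k]) hε.le
        linarith
      · have := hu k
        rw [h] at h2 ⊢
        simp only [sub_self, mul_zero, min_self]
        linarith
  have hne : (Finset.univ : Finset (Option ι)).Nonempty := Finset.univ_nonempty
  have hle : ∀ o s, g o s ≤ Finset.univ.sup' hne fun o => g o s := fun o s =>
    Finset.le_sup' (fun o => g o s) (Finset.mem_univ o)
  refine ⟨fun s => Finset.univ.sup' hne fun o => g o s, ⟨?_, ?_, ?_, ?_⟩, fun k => ?_⟩
  · exact Continuous.finset_sup'_apply hne fun o _ => hgc o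
  · intro s _ t _ hst
    exact (Finset.sup'_lt_iff hne).2 fun o _ => (hgs o hst).trans_le (hle o t)
  · exact le_antisymm (Finset.sup'_le hne _ fun o _ => hg1 o) (hle none 1)
  · exact fun s _ _ => hle none s
  · refine le_antisymm (Finset.sup'_le hne _ fun o _ => hgv o k) ?_
    refine le_trans ?_ (hle (some k) (v k))
    simp [g]

/-- Two finite configurations of points in the square with the same order type in each coordinate
are moved to the same configuration by suitable profiles. -/
lemma exists_profiles {ι : Type} [Fintype ι] (x x' : ι → Fin 2 → I)
    (hlt : ∀ i k l, x k i < x l i ↔ x' k i < x' l i) (h1 : ∀ i k, x k i = 1 ↔ x' k i = 1) :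
    ∃ Φ Φ' : Fin 2 → ℝ → ℝ, (∀ i, Profile (Φ i)) ∧ (∀ i, Profile (Φ' i)) ∧
      ∀ k, squareMap Φ (x k) = squareMap Φ' (x' k) := by
  have key : ∀ i, ∃ Φ Φ' : ℝ → ℝ, Profile Φ ∧ Profile Φ' ∧ ∀ k, Φ (x k i) = Φ' (x' k i) := by
    intro i
    obtain ⟨δ₁, hδ₁, -, hs₁⟩ := exists_pos_le fun k => 1 - (x k i : ℝ)
    obtain ⟨δ₂, hδ₂, -, hs₂⟩ := exists_pos_le fun k => 1 - (x' k i : ℝ)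
    obtain ⟨δ, hδ, hδ1, hle⟩ := exists_pos_le ![δ₁, δ₂]
    have hl1 : δ ≤ δ₁ := hle 0 hδ₁
    have hl2 : δ ≤ δ₂ := hle 1 hδ₂
    -- The averages have the common order type of both configurations.
    let w : ι → ℝ := fun k => ((x k i : ℝ) + x' k i) / 2
    have hw0 : ∀ k, 0 ≤ w k := fun k => by
      have := (x k i).2.1; have := (x' k i).2.1; simp only [w]; linarith
    have hw1 : ∀ k, w k ≤ 1 := fun k => by
      have := (x k i).2.2; have := (x' k i).2.2; simp only [w]; linarith
    -- Profiles only move points forward. Contracting the averages towards `1` by a small `δ` puts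
    -- the common targets above all coordinates that are not yet `1`, and keeps the order.
    let u : ι → ℝ := fun k => 1 - δ * (1 - w k)
    have hu1 : ∀ k, u k ≤ 1 := fun k => by
      have := mul_nonneg hδ.le (sub_nonneg.2 (hw1 k)); simp only [u]; linarith
    have hwlt : ∀ k l, x k i < x l i → w k < w l := fun k l h => by
      have h2 : (x' k i : ℝ) < x' l i := (hlt i k l).1 h
      have h3 : (x k i : ℝ) < x l i := h
      simp only [w]; linarith
    have hulow : ∀ k, 1 - δ ≤ u k := fun k => by
      have := mul_le_mul_of_nonneg_left (show 1 - w k ≤ 1 by linarith [hw0 k]) hδ.le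
      simp only [u]; linarith
    have hult : ∀ k l, x k i < x l i → u k < u l := fun k l h => by
      have := mul_lt_mul_of_pos_left (hwlt k l h) hδ
      simp only [u]; linarith
    have hueq : ∀ k l, x k i = x l i → u k = u l := fun k l h => by
      have h2 : x' k i = x' l i := by
        refine le_antisymm (not_lt.1 fun h' => ?_) (not_lt.1 fun h' => ?_)
        · exact ((hlt i l k).2 h').ne h.symm
        · exact ((hlt i k l).2 h').ne h
      simp only [u, w, h, h2]
    have hwone : ∀ k, x k i = 1 → u k = 1 := fun k h => by
      simp [u, w, h, (h1 i k).1 h]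
    have hwlt1 : ∀ k, x k i < 1 → u k < 1 := fun k h => by
      have h2 : (x k i : ℝ) < 1 := h
      have := mul_pos hδ (show 0 < 1 - w k by simp only [w]; linarith [(x' k i).2.2])
      simp only [u]; linarith
    have hxu : ∀ k, (x k i : ℝ) ≤ u k := fun k => by
      rcases (x k i).2.2.lt_or_eq with h | h
      · linarith [hs₁ k (sub_pos.2 h), hulow k]
      · rw [h, hwone k (Subtype.ext h)]
    have hxu' : ∀ k, (x' k i : ℝ) ≤ u k := fun k => by
      rcases (x' k i).2.2.lt_or_eq with h | h
      · linarith [hs₂ k (sub_pos.2 h), hulow k]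
      · rw [h, hwone k ((h1 i k).2 (Subtype.ext h))]
    have htr : ∀ k l, x' k i = x' l i → x k i = x l i := fun k l h =>
      le_antisymm (not_lt.1 fun h' => ((hlt i l k).1 h').ne h.symm)
        (not_lt.1 fun h' => ((hlt i k l).1 h').ne h)
    obtain ⟨φ, hφ, hφu⟩ := exists_squareProfile (fun k => (x k i : ℝ)) u (fun k => (x k i).2.1) hxu
      hu1 (fun k l h => hult k l h) (fun k l h => hueq k l (Subtype.ext h)) fun k h => hwlt1 k h
    obtain ⟨φ', hφ', hφu'⟩ := exists_squareProfile (fun k => (x' k i : ℝ)) u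
      (fun k => (x' k i).2.1) hxu' hu1 (fun k l h => hult k l ((hlt i k l).2 h))
      (fun k l h => hueq k l (htr k l (Subtype.ext h))) fun k h => hwlt1 k
        (unitInterval.lt_one_iff_ne_one.2 fun h' => h.ne (congrArg Subtype.val ((h1 i k).1 h')))
    refine ⟨_, _, profile_profile hφ plateauBounds_zero, profile_profile hφ' plateauBounds_zero,
      fun k => ?_⟩
    rw [profile_A plateauBounds_zero (x k i).2.1 (x k i).2.2,
      profile_A plateauBounds_zero (x' k i).2.1 (x' k i).2.2, hφu, hφu']
  choose Φ Φ' h h' he using key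
  refine ⟨Φ, Φ', h, h', fun k => ?_⟩
  funext i
  simp only [squareMap, he]

/-- Finitely many points can be moved into the squares `A` and `C`. -/
lemma exists_move_mem_corner {ι : Type} [Finite ι] (z : ι → D) :
    ∃ Φ : Fin 2 → ℝ → ℝ, (∀ i, Profile (Φ i)) ∧
      ∀ k, (∃ x, move Φ (z k) = D.mk .A x) ∨ ∃ x, move Φ (z k) = D.mk .C x := by
  obtain ⟨ε, hε, -, hle⟩ := exists_pos_le fun k => height (z k)
  have hφ := squareProfile_affine (a := 1 / 2) (by norm_num) (by norm_num)
  -- Here `φ 0 = 1 / 2`, so the middle square is stretched by `3 / 2`, and the plateau value `2 / 3`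
  -- is sent to `1 + 3 / 2 * (2 / 3) = 2`, the beginning of `C`. The slope `ε⁻¹` puts every point of
  -- height at least `ε` at or above this value.
  have hc : PlateauBounds (2 / 3) ε⁻¹ := ⟨by norm_num, by norm_num, (inv_pos.2 hε).le⟩
  have h := profile_profile hφ hc
  refine ⟨fun _ => _, fun _ => h, fun k => ?_⟩
  have hk := hle k
  generalize z k = y at hk
  rcases normal y with x | ⟨i, x, h0, h1⟩ | x
  · exact .inl ⟨_, move_A (fun _ => h) x⟩
  · refine .inr ?_
    rw [move_B (fun _ => h), emb_C]
    · exact ⟨_, rfl⟩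
    · have h2 := hk h0
      rw [height_B] at h2
      rw [profile_B hφ (by linarith [(x i).2.1]) (by linarith [(x i).2.2])]
      have h3 : 2 / 3 ≤ plateau (2 / 3) ε⁻¹ (x i + 1 - 1) := by
        rw [add_sub_cancel_right]
        refine le_max_of_le_right (le_min le_rfl ?_)
        have := mul_le_mul_of_nonneg_left h2 (inv_pos.2 hε).le
        rw [inv_mul_cancel₀ hε.ne'] at this
        linarith
      linarith
  · exact .inr ⟨_, move_C (fun _ => h) x⟩

/-! ### Reachability in normal form -/

lemma reach_AA {a b : Fin 2 → I} : Nonempty (DPath (D.mk .A a) (D.mk .A b)) ↔ a ≤ b := by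
  rw [nonempty_dpath_iff]
  exact ⟨fun ⟨i, h⟩ => stripLE_AA.1 h, fun h => ⟨0, stripLE_AA.2 h⟩⟩

lemma reach_CC {a b : Fin 2 → I} : Nonempty (DPath (D.mk .C a) (D.mk .C b)) ↔ a ≤ b := by
  rw [nonempty_dpath_iff]
  exact ⟨fun ⟨i, h⟩ => stripLE_CC.1 h, fun h => ⟨0, stripLE_CC.2 h⟩⟩

/-- In each strip the long coordinate imposes no condition between `A` and `C`; only the short one
does, and either strip may be used. -/
lemma reach_AC {a b : Fin 2 → I} : Nonempty (DPath (D.mk .A a) (D.mk .C b)) ↔ ∃ i, a i ≤ b i := by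
  simp only [nonempty_dpath_iff, stripLE_AC]
  exact ⟨fun ⟨i, h⟩ => ⟨1 - i, h⟩, fun ⟨i, h⟩ => ⟨1 - i, by rwa [one_sub_one_sub]⟩⟩

lemma exists_A_of_reach {z : D} {b : Fin 2 → I} (h : Nonempty (DPath z (D.mk .A b))) :
    ∃ a, z = D.mk .A a := by
  obtain ⟨i, h⟩ := nonempty_dpath_iff.1 h
  exact ⟨_, exists_A_of_long_le h.left (h.leLong.trans (b i).2.2)⟩

lemma exists_C_of_reach {z : D} {b : Fin 2 → I} (h : Nonempty (DPath (D.mk .C b) z)) :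
    ∃ a, z = D.mk .C a := by
  obtain ⟨i, h⟩ := nonempty_dpath_iff.1 h
  refine ⟨_, exists_C_of_le_long h.right (le_trans ?_ h.leLong)⟩
  rw [long_C]; linarith [(b i).2.1]

lemma reach_AB {i : Fin 2} {a b : Fin 2 → I} (h0 : 0 < b i) (h1 : b i < 1) :
    Nonempty (DPath (D.mk .A a) (D.mk (.B i) b)) ↔ a (1 - i) ≤ b (1 - i) := by
  rw [nonempty_dpath_iff]
  constructor
  · rintro ⟨k, h⟩
    obtain rfl := (mem_strip_B h0 h1).1 h.right
    simpa using h.leShort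
  · intro h
    refine ⟨i, by simp, by simp, ?_, by simpa using h⟩
    rw [long_A, long_B_self]; linarith [(a i).2.2, (b i).2.1]

lemma reach_BC {i : Fin 2} {b c : Fin 2 → I} (h0 : 0 < b i) (h1 : b i < 1) :
    Nonempty (DPath (D.mk (.B i) b) (D.mk .C c)) ↔ b (1 - i) ≤ c (1 - i) := by
  rw [nonempty_dpath_iff]
  constructor
  · rintro ⟨k, h⟩
    obtain rfl := (mem_strip_B h0 h1).1 h.left
    simpa using h.leShort
  · intro h
    refine ⟨i, by simp, by simp, ?_, by simpa using h⟩
    rw [long_C, long_B_self]; linarith [(b i).2.2, (c i).2.1]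

lemma reach_BB {i : Fin 2} {b c : Fin 2 → I} (h0 : 0 < b i) (h1 : b i < 1) :
    Nonempty (DPath (D.mk (.B i) b) (D.mk (.B i) c)) ↔ b ≤ c := by
  rw [nonempty_dpath_iff, Pi.le_def, forall_fin_two_iff i]
  constructor
  · rintro ⟨k, h⟩
    obtain rfl := (mem_strip_B h0 h1).1 h.left
    exact ⟨by simpa using h.leLong, by simpa using h.leShort⟩
  · intro h
    exact ⟨i, by simp, by simp, by simpa using h.1, by simpa using h.2⟩

lemma cases_of_reach_B {i : Fin 2} {b : Fin 2 → I} (h0 : 0 < b i) (h1 : b i < 1) {z : D}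
    (h : Nonempty (DPath (D.mk (.B i) b) z)) :
    (∃ c : Fin 2 → I, z = D.mk (.B i) c ∧ 0 < c i ∧ c i < 1) ∨ ∃ c, z = D.mk .C c := by
  have h' := h
  obtain ⟨k, h⟩ := nonempty_dpath_iff.1 h
  obtain rfl := (mem_strip_B h0 h1).1 h.left
  rcases strip_cases h.right with ⟨x, rfl⟩ | ⟨x, h2, h3, rfl⟩ | hC
  · obtain ⟨a, ha⟩ := exists_A_of_reach h'
    have := congrArg height ha
    rw [height_B, height_A] at this
    exact absurd (Subtype.ext this) h0.ne'
  · exact .inl ⟨x, rfl, h2, h3⟩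
  · exact .inr hC

/-! ### The action of an arbitrary inessential map -/

lemma DMap.ext {X Y : Type} [TopologicalSpace X] [TopologicalSpace Y] [DSpace X] [DSpace Y]
    {f g : DMap X Y} (h : ∀ x, f x = g x) : f = g := by
  obtain ⟨f, hf⟩ := f
  obtain ⟨g, hg⟩ := g
  obtain rfl : f = g := ContinuousMap.ext h
  rfl

/-- The properties of an inessential map that determine its action on components. -/
structure IsFutureMap (f : DMap D D) : Prop where
  reach : ∀ x, Nonempty (DPath x (f x))
  pres : PreservesComponents f

lemma FutureInessential.isFutureMap {F : MorphismProperty TopCat.{0}}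
    (h1 : homotopyEquivalences ≤ F) (h2 : F ≤ pi0Bijections) {f : DMap D D}
    (hf : FutureInessential F f) : IsFutureMap f := by
  obtain ⟨h, hh⟩ := hf
  have he : h.level 1 = f := DMap.ext h.one
  exact ⟨fun x => ⟨h.line x⟩, he ▸ (isPsp_iff h1 h2).1 (hh 1)⟩

lemma IsFutureMap.map_reach {f : DMap D D} {x y : D} (h : Nonempty (DPath x y)) :
    Nonempty (DPath (f x) (f y)) := h.map (DPath.map f)

/-- By `exists_ne_iff` both sides say that there are at least two classes of d-paths, and this is
invariant under a bijection. -/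
lemma IsFutureMap.multi_iff {f : DMap D D} (hf : IsFutureMap f) {x y : D}
    (h : Nonempty (DPath x y)) :
    (∃ a b, f x = D.mk .A a ∧ f y = D.mk .C b ∧ a ≤ b) ↔
      ∃ a b, x = D.mk .A a ∧ y = D.mk .C b ∧ a ≤ b := by
  rw [← exists_ne_iff, ← exists_ne_iff]
  have hb := hf.pres x y h
  constructor
  · rintro ⟨a, b, hab⟩
    obtain ⟨a, rfl⟩ := hb.2 a
    obtain ⟨b, rfl⟩ := hb.2 b
    exact ⟨a, b, fun h => hab (h ▸ rfl)⟩
  · rintro ⟨a, b, hab⟩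
    exact ⟨_, _, hb.1.ne hab⟩

/-- `f` acts coordinatewise on the squares `A` and `C`, by strictly monotone functions, and
accordingly on the squares `B i`. -/
structure ActsBy (f : DMap D D) (ψ : Fin 2 → I → I) : Prop where
  strict : ∀ i, StrictMono (ψ i)
  one : ∀ i, ψ i 1 = 1
  A : ∀ a, f (D.mk .A a) = D.mk .A fun i => ψ i (a i)
  C : ∀ a, f (D.mk .C a) = D.mk .C fun i => ψ i (a i)
  B : ∀ (i : Fin 2) (b : Fin 2 → I), 0 < b i → b i < 1 → ∃ c : Fin 2 → I,
    c (1 - i) = ψ (1 - i) (b (1 - i)) ∧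
      ((f (D.mk (.B i) b) = D.mk (.B i) c ∧ 0 < c i ∧ c i < 1) ∨
        (f (D.mk (.B i) b) = D.mk .C c ∧ c i < ψ i 0))

/-- The point of the square with `i`-th coordinate `s` and other coordinate `t`. -/
def pair (i : Fin 2) (s t : I) : Fin 2 → I := fun k => if k = i then s else t

@[simp] lemma pair_self (i : Fin 2) (s t : I) : pair i s t i = s := if_pos rfl
@[simp] lemma pair_other (i : Fin 2) (s t : I) : pair i s t (1 - i) = t := if_neg (one_sub_ne i)

lemma pair_coords (i : Fin 2) (a : Fin 2 → I) : pair i (a i) (a (1 - i)) = a := by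
  funext k
  rcases eq_or_eq_one_sub i k with rfl | rfl <;> simp

lemma pair_le_iff {i : Fin 2} {s t : I} {a : Fin 2 → I} :
    pair i s t ≤ a ↔ s ≤ a i ∧ t ≤ a (1 - i) := by
  rw [Pi.le_def, forall_fin_two_iff i]; simp

lemma le_pair_iff {i : Fin 2} {s t : I} {a : Fin 2 → I} :
    a ≤ pair i s t ↔ a i ≤ s ∧ a (1 - i) ≤ t := by
  rw [Pi.le_def, forall_fin_two_iff i]; simp

lemma exists_between_of_lt {φ : I → I} (hφ : Continuous φ) {s : I} (hs : s < 1) {c : I}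
    (h : φ s < c) : ∃ t, s < t ∧ φ t < c := by
  have h1 : ∀ᶠ t in nhdsWithin s (Set.Ioi s), φ t < c :=
    (hφ.continuousAt.eventually_lt continuousAt_const h).filter_mono nhdsWithin_le_nhds
  have : (nhdsWithin s (Set.Ioi s)).NeBot := nhdsGT_neBot_of_exists_gt ⟨1, hs⟩
  obtain ⟨t, h2, h3⟩ := (h1.and self_mem_nhdsWithin).exists
  exact ⟨t, h3, h2⟩

/-- The order between points of `A` and points of `C` is encoded in the number of classes of
d-paths, which `f` preserves and reflects; comparing with suitable test points isolates the single
coordinates. -/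
lemma IsFutureMap.exists_actsBy {f : DMap D D} (hf : IsFutureMap f) : ∃ ψ, ActsBy f ψ := by
  have hA : ∀ a, ∃ b, f (D.mk .A a) = D.mk .A b ∧ a ≤ b := by
    intro a
    -- The vertex `c⁺` is above every point of `A`, so there are several classes to it; hence the
    -- image of a point of `A` must be the start of several classes and lies in `A`.
    have h1 : a ≤ fun _ => 1 := fun _ => unitInterval.le_one'
    obtain ⟨b, -, hb, -, -⟩ := (hf.multi_iff (reach_AC.2 ⟨0, h1 0⟩)).2 ⟨a, _, rfl, rfl, h1⟩
    have := hf.reach (D.mk .A a)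
    rw [hb, reach_AA] at this
    exact ⟨b, hb, this⟩
  have hC : ∀ a, ∃ b, f (D.mk .C a) = D.mk .C b ∧ a ≤ b := by
    intro a
    have := hf.reach (D.mk .C a)
    obtain ⟨b, hb⟩ := exists_C_of_reach this
    rw [hb, reach_CC] at this
    exact ⟨b, hb, this⟩
  choose g hg hgle using hA
  choose k hk hkle using hC
  have multi : ∀ a b i, a i ≤ b i → (g a ≤ k b ↔ a ≤ b) := by
    intro a b i hi
    have := hf.multi_iff (reach_AC.2 ⟨i, hi⟩)
    rw [hg, hk] at this
    constructor
    · intro h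
      obtain ⟨a', b', ha, hb, hab⟩ := this.1 ⟨_, _, rfl, rfl, h⟩
      rwa [D.mk_A_inj ha, D.mk_C_inj hb]
    · intro h
      obtain ⟨a', b', ha, hb, hab⟩ := this.2 ⟨_, _, rfl, rfl, h⟩
      rwa [D.mk_A_inj ha, D.mk_C_inj hb]
  have kone : ∀ b i, b i = 1 → k b i = 1 := fun b i h =>
    le_antisymm unitInterval.le_one' (h.symm.le.trans (hkle b i))
  have gone : ∀ b i, b i = 1 → g b i = 1 := fun b i h =>
    le_antisymm unitInterval.le_one' (h.symm.le.trans (hgle b i))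
  -- Test points with the other coordinate `1` are used, because `f` can only fix a coordinate `1`;
  -- the order relation then involves the `i`-th coordinate alone.
  let ψ : Fin 2 → I → I := fun i s => k (pair i s 1) i
  have hgψ : ∀ i a s, a i ≤ s ↔ g a i ≤ ψ i s := by
    intro i a s
    have := multi a (pair i s 1) (1 - i) (by simpa using unitInterval.le_one')
    rw [le_pair_iff, Pi.le_def, forall_fin_two_iff i, kone _ (1 - i) (by simp)] at this
    simpa [unitInterval.le_one', ψ] using this.symm
  have hgc : ∀ i, Continuous fun a => g a i := by
    intro i
    have h1 : Continuous fun a => long i (f (D.mk .A a)) :=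
      (continuous_long i).comp (f.toContinuousMap.continuous.comp (continuous_mk _))
    simp only [hg, long_A] at h1
    exact continuous_induced_rng.2 h1
  have hgeq : ∀ i a, g a i = ψ i (a i) := by
    intro i a
    refine le_antisymm ((hgψ i a _).1 le_rfl) (not_lt.1 fun hlt => ?_)
    rcases eq_or_ne (a i) 1 with h1 | h1
    · rw [gone a i h1] at hlt
      exact absurd hlt unitInterval.le_one'.not_gt
    -- If the inequality were strict, by continuity the coordinate could be increased slightly
    -- without violating it, contrary to the equivalence above.
    obtain ⟨t, ht, ht'⟩ := exists_between_of_lt (φ := fun s => g (pair i s (a (1 - i))) i)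
      ((hgc i).comp (continuous_pi fun j => by
        by_cases hj : j = i <;> simp only [pair, hj, if_true, if_false] <;> fun_prop))
      (s := a i) (unitInterval.lt_one_iff_ne_one.2 h1) (c := ψ i (a i))
      (by rwa [pair_coords])
    have := (hgψ i _ _).2 ht'.le
    rw [pair_self] at this
    exact absurd ht this.not_gt
  have hψs : ∀ i, StrictMono (ψ i) := by
    intro i s t hst
    have := (hgψ i (pair i t 0) s).not.1 (by simpa using hst)
    rw [hgeq, pair_self] at this
    exact not_le.1 this
  have hψc : ∀ i, Continuous (ψ i) := by
    intro i
    have : ψ i = fun s => g (pair i s 0) i := by funext s; rw [hgeq, pair_self]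
    rw [this]
    exact (hgc i).comp (continuous_pi fun j => by
        by_cases hj : j = i <;> simp only [pair, hj, if_true, if_false] <;> fun_prop)
  have hψ1 : ∀ i, ψ i 1 = 1 := fun i => kone _ i (by simp)
  have hψlt : ∀ i s, s < 1 → ψ i s < 1 := fun i s hs => (hψs i hs).trans_eq (hψ1 i)
  have hkeq : ∀ i b, k b i = ψ i (b i) := by
    intro i b
    -- On `C` the test points are those of `A` with the other coordinate `0`; the resulting extra
    -- condition does not involve `s`.
    have key : ∀ s, s ≤ b i ↔ ψ i s ≤ k b i ∧ ψ (1 - i) 0 ≤ k b (1 - i) := by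
      intro s
      have := multi (pair i s 0) b (1 - i) (by simp)
      rw [pair_le_iff, Pi.le_def, forall_fin_two_iff i, hgeq, hgeq] at this
      simpa [unitInterval.nonneg'] using this.symm
    have h0 := (key (b i)).1 le_rfl
    refine le_antisymm (not_lt.1 fun hlt => ?_) h0.1
    have hb : b i < 1 := unitInterval.lt_one_iff_ne_one.2 fun h => by
      rw [h, hψ1] at hlt
      exact absurd hlt unitInterval.le_one'.not_gt
    obtain ⟨t, ht, ht'⟩ := exists_between_of_lt (hψc i) hb hlt
    exact absurd ht ((key t).2 ⟨ht'.le, h0.2⟩).not_gt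
  have hgfun : ∀ a, g a = fun i => ψ i (a i) := fun a => funext fun i => hgeq i a
  have hkfun : ∀ a, k a = fun i => ψ i (a i) := fun a => funext fun i => hkeq i a
  refine ⟨ψ, hψs, hψ1, fun a => by rw [hg, hgfun], fun a => by rw [hk, hkfun], ?_⟩
  intro i b h0 h1
  have hr := hf.reach (D.mk (.B i) b)
  -- The point is squeezed between the points with the same short coordinate on its edges in `A` and
  -- in `C`; this determines the short coordinate of its image.
  have hup : Nonempty (DPath (f (D.mk (.B i) b)) (D.mk .C (k (pair i 0 (b (1 - i)))))) := by
    rw [← hk]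
    exact IsFutureMap.map_reach ((reach_BC h0 h1).2 (by simp))
  have hlow : Nonempty (DPath (D.mk .A (g (pair i 1 (b (1 - i))))) (f (D.mk (.B i) b))) := by
    rw [← hg]
    exact IsFutureMap.map_reach ((reach_AB h0 h1).2 (by simp))
  rw [hkfun] at hup
  rw [hgfun] at hlow
  rcases cases_of_reach_B h0 h1 hr with ⟨c, hc, hc0, hc1⟩ | ⟨c, hc⟩
  · rw [hc] at hup hlow
    rw [reach_BC hc0 hc1] at hup
    rw [reach_AB hc0 hc1] at hlow
    simp only [pair_other] at hup hlow
    exact ⟨c, le_antisymm hup hlow, .inl ⟨hc, hc0, hc1⟩⟩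
  · rw [hc] at hup hlow
    rw [reach_CC, Pi.le_def, forall_fin_two_iff i] at hup
    simp only [pair_self, pair_other] at hup
    have hlow' : ψ (1 - i) (b (1 - i)) ≤ c (1 - i) := by
      obtain ⟨j, hj⟩ := reach_AC.1 hlow
      rcases eq_or_eq_one_sub i j with rfl | rfl
      · rw [pair_self, hψ1] at hj
        exact absurd ((hψlt _ 0 zero_lt_one).trans_le (hj.trans hup.1)) (lt_irrefl _)
      · simpa using hj
    have heq := le_antisymm hup.2 hlow'
    refine ⟨c, heq, .inr ⟨hc, not_le.1 fun hle => ?_⟩⟩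
    -- There is a single class from `[A; (0, 0)]` to a point in the interior of `B i`. Were the
    -- entry into `C` not strictly below `ψ i 0`, there would be several classes between the images.
    have hm := hf.multi_iff ((reach_AB (a := fun _ => 0) h0 h1).2 unitInterval.nonneg')
    rw [hg, hgfun, hc] at hm
    obtain ⟨_, _, -, h, -⟩ := hm.1 ⟨_, _, rfl, rfl, by
      rw [Pi.le_def, forall_fin_two_iff i]
      exact ⟨hle, heq ▸ (hψs _).monotone unitInterval.nonneg'⟩⟩
    have := congrArg height h
    rw [height_B, height_C] at this
    exact h1.ne (Subtype.ext this)

/-! ### Regions of `D` -/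

lemma lt_one_iff {s : I} : s < 1 ↔ s ≠ 1 := unitInterval.lt_one_iff_ne_one

lemma height_B_ne_zero {i : Fin 2} {b : Fin 2 → I} (h0 : 0 < b i) (a : Fin 2 → I) :
    D.mk (.B i) b ≠ D.mk .A a := fun h => h0.ne' (Subtype.ext (congrArg height h))

lemma height_B_ne_one {i : Fin 2} {b : Fin 2 → I} (h1 : b i < 1) (a : Fin 2 → I) :
    D.mk (.B i) b ≠ D.mk .C a := fun h => h1.ne (Subtype.ext (congrArg height h))

lemma A_mem_edgeA {i : Fin 2} {a : Fin 2 → I} :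
    D.mk .A a ∈ edgeA i ↔ a i = 1 ∧ a (1 - i) < 1 :=
  ⟨fun ⟨_, h1, h2, h⟩ => D.mk_A_inj h ▸ ⟨h1, h2⟩, fun h => ⟨a, h.1, h.2, rfl⟩⟩

lemma A_eq_aPlus {a : Fin 2 → I} : D.mk .A a = aPlus ↔ ∀ i, a i = 1 :=
  ⟨fun h => fun i => by rw [D.mk_A_inj h], fun h => congrArg _ (funext h)⟩

lemma A_mem_lowA {a : Fin 2 → I} : D.mk .A a ∈ lowA ↔ ∀ i, a i < 1 := by
  simp only [lowA, Set.mem_sdiff, Set.mem_union, Set.mem_singleton_iff, A_mem_edgeA, A_eq_aPlus,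
    lt_one_iff, Fin.forall_fin_two]
  have : D.mk .A a ∈ cell .A := ⟨a, rfl⟩
  norm_num
  tauto

lemma C_mem_edgeC {i : Fin 2} {a : Fin 2 → I} :
    D.mk .C a ∈ edgeC i ↔ a i = 1 ∧ a (1 - i) < 1 :=
  ⟨fun ⟨_, h1, h2, h⟩ => D.mk_C_inj h ▸ ⟨h1, h2⟩, fun h => ⟨a, h.1, h.2, rfl⟩⟩

lemma C_eq_cPlus {a : Fin 2 → I} : D.mk .C a = cPlus ↔ ∀ i, a i = 1 :=
  ⟨fun h => fun i => by rw [D.mk_C_inj h], fun h => congrArg _ (funext h)⟩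

lemma C_mem_lowC {a : Fin 2 → I} : D.mk .C a ∈ lowC ↔ ∀ i, a i < 1 := by
  simp only [lowC, Set.mem_sdiff, Set.mem_union, Set.mem_singleton_iff, C_mem_edgeC, C_eq_cPlus,
    lt_one_iff, Fin.forall_fin_two]
  have : D.mk .C a ∈ cell .C := ⟨a, rfl⟩
  norm_num
  tauto

lemma C_eq_B {i : Fin 2} {a b : Fin 2 → I} (h : D.mk .C a = D.mk (.B i) b) :
    b i = 1 ∧ a i = 0 ∧ a (1 - i) = b (1 - i) := by
  have h1 : b i = 1 := Subtype.ext (congrArg height h).symm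
  rw [mk_B_of_eq_one h1] at h
  have := D.mk_C_inj h
  subst this
  simp [h1, one_sub_ne]

lemma C_mem_edgeB {i : Fin 2} {a : Fin 2 → I} :
    D.mk .C a ∈ edgeB i ↔ a i = 0 ∧ a (1 - i) = 1 := by
  constructor
  · rintro ⟨x, h1, h2, h⟩
    have := C_eq_B h
    exact ⟨this.2.1, this.2.2.trans h1⟩
  · rintro ⟨h1, h2⟩
    refine ⟨pair i 1 1, by simp, by simp, ?_⟩
    rw [mk_B_of_eq_one (by simp)]
    congr 1
    rw [← pair_coords i a, h1, h2]
    funext k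
    rcases eq_or_eq_one_sub i k with rfl | rfl <;> simp [one_sub_ne]

lemma C_mem_topEdge {i : Fin 2} {a : Fin 2 → I} :
    D.mk .C a ∈ topEdge i ↔ a (1 - i) = 1 ∧ a i < 1 := by
  simp only [topEdge, Set.mem_union, C_mem_edgeB, C_mem_edgeC, one_sub_one_sub]
  constructor
  · rintro (⟨h1, h2⟩ | h)
    · exact ⟨h2, by rw [h1]; exact zero_lt_one⟩
    · exact h
  · exact .inr

lemma C_ne_A {a b : Fin 2 → I} : D.mk .C a ≠ D.mk .A b := D.mk_A_ne_C.symm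

/-- The edge shared with `C` is not removed from `B i`, except for its end point on `edgeB i`; so
`lowB i` and `lowC` overlap. -/
lemma C_mem_lowB {i : Fin 2} {a : Fin 2 → I} :
    D.mk .C a ∈ lowB i ↔ a i = 0 ∧ a (1 - i) < 1 := by
  constructor
  · rintro ⟨⟨x, hx⟩, h⟩
    have := C_eq_B hx.symm
    refine ⟨this.2.1, lt_one_iff.2 fun h1 => h (.inl (.inr (C_mem_edgeB.2 ⟨this.2.1, h1⟩)))⟩
  · rintro ⟨h0, h1⟩
    refine ⟨⟨pair i 1 (a (1 - i)), ?_⟩, ?_⟩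
    · rw [mk_B_of_eq_one (by simp)]
      congr 1
      conv_rhs => rw [← pair_coords i a, h0]
      funext k
      rcases eq_or_eq_one_sub i k with rfl | rfl <;> simp [one_sub_ne]
    · rintro ((⟨x, -, -, h⟩ | h) | h)
      · exact C_ne_A h
      · exact h1.ne (C_mem_edgeB.1 h).2
      · exact C_ne_A h

lemma B_mem_edgeB {i k : Fin 2} {b : Fin 2 → I} (h0 : 0 < b i) (h1 : b i < 1) :
    D.mk (.B i) b ∈ edgeB k ↔ k = i ∧ b (1 - i) = 1 := by
  constructor
  · rintro ⟨x, h2, h3, h⟩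
    obtain ⟨rfl, rfl⟩ := D.mk_B_inj h0 h1 h
    exact ⟨rfl, h2⟩
  · rintro ⟨rfl, h2⟩
    exact ⟨b, h2, h0, rfl⟩

lemma B_mem_topEdge {i k : Fin 2} {b : Fin 2 → I} (h0 : 0 < b i) (h1 : b i < 1) :
    D.mk (.B i) b ∈ topEdge k ↔ k = i ∧ b (1 - i) = 1 := by
  simp only [topEdge, Set.mem_union, B_mem_edgeB h0 h1, or_iff_left_iff_imp]
  rintro ⟨x, -, -, h⟩
  exact absurd h (height_B_ne_one h1 x)

lemma B_mem_lowB {i k : Fin 2} {b : Fin 2 → I} (h0 : 0 < b i) (h1 : b i < 1) :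
    D.mk (.B i) b ∈ lowB k ↔ k = i ∧ b (1 - i) < 1 := by
  constructor
  · rintro ⟨⟨x, hx⟩, h⟩
    obtain ⟨rfl, rfl⟩ := D.mk_B_inj h0 h1 hx.symm
    exact ⟨rfl, lt_one_iff.2 fun h2 => h (.inl (.inr ((B_mem_edgeB h0 h1).2 ⟨rfl, h2⟩)))⟩
  · rintro ⟨rfl, h2⟩
    refine ⟨⟨b, rfl⟩, ?_⟩
    rintro ((⟨x, -, -, h⟩ | h) | h)
    · exact height_B_ne_zero h0 _ h
    · exact h2.ne ((B_mem_edgeB h0 h1).1 h).2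
    · exact height_B_ne_zero h0 _ h

lemma B_notMem_lowC {i : Fin 2} {b : Fin 2 → I} (h1 : b i < 1) :
    D.mk (.B i) b ∉ lowC := by
  rintro ⟨⟨x, hx⟩, -⟩
  exact height_B_ne_one h1 x hx.symm

/-- The regions of `D` that occur in the list of components. -/
inductive Region
  | lowA
  | a (i : Fin 2)
  | aPlus
  | e
  | top (i : Fin 2)
  | cPlus

/-- The points of a region. -/
def Region.set : Region → Set D
  | lowA => DirTop.lowA
  | a i => edgeA i
  | aPlus => {DirTop.aPlus}
  | e => lowB 0 ∪ lowB 1 ∪ lowC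
  | top i => topEdge i
  | cPlus => {DirTop.cPlus}

/-- The region that contains `[A; a]`. -/
def Region.HasA (a : Fin 2 → I) : Region → Prop
  | lowA => ∀ i, a i < 1
  | .a i => a i = 1 ∧ a (1 - i) < 1
  | aPlus => ∀ i, a i = 1
  | _ => False

/-- The region that contains `[C; a]`. -/
def Region.HasC (a : Fin 2 → I) : Region → Prop
  | e => ∀ i, a i < 1
  | top i => a (1 - i) = 1 ∧ a i < 1
  | cPlus => ∀ i, a i = 1
  | _ => False

/-- The region that contains `[B i; b]`. -/
def Region.HasB (i : Fin 2) (b : Fin 2 → I) : Region → Prop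
  | e => b (1 - i) < 1
  | top k => k = i ∧ b (1 - i) = 1
  | _ => False

lemma exists_height_pos_of_mem_lowB {i : Fin 2} {z : D} (h : z ∈ lowB i) : height z ≠ 0 := by
  intro h0
  obtain ⟨⟨x, rfl⟩, h⟩ := h
  rw [height_B] at h0
  have h0 : x i = 0 := Subtype.ext h0
  refine h ?_
  rw [mk_B_of_eq_zero h0]
  by_cases h1 : x (1 - i) = 1
  · refine .inr (A_eq_aPlus.2 ((forall_fin_two_iff i).2 ?_))
    simp [one_sub_ne, h1]
  · exact .inl (.inl (A_mem_edgeA.2 (by simp [one_sub_ne, lt_one_iff, h1])))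

lemma A_mem_region {a : Fin 2 → I} {r : Region} : D.mk .A a ∈ r.set ↔ r.HasA a := by
  cases r with
  | lowA => exact A_mem_lowA
  | a i => exact A_mem_edgeA
  | aPlus => exact A_eq_aPlus
  | e =>
    refine iff_of_false ?_ id
    rintro ((h | h) | h)
    · exact exists_height_pos_of_mem_lowB h rfl
    · exact exists_height_pos_of_mem_lowB h rfl
    · obtain ⟨⟨x, hx⟩, -⟩ := h
      exact C_ne_A hx
  | top i =>
    refine iff_of_false ?_ id
    rintro (⟨x, -, h0, h⟩ | ⟨x, -, -, h⟩)
    · exact height_B_ne_zero h0 _ h.symm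
    · exact C_ne_A h.symm
  | cPlus => exact iff_of_false (fun h => C_ne_A (Eq.symm h)) id

lemma C_mem_region {a : Fin 2 → I} {r : Region} : D.mk .C a ∈ r.set ↔ r.HasC a := by
  cases r with
  | lowA => exact iff_of_false (by rintro ⟨⟨x, h⟩, -⟩; exact C_ne_A h.symm) id
  | a i => exact iff_of_false (by rintro ⟨x, -, -, h⟩; exact C_ne_A h) id
  | aPlus => exact iff_of_false (fun h => C_ne_A h) id
  | e =>
    refine ⟨?_, fun h => .inr (C_mem_lowC.2 h)⟩
    have key : ∀ i, D.mk .C a ∈ lowB i → ∀ k, a k < 1 := fun i h => by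
      rw [C_mem_lowB] at h
      exact (forall_fin_two_iff i).2 ⟨by rw [h.1]; exact zero_lt_one, h.2⟩
    rintro ((h | h) | h)
    · exact key 0 h
    · exact key 1 h
    · exact C_mem_lowC.1 h
  | top i => exact C_mem_topEdge
  | cPlus => exact C_eq_cPlus

lemma B_mem_region {i : Fin 2} {b : Fin 2 → I} (h0 : 0 < b i) (h1 : b i < 1) {r : Region} :
    D.mk (.B i) b ∈ r.set ↔ r.HasB i b := by
  cases r with
  | lowA => exact iff_of_false (by rintro ⟨⟨x, h⟩, -⟩; exact height_B_ne_zero h0 _ h.symm) id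
  | a k => exact iff_of_false (by rintro ⟨x, -, -, h⟩; exact height_B_ne_zero h0 _ h) id
  | aPlus => exact iff_of_false (fun h => height_B_ne_zero h0 _ h) id
  | e =>
    simp only [Region.set, Set.mem_union, B_mem_lowB h0 h1, B_notMem_lowC h1, or_false,
      Region.HasB]
    fin_cases i <;> simp
  | top k => exact B_mem_topEdge h0 h1
  | cPlus => exact iff_of_false (fun h => height_B_ne_one h1 _ h) id

lemma exists_region (z : D) : ∃ r : Region, z ∈ r.set := by
  rcases normal z with x | ⟨i, x, h0, h1⟩ | x
  · simp only [A_mem_region]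
    by_cases hx0 : x 0 = 1 <;> by_cases hx1 : x 1 = 1
    · exact ⟨.aPlus, Fin.forall_fin_two.2 ⟨hx0, hx1⟩⟩
    · exact ⟨.a 0, hx0, lt_one_iff.2 hx1⟩
    · exact ⟨.a 1, hx1, lt_one_iff.2 hx0⟩
    · exact ⟨.lowA, Fin.forall_fin_two.2 ⟨lt_one_iff.2 hx0, lt_one_iff.2 hx1⟩⟩
  · simp only [B_mem_region h0 h1]
    by_cases hx : x (1 - i) = 1
    · exact ⟨.top i, rfl, hx⟩
    · exact ⟨.e, lt_one_iff.2 hx⟩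
  · simp only [C_mem_region]
    by_cases hx0 : x 0 = 1 <;> by_cases hx1 : x 1 = 1
    · exact ⟨.cPlus, Fin.forall_fin_two.2 ⟨hx0, hx1⟩⟩
    · exact ⟨.top 1, hx0, lt_one_iff.2 hx1⟩
    · exact ⟨.top 0, hx1, lt_one_iff.2 hx0⟩
    · exact ⟨.e, Fin.forall_fin_two.2 ⟨lt_one_iff.2 hx0, lt_one_iff.2 hx1⟩⟩

lemma Region.eq_of_hasA {a : Fin 2 → I} {r s : Region} (hr : r.HasA a) (hs : s.HasA a) : r = s := by
  cases r <;> cases s <;> simp only [Region.HasA] at hr hs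
  · rfl
  · exact absurd hs.1 (hr _).ne
  · exact absurd (hs 0) (hr 0).ne
  · exact absurd hr.1 (hs _).ne
  · rename_i i k
    rcases eq_or_eq_one_sub i k with rfl | rfl
    · rfl
    · exact absurd hs.1 hr.2.ne
  · exact absurd (hs _) hr.2.ne
  · exact absurd (hr 0) (hs 0).ne
  · exact absurd (hr _) hs.2.ne
  · rfl

lemma Region.eq_of_hasC {a : Fin 2 → I} {r s : Region} (hr : r.HasC a) (hs : s.HasC a) : r = s := by
  cases r <;> cases s <;> simp only [Region.HasC] at hr hs
  · rfl
  · exact absurd hs.1 (hr _).ne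
  · exact absurd (hs 0) (hr 0).ne
  · exact absurd hr.1 (hs _).ne
  · rename_i i k
    rcases eq_or_eq_one_sub i k with rfl | rfl
    · rfl
    · exact absurd hr.1 hs.2.ne
  · exact absurd (hs _) hr.2.ne
  · exact absurd (hr 0) (hs 0).ne
  · exact absurd (hr _) hs.2.ne
  · rfl

lemma Region.eq_of_hasB {i : Fin 2} {a : Fin 2 → I} {r s : Region} (hr : r.HasB i a)
    (hs : s.HasB i a) : r = s := by
  cases r <;> cases s <;> simp only [Region.HasB] at hr hs
  · rfl
  · exact absurd hs.2 hr.ne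
  · exact absurd hr.2 hs.ne
  · rw [hr.1, hs.1]

lemma Region.eq_of_mem {z : D} {r s : Region} (hr : z ∈ r.set) (hs : z ∈ s.set) : r = s := by
  rcases normal z with x | ⟨i, x, h0, h1⟩ | x
  · exact Region.eq_of_hasA (A_mem_region.1 hr) (A_mem_region.1 hs)
  · exact Region.eq_of_hasB ((B_mem_region h0 h1).1 hr) ((B_mem_region h0 h1).1 hs)
  · exact Region.eq_of_hasC (C_mem_region.1 hr) (C_mem_region.1 hs)

/-- The region of a point. -/
def region (z : D) : Region := (exists_region z).choose

lemma mem_region (z : D) : z ∈ (region z).set := (exists_region z).choose_spec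

lemma region_eq {z : D} {r : Region} (h : z ∈ r.set) : region z = r :=
  Region.eq_of_mem (mem_region z) h

/-- Strictly increasing functions fixing `1` preserve which coordinates are `1`. A point of `B i`
that enters `C` does so with `i`-th coordinate below `ψ i 0 < 1`, so it stays in the same region. -/
lemma ActsBy.mem_region {f : DMap D D} {ψ : Fin 2 → I → I} (hf : ActsBy f ψ) {z : D} {r : Region}
    (h : z ∈ r.set) : f z ∈ r.set := by
  have hlt : ∀ i s, s < 1 → ψ i s < 1 := fun i s hs => (hf.strict i hs).trans_eq (hf.one i)
  have h1 : ∀ i s, s = 1 → ψ i s = 1 := fun i s hs => hs ▸ hf.one i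
  rcases normal z with x | ⟨i, x, hx0, hx1⟩ | x
  · rw [hf.A, A_mem_region]
    rw [A_mem_region] at h
    cases r with
    | lowA => exact fun i => hlt i _ (h i)
    | a i => exact ⟨h1 i _ h.1, hlt _ _ h.2⟩
    | aPlus => exact fun i => h1 i _ (h i)
    | _ => exact h
  · rw [B_mem_region hx0 hx1] at h
    obtain ⟨c, hc, ⟨he, hc0, hc1⟩ | ⟨he, hci⟩⟩ := hf.B i x hx0 hx1
    · rw [he, B_mem_region hc0 hc1]
      cases r with
      | e => exact hc.trans_lt (hlt _ _ h)
      | top k => exact ⟨h.1, hc.trans (h1 _ _ h.2)⟩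
      | _ => exact h
    · have hci' := hci.trans (hlt i 0 zero_lt_one)
      rw [he, C_mem_region]
      cases r with
      | e => exact (forall_fin_two_iff i).2 ⟨hci', hc.trans_lt (hlt _ _ h)⟩
      | top k =>
        obtain ⟨rfl, h⟩ := h
        exact ⟨hc.trans (h1 _ _ h), hci'⟩
      | _ => exact h.elim
  · rw [hf.C, C_mem_region]
    rw [C_mem_region] at h
    cases r with
    | e => exact fun i => hlt i _ (h i)
    | top i => exact ⟨h1 _ _ h.1, hlt _ _ h.2⟩
    | cPlus => exact fun i => h1 i _ (h i)
    | _ => exact h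

/-! ### Labels of pairs -/

@[simp] lemma coord_A (a : Fin 2 → I) (i : Fin 2) : coord (D.mk .A a) i = a i := rfl
@[simp] lemma coord_C (a : Fin 2 → I) (i : Fin 2) : coord (D.mk .C a) i = a i := rfl

lemma coord_B_self {i : Fin 2} {b : Fin 2 → I} (h0 : 0 < b i) :
    coord (D.mk (.B i) b) i = b i - 1 := by
  change (if i = i then (if b i = 0 then 1 else (b i : ℝ) - 1) else (b i : ℝ)) = _
  rw [if_pos rfl, if_neg h0.ne']

lemma coord_B_other {i : Fin 2} {b : Fin 2 → I} :
    coord (D.mk (.B i) b) (1 - i) = b (1 - i) := if_neg (one_sub_ne i)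

/-- The comparison of the `i`-th coordinates of two points. -/
def cmpCoord (i : Fin 2) (p : D × D) : Ordering := cmp (coord p.1 i) (coord p.2 i)

lemma mem_compare_iff {i : Fin 2} {o : Ordering} {p : D × D} :
    p ∈ Compare i o ↔ cmpCoord i p = o :=
  ⟨fun h => (cmp_compares _ _).inj h, fun h => h ▸ cmp_compares _ _⟩

/-- The decoration `=` or `<`. -/
def Deco.ofOrd : Ordering → Deco
  | .eq => .eq
  | _ => .lt

@[simp] lemma Deco.ofOrd_ord (d : Deco) : Deco.ofOrd d.ord = d := by cases d <;> rfl

@[simp] lemma Deco.ord_ne_gt (d : Deco) : d.ord ≠ .gt := by cases d <;> decide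

lemma Deco.ord_ofOrd {o : Ordering} (h : o ≠ .gt) : (Deco.ofOrd o).ord = o := by
  cases o
  · rfl
  · rfl
  · exact absurd rfl h

/-- The label of a pair of points with given regions and comparison of coordinates. -/
def Label.ofCode : Region → Region → (Fin 2 → Ordering) → Label
  | .lowA, .lowA, c => .AA fun i => Deco.ofOrd (c i)
  | .lowA, .a i, c => .Aa i (Deco.ofOrd (c (1 - i)))
  | .lowA, .aPlus, _ => .AaPlus
  -- For reachable pairs at most one coordinate decreases, so the order of the two tests is
  -- immaterial.
  | .lowA, .e, c => if c 0 = .gt then .ABC 0 (Deco.ofOrd (c 1)) else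
      if c 1 = .gt then .ABC 1 (Deco.ofOrd (c 0)) else .AC fun i => Deco.ofOrd (c i)
  | .lowA, .top i, c => .Abc i (c i)
  | .lowA, .cPlus, _ => .AcPlus
  | .a i, .a _, c => .aa i (Deco.ofOrd (c (1 - i)))
  | .a i, .e, c => .aBC i (Deco.ofOrd (c (1 - i)))
  | .a i, .top k, c => if k = i then .abcSame i else .abcOther i (c (1 - i))
  | .a i, .cPlus, _ => .acPlus i
  -- The catch-all rows serve one actual target region each; for the other regions they give default
  -- values, which reachable pairs do not meet.
  | .a i, _, _ => .aaPlus i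
  | .aPlus, .top i, _ => .aPlusbc i
  | .aPlus, .cPlus, _ => .aPluscPlus
  | .aPlus, _, _ => .aPlusaPlus
  | .e, .top i, _ => .BCbc i
  | .e, .cPlus, _ => .BCcPlus
  | .e, _, _ => .BCBC
  | .top i, .cPlus, _ => .bccPlus i
  | .top i, _, _ => .bcbc i
  | .cPlus, _, _ => .cPluscPlus

/-- The label of a pair of points. -/
def labelOf (p : D × D) : Label :=
  Label.ofCode (region p.1) (region p.2) fun i => cmpCoord i p

lemma mem_e_of_mem {i : Fin 2} {z : D} (h : z ∈ lowB i ∪ lowC) : z ∈ Region.e.set := by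
  fin_cases i
  · exact h.imp_left .inl
  · exact h.imp_left .inr

lemma labelOf_eq_of_mem {l : Label} {p : D × D} (h : p ∈ l.pairs) : labelOf p = l := by
  obtain ⟨x, y⟩ := p
  cases l <;> simp only [Label.pairs, Set.mem_inter_iff, Set.mem_prod, mem_compare_iff] at h <;>
    unfold labelOf
  case AA d =>
    obtain ⟨⟨⟨hx, hy⟩, h0⟩, h1⟩ := h
    rw [region_eq (r := .lowA) hx, region_eq (r := .lowA) hy]
    refine congrArg Label.AA (funext fun i => ?_)
    fin_cases i
    · simp [h0]
    · simp [h1]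
  case Aa i d => 
    obtain ⟨⟨hx, hy⟩, h0⟩ := h
    rw [region_eq (r := .lowA) hx, region_eq (r := .a i) hy]
    simp [Label.ofCode, h0]
  case AaPlus =>
    rw [region_eq (r := .lowA) h.1, region_eq (r := .aPlus) h.2]; rfl
  case aa i d =>
    obtain ⟨⟨hx, hy⟩, h0⟩ := h
    rw [region_eq (r := .a i) hx, region_eq (r := .a i) hy]
    simp [Label.ofCode, h0]
  case aaPlus i =>
    rw [region_eq (r := .a i) h.1, region_eq (r := .aPlus) h.2]; rfl
  case aPlusaPlus =>
    rw [region_eq (r := .aPlus) h.1, region_eq (r := .aPlus) h.2]; rfl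
  case AC d =>
    obtain ⟨⟨⟨hx, hy⟩, h0⟩, h1⟩ := h
    rw [region_eq (r := .lowA) hx, region_eq (r := .e) (.inr hy)]
    simp only [Label.ofCode, h0, h1, Deco.ord_ne_gt, if_false]
    refine congrArg Label.AC (funext fun i => ?_)
    fin_cases i
    · simp [h0]
    · simp [h1]
  case ABC i d =>
    obtain ⟨⟨⟨hx, hy⟩, h0⟩, h1⟩ := h
    rw [region_eq (r := .lowA) hx, region_eq (r := .e) (mem_e_of_mem hy)]
    fin_cases i
    · have h1 : cmpCoord 1 (x, y) = d.ord := h1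
      have h0 : cmpCoord 0 (x, y) = .gt := h0
      simp [Label.ofCode, h0, h1]
    · have h1 : cmpCoord 0 (x, y) = d.ord := h1
      have h0 : cmpCoord 1 (x, y) = .gt := h0
      simp [Label.ofCode, h0, h1]
  case Abc i o =>
    obtain ⟨⟨hx, hy⟩, h0⟩ := h
    rw [region_eq (r := .lowA) hx, region_eq (r := .top i) hy]
    simp [Label.ofCode, h0]
  case AcPlus => rw [region_eq (r := .lowA) h.1, region_eq (r := .cPlus) h.2]; rfl
  case aBC i d =>
    obtain ⟨⟨hx, hy⟩, h0⟩ := h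
    rw [region_eq (r := .a i) hx, region_eq (r := .e) (mem_e_of_mem hy)]
    simp [Label.ofCode, h0]
  case abcSame i =>
    rw [region_eq (r := .a i) h.1, region_eq (r := .top i) h.2]; simp [Label.ofCode]
  case abcOther i o =>
    obtain ⟨⟨hx, hy⟩, h0⟩ := h
    rw [region_eq (r := .a i) hx, region_eq (r := .top (1 - i)) hy]
    simp [Label.ofCode, h0, one_sub_ne]
  case acPlus i => rw [region_eq (r := .a i) h.1, region_eq (r := .cPlus) h.2]; rfl
  case aPlusbc i => rw [region_eq (r := .aPlus) h.1, region_eq (r := .top i) h.2]; rfl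
  case aPluscPlus => rw [region_eq (r := .aPlus) h.1, region_eq (r := .cPlus) h.2]; rfl
  case BCBC => rw [region_eq (r := .e) h.1, region_eq (r := .e) h.2]; rfl
  case BCbc i => rw [region_eq (r := .e) h.1, region_eq (r := .top i) h.2]; rfl
  case BCcPlus => rw [region_eq (r := .e) h.1, region_eq (r := .cPlus) h.2]; rfl
  case bcbc i => rw [region_eq (r := .top i) h.1, region_eq (r := .top i) h.2]; rfl
  case bccPlus i => rw [region_eq (r := .top i) h.1, region_eq (r := .cPlus) h.2]; rfl
  case cPluscPlus => rw [region_eq (r := .cPlus) h.1, region_eq (r := .cPlus) h.2]; rfl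

/-! ### Reachable pairs belong to the class of their label -/

lemma mem_compare_ofOrd {i : Fin 2} {x y : D} (h : coord x i ≤ coord y i) :
    (x, y) ∈ Compare i (Deco.ofOrd (cmpCoord i (x, y))).ord := by
  rw [mem_compare_iff, Deco.ord_ofOrd]
  intro h'
  exact absurd h (not_le.2 (cmp_eq_gt_iff _ _ |>.1 h'))

lemma cmpCoord_eq_gt_iff {i : Fin 2} {x y : D} :
    cmpCoord i (x, y) = .gt ↔ coord y i < coord x i := cmp_eq_gt_iff _ _

/-- In the interior of `B i` the lowered coordinate is negative, whereas coordinates in `A` are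
nonnegative. -/
lemma cmpCoord_AB_self {i : Fin 2} {a b : Fin 2 → I} (h0 : 0 < b i) (h1 : b i < 1) :
    cmpCoord i (D.mk .A a, D.mk (.B i) b) = .gt := by
  rw [cmpCoord_eq_gt_iff, coord_A, coord_B_self h0]
  have h1 : (b i : ℝ) < 1 := h1
  linarith [(a i).2.1]

lemma mem_pairs_labelOf_AA {a b : Fin 2 → I} (h : a ≤ b) :
    (D.mk .A a, D.mk .A b) ∈ (labelOf (D.mk .A a, D.mk .A b)).pairs := by
  have hc : ∀ i, (D.mk .A a, D.mk .A b) ∈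
      Compare i (Deco.ofOrd (cmpCoord i (D.mk .A a, D.mk .A b))).ord := fun i =>
    mem_compare_ofOrd (h i)
  have hx := mem_region (D.mk .A a)
  have hy := mem_region (D.mk .A b)
  unfold labelOf
  dsimp only
  generalize region (D.mk .A a) = r at *
  generalize region (D.mk .A b) = s at *
  have hx' := A_mem_region.1 hx
  have hy' := A_mem_region.1 hy
  have no : ∀ i, a i = 1 → ¬ b i < 1 := fun i h1 h2 => ((h i).trans_lt h2).ne h1
  cases r <;> cases s <;> simp only [Region.HasA] at hx' hy'
  · exact ⟨⟨⟨hx, hy⟩, hc 0⟩, hc 1⟩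
  · exact ⟨⟨hx, hy⟩, hc _⟩
  · exact ⟨hx, hy⟩
  · exact absurd (hy' _) (no _ hx'.1)
  · rename_i i k
    rcases eq_or_eq_one_sub i k with rfl | rfl
    · exact ⟨⟨hx, hy⟩, hc _⟩
    · rw [one_sub_one_sub] at hy'
      exact absurd hy'.2 (no _ hx'.1)
  · exact ⟨hx, hy⟩
  · exact absurd (hy' 0) (no _ (hx' 0))
  · exact absurd hy'.2 (no _ (hx' _))
  · exact ⟨hx, hy⟩

lemma mem_pairs_labelOf_AC {a b : Fin 2 → I} (h : ∃ i, a i ≤ b i) :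
    (D.mk .A a, D.mk .C b) ∈ (labelOf (D.mk .A a, D.mk .C b)).pairs := by
  have hc : ∀ i, a i ≤ b i → (D.mk .A a, D.mk .C b) ∈
      Compare i (Deco.ofOrd (cmpCoord i (D.mk .A a, D.mk .C b))).ord := fun i h =>
    mem_compare_ofOrd h
  have hgt : ∀ i, cmpCoord i (D.mk .A a, D.mk .C b) = .gt ↔ b i < a i := fun i =>
    cmpCoord_eq_gt_iff
  have hx := mem_region (D.mk .A a)
  have hy := mem_region (D.mk .C b)
  unfold labelOf
  dsimp only
  generalize region (D.mk .A a) = r at *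
  generalize region (D.mk .C b) = s at *
  have hx' := A_mem_region.1 hx
  have hy' := C_mem_region.1 hy
  cases r <;> simp only [Region.HasA] at hx' <;> cases s <;> simp only [Region.HasC] at hy'
  · have hy0 : D.mk .C b ∈ lowC := C_mem_lowC.2 hy'
    simp only [Label.ofCode]
    by_cases h0 : b 0 < a 0
    · rw [if_pos ((hgt 0).2 h0)]
      refine ⟨⟨⟨hx, .inr hy0⟩, mem_compare_iff.2 ((hgt 0).2 h0)⟩, hc 1 ?_⟩
      exact ((Fin.exists_fin_two.1 h).resolve_left h0.not_ge)
    rw [if_neg ((hgt 0).not.2 h0)]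
    by_cases h1 : b 1 < a 1
    · rw [if_pos ((hgt 1).2 h1)]
      exact ⟨⟨⟨hx, .inr hy0⟩, mem_compare_iff.2 ((hgt 1).2 h1)⟩, hc 0 (not_lt.1 h0)⟩
    · rw [if_neg ((hgt 1).not.2 h1)]
      exact ⟨⟨⟨hx, hy0⟩, hc 0 (not_lt.1 h0)⟩, hc 1 (not_lt.1 h1)⟩
  · exact ⟨⟨hx, hy⟩, mem_compare_iff.2 rfl⟩
  · exact ⟨hx, hy⟩
  · rename_i i
    refine ⟨⟨hx, .inr (C_mem_lowC.2 hy')⟩, hc _ ?_⟩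
    obtain ⟨k, hk⟩ := h
    rcases eq_or_eq_one_sub i k with rfl | rfl
    · exact absurd hx'.1 (hk.trans_lt (hy' _)).ne
    · exact hk
  · rename_i i k
    simp only [Label.ofCode]
    rcases eq_or_eq_one_sub i k with rfl | rfl
    · rw [if_pos rfl]; exact ⟨hx, hy⟩
    · rw [if_neg (one_sub_ne i)]; exact ⟨⟨hx, hy⟩, mem_compare_iff.2 rfl⟩
  · exact ⟨hx, hy⟩
  · obtain ⟨k, hk⟩ := h
    exact absurd (hx' k) (hk.trans_lt (hy' _)).ne
  · exact ⟨hx, hy⟩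
  · exact ⟨hx, hy⟩

lemma mem_pairs_labelOf_AB {i : Fin 2} {a b : Fin 2 → I} (h0 : 0 < b i) (h1 : b i < 1)
    (h : a (1 - i) ≤ b (1 - i)) :
    (D.mk .A a, D.mk (.B i) b) ∈ (labelOf (D.mk .A a, D.mk (.B i) b)).pairs := by
  have hc : (D.mk .A a, D.mk (.B i) b) ∈
      Compare (1 - i) (Deco.ofOrd (cmpCoord (1 - i) (D.mk .A a, D.mk (.B i) b))).ord :=
    mem_compare_ofOrd (by rw [coord_B_other]; exact h)
  have hgt := cmpCoord_AB_self (a := a) h0 h1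
  have hngt : cmpCoord (1 - i) (D.mk .A a, D.mk (.B i) b) ≠ .gt := by
    rw [Ne, cmpCoord_eq_gt_iff, coord_B_other, not_lt]; exact h
  have hx := mem_region (D.mk .A a)
  have hy := mem_region (D.mk (.B i) b)
  unfold labelOf
  dsimp only
  generalize region (D.mk .A a) = r at *
  generalize region (D.mk (.B i) b) = s at *
  have hx' := A_mem_region.1 hx
  have hy' := (B_mem_region h0 h1).1 hy
  cases r <;> simp only [Region.HasA] at hx' <;> cases s <;> simp only [Region.HasB] at hy'
  · have hy0 : D.mk (.B i) b ∈ lowB i := (B_mem_lowB h0 h1).2 ⟨rfl, hy'⟩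
    simp only [Label.ofCode]
    obtain rfl | rfl : i = 0 ∨ i = 1 := by fin_cases i <;> simp
    · rw [if_pos hgt]
      exact ⟨⟨⟨hx, .inl hy0⟩, mem_compare_iff.2 hgt⟩, hc⟩
    · rw [if_neg (show cmpCoord 0 _ ≠ .gt from hngt), if_pos hgt]
      exact ⟨⟨⟨hx, .inl hy0⟩, mem_compare_iff.2 hgt⟩, hc⟩
  · exact ⟨⟨hx, hy⟩, mem_compare_iff.2 rfl⟩
  · rename_i k
    rcases eq_or_eq_one_sub i k with rfl | rfl
    · exact ⟨⟨hx, .inl ((B_mem_lowB h0 h1).2 ⟨rfl, hy'⟩)⟩, hc⟩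
    · exact absurd hx'.1 (h.trans_lt hy').ne
  · rename_i k k'
    simp only [Label.ofCode]
    rcases eq_or_eq_one_sub k k' with rfl | rfl
    · rw [if_pos rfl]; exact ⟨hx, hy⟩
    · rw [if_neg (one_sub_ne _)]; exact ⟨⟨hx, hy⟩, mem_compare_iff.2 rfl⟩
  · exact absurd (hx' _) (h.trans_lt hy').ne
  · exact ⟨hx, hy⟩

/-- The coordinate that equals `1` cannot increase, so the path stays on the same outer edge until
it reaches `c⁺`. -/
lemma mem_top_or_cPlus {i : Fin 2} {x y : D} (hx : x ∈ topEdge i) (h : Nonempty (DPath x y)) :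
    y ∈ topEdge i ∨ y = cPlus := by
  rcases normal x with a | ⟨k, a, h0, h1⟩ | a
  · exact absurd hx (A_mem_region (r := .top i)).1
  · obtain ⟨rfl, ha⟩ := (B_mem_topEdge h0 h1).1 hx
    rcases cases_of_reach_B h0 h1 h with ⟨c, rfl, hc0, hc1⟩ | ⟨c, rfl⟩
    · refine .inl ((B_mem_topEdge hc0 hc1).2 ⟨rfl, ?_⟩)
      exact le_antisymm unitInterval.le_one' (ha ▸ (reach_BB h0 h1).1 h _)
    · have hc : c (1 - i) = 1 := le_antisymm unitInterval.le_one' (ha ▸ (reach_BC h0 h1).1 h)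
      by_cases hci : c i = 1
      · exact .inr (C_eq_cPlus.2 ((forall_fin_two_iff i).2 ⟨hci, hc⟩))
      · exact .inl (C_mem_topEdge.2 ⟨hc, lt_one_iff.2 hci⟩)
  · rw [C_mem_topEdge] at hx
    obtain ⟨c, rfl⟩ := exists_C_of_reach h
    have hc : c (1 - i) = 1 := le_antisymm unitInterval.le_one' (hx.1 ▸ reach_CC.1 h _)
    by_cases hci : c i = 1
    · exact .inr (C_eq_cPlus.2 ((forall_fin_two_iff i).2 ⟨hci, hc⟩))
    · exact .inl (C_mem_topEdge.2 ⟨hc, lt_one_iff.2 hci⟩)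

lemma eq_cPlus_of_reach {y : D} (h : Nonempty (DPath cPlus y)) : y = cPlus := by
  obtain ⟨c, rfl⟩ := exists_C_of_reach h
  exact C_eq_cPlus.2 fun i => le_antisymm unitInterval.le_one' (reach_CC.1 h i)

lemma height_eq_zero_of_reach {x y : D} (hy : height y = 0) (h : Nonempty (DPath x y)) :
    height x = 0 := by
  obtain ⟨b, rfl⟩ := height_eq_zero_iff.1 hy
  exact height_eq_zero_iff.2 (exists_A_of_reach h)

lemma mem_pairs_labelOf_of_height {x y : D} (hx0 : height x ≠ 0) (h : Nonempty (DPath x y)) :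
    (x, y) ∈ (labelOf (x, y)).pairs := by
  have hy0 : height y ≠ 0 := fun h0 => hx0 (height_eq_zero_of_reach h0 h)
  have key : ∀ {z : D}, height z ≠ 0 → ∀ {r : Region}, z ∈ r.set → r = .e ∨ (∃ i, r = .top i) ∨
      r = .cPlus := by
    intro z hz r hr
    cases r with
    | lowA => obtain ⟨⟨a, rfl⟩, -⟩ := hr; exact absurd rfl hz
    | a i => obtain ⟨a, -, -, rfl⟩ := hr; exact absurd rfl hz
    | aPlus => rw [show z = aPlus from hr] at hz; exact absurd rfl hz
    | e => exact .inl rfl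
    | top i => exact .inr (.inl ⟨i, rfl⟩)
    | cPlus => exact .inr (.inr rfl)
  have hx := mem_region x
  have hy := mem_region y
  unfold labelOf
  dsimp only
  rcases key hx0 hx with hr | ⟨i, hr⟩ | hr <;> rw [hr] at hx ⊢
  · rcases key hy0 hy with hs | ⟨k, hs⟩ | hs <;> rw [hs] at hy ⊢ <;> exact ⟨hx, hy⟩
  · rcases mem_top_or_cPlus hx h with h' | h'
    · rw [region_eq (r := .top i) h']; exact ⟨hx, h'⟩
    · rw [region_eq (r := .cPlus) h']; exact ⟨hx, h'⟩
  · rw [show x = cPlus from hx] at h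
    exact ⟨hx, eq_cPlus_of_reach h⟩

lemma mem_pairs_labelOf {x y : D} (h : Nonempty (DPath x y)) :
    (x, y) ∈ (labelOf (x, y)).pairs := by
  by_cases hx : height x = 0
  · obtain ⟨a, rfl⟩ := height_eq_zero_iff.1 hx
    rcases normal y with b | ⟨i, b, h0, h1⟩ | b
    · exact mem_pairs_labelOf_AA (reach_AA.1 h)
    · exact mem_pairs_labelOf_AB h0 h1 ((reach_AB h0 h1).1 h)
    · exact mem_pairs_labelOf_AC (reach_AC.1 h)
  · exact mem_pairs_labelOf_of_height hx h

/-- The label of a reachable pair. -/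
def RPair.label (p : RPair D) : Label := labelOf (p.src, p.tgt)

lemma RPair.mem_pairs_iff {p : RPair D} {l : Label} : (p.src, p.tgt) ∈ l.pairs ↔ p.label = l :=
  ⟨labelOf_eq_of_mem, fun h => h ▸ mem_pairs_labelOf p.reach⟩

/-- The only case in which the coordinate is not simply transformed by `ψ` is a point of `B i` that
enters `C`: its `i`-th coordinate becomes less than `ψ i 0`, hence remains below that of every image
of a point of `A`. -/
lemma ActsBy.cmpCoord_eq {f : DMap D D} {ψ : Fin 2 → I → I} (hf : ActsBy f ψ) (a : Fin 2 → I)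
    (y : D) (i : Fin 2) :
    cmpCoord i (f (D.mk .A a), f y) = cmpCoord i (D.mk .A a, y) := by
  have hcmp : ∀ i s t, cmp (ψ i s : ℝ) (ψ i t) = cmp (s : ℝ) t := fun i s t =>
    StrictMono.cmp_map_eq (f := fun s : I => (s : ℝ)) (fun _ _ h => h) (ψ i s) (ψ i t) |>.trans
      (((hf.strict i).cmp_map_eq s t).trans
        (StrictMono.cmp_map_eq (f := fun s : I => (s : ℝ)) (fun _ _ h => h) s t).symm)
  rw [hf.A]
  rcases normal y with b | ⟨k, b, h0, h1⟩ | b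
  · rw [hf.A]; exact hcmp _ _ _
  · obtain ⟨c, hc, ⟨he, hc0, hc1⟩ | ⟨he, hci⟩⟩ := hf.B k b h0 h1
    · rw [he]
      rcases eq_or_eq_one_sub k i with rfl | rfl
      · rw [cmpCoord_AB_self hc0 hc1, cmpCoord_AB_self h0 h1]
      · simp only [cmpCoord, coord_B_other, coord_A, hc]; exact hcmp _ _ _
    · rw [he]
      rcases eq_or_eq_one_sub k i with rfl | rfl
      · rw [cmpCoord_AB_self h0 h1, cmpCoord_eq_gt_iff]
        exact hci.trans_le ((hf.strict i).monotone unitInterval.nonneg')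
      · simp only [cmpCoord, coord_B_other, coord_A, coord_C, hc]; exact hcmp _ _ _
  · rw [hf.C]; exact hcmp _ _ _

lemma ActsBy.region_eq {f : DMap D D} {ψ : Fin 2 → I → I} (hf : ActsBy f ψ) (z : D) :
    region (f z) = region z := DirTop.region_eq (hf.mem_region (DirTop.mem_region z))

/-- Decorations occur only in classes of pairs that start in `A`, so the comparisons are irrelevant
here. -/
lemma Label.ofCode_congr {z : D} (hz : height z ≠ 0) (s : Region) (c c' : Fin 2 → Ordering) :
    Label.ofCode (region z) s c = Label.ofCode (region z) s c' := by
  have h := DirTop.mem_region z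
  generalize region z = r at *
  cases r with
  | lowA => obtain ⟨⟨a, rfl⟩, -⟩ := h; exact absurd rfl hz
  | a i => obtain ⟨a, -, -, rfl⟩ := h; exact absurd rfl hz
  | aPlus => rw [show z = aPlus from h] at hz; exact absurd rfl hz
  | e => cases s <;> rfl
  | top i => cases s <;> rfl
  | cPlus => rfl

lemma IsFutureMap.label_map {f : DMap D D} (hf : IsFutureMap f) (p : RPair D) :
    (p.map f).label = p.label := by
  obtain ⟨ψ, hψ⟩ := hf.exists_actsBy
  unfold RPair.label labelOf
  change Label.ofCode (region (f p.src)) (region (f p.tgt)) (fun i => cmpCoord i (f p.src, f p.tgt))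
    = _
  rw [hψ.region_eq, hψ.region_eq]
  by_cases h : height p.src = 0
  · obtain ⟨a, ha⟩ := height_eq_zero_iff.1 h
    simp only [ha, hψ.cmpCoord_eq]
  · exact Label.ofCode_congr h _ _ _

/-! ### Every label occurs -/

/-- The value of a coordinate of the start point that is in relation `o` to the value `1 / 2`. -/
def startValue : Ordering → I
  | .lt => ⟨1 / 4, by norm_num, by norm_num⟩
  | .eq => ⟨1 / 2, by norm_num, by norm_num⟩
  | .gt => ⟨3 / 4, by norm_num, by norm_num⟩

lemma startValue_lt_one (o : Ordering) : startValue o < 1 := by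
  cases o <;> rw [← Subtype.coe_lt_coe] <;> simp only [startValue, Set.Icc.coe_one] <;> norm_num

lemma startValue_compares (o : Ordering) :
    o.Compares (startValue o : ℝ) (startValue .eq : ℝ) := by
  cases o <;> simp only [startValue, Ordering.Compares] <;> norm_num

lemma startValue_deco_le (d : Deco) : startValue d.ord ≤ startValue .eq := by
  cases d <;> rw [← Subtype.coe_le_coe] <;> simp only [startValue, Deco.ord] <;> norm_num

lemma pair_forall {i : Fin 2} {s t : I} {P : I → Prop} : (∀ k, P (pair i s t k)) ↔ P s ∧ P t := by
  rw [forall_fin_two_iff i]; simp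

/-- All end points are taken in `A` or `C` with coordinates `1 / 2` or `1`; the decoration is
realized by the start point. -/
lemma exists_label_eq (l : Label) : ∃ p : RPair D, p.label = l := by
  have mid1 := startValue_lt_one .eq
  have le1 : ∀ s : I, s ≤ 1 := fun _ => unitInterval.le_one'
  have AA : ∀ a b : Fin 2 → I, a ≤ b → (D.mk .A a, D.mk .A b) ∈ l.pairs → ∃ p : RPair D, p.label = l :=
    fun a b h hl => ⟨⟨_, _, reach_AA.2 h⟩, RPair.mem_pairs_iff.1 hl⟩
  have AC : ∀ (a b : Fin 2 → I) (i), a i ≤ b i → (D.mk .A a, D.mk .C b) ∈ l.pairs →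
      ∃ p : RPair D, p.label = l :=
    fun a b i h hl => ⟨⟨_, _, reach_AC.2 ⟨i, h⟩⟩, RPair.mem_pairs_iff.1 hl⟩
  have CC : ∀ a b : Fin 2 → I, a ≤ b → (D.mk .C a, D.mk .C b) ∈ l.pairs → ∃ p : RPair D, p.label = l :=
    fun a b h hl => ⟨⟨_, _, reach_CC.2 h⟩, RPair.mem_pairs_iff.1 hl⟩
  have hcA : ∀ (i : Fin 2) (o : Ordering) (a b : Fin 2 → I), a i = startValue o →
      b i = startValue .eq → (D.mk .A a, D.mk .A b) ∈ Compare i o := fun i o a b ha hb => by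
    change o.Compares (a i : ℝ) (b i : ℝ)
    rw [ha, hb]; exact startValue_compares o
  have hcC : ∀ (i : Fin 2) (o : Ordering) (a b : Fin 2 → I), a i = startValue o →
      b i = startValue .eq → (D.mk .A a, D.mk .C b) ∈ Compare i o := fun i o a b ha hb => by
    change o.Compares (a i : ℝ) (b i : ℝ)
    rw [ha, hb]; exact startValue_compares o
  have lowA' : ∀ a : Fin 2 → I, (∀ i, a i < 1) → D.mk .A a ∈ lowA := fun a h => A_mem_lowA.2 h
  have lowC' : ∀ a : Fin 2 → I, (∀ i, a i < 1) → D.mk .C a ∈ lowC := fun a h => C_mem_lowC.2 h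
  have edge : ∀ (i : Fin 2) (s : I), s < 1 → D.mk .A (pair i 1 s) ∈ edgeA i := fun i s h =>
    A_mem_edgeA.2 (by simpa using h)
  have tope : ∀ (i : Fin 2) (s : I), s < 1 → D.mk .C (pair i s 1) ∈ topEdge i := fun i s h =>
    C_mem_topEdge.2 (by simpa using h)
  have tope' : ∀ (i : Fin 2) (s : I), s < 1 → D.mk .C (pair i 1 s) ∈ topEdge (1 - i) :=
    fun i s h => C_mem_topEdge.2 (by simpa [one_sub_one_sub] using h)
  let m : Fin 2 → I := fun _ => startValue .eq
  have hm : ∀ i, m i < 1 := fun _ => mid1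
  cases l with
  | AA d =>
    exact AA (fun i => startValue (d i).ord) m (fun i => startValue_deco_le _)
      ⟨⟨⟨lowA' _ fun i => startValue_lt_one _, lowA' _ hm⟩, hcA _ _ _ _ rfl rfl⟩, hcA _ _ _ _ rfl rfl⟩
  | Aa i d =>
    exact AA (fun _ => startValue d.ord) (pair i 1 (startValue .eq))
      (le_pair_iff.2 ⟨le1 _, startValue_deco_le _⟩)
      ⟨⟨lowA' _ fun i => startValue_lt_one _, edge _ _ mid1⟩, hcA _ _ _ _ rfl (by simp)⟩
  | AaPlus => exact AA m (fun _ => 1) (fun _ => le1 _) ⟨lowA' _ hm, rfl⟩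
  | aa i d =>
    exact AA (pair i 1 (startValue d.ord)) (pair i 1 (startValue .eq))
      (le_pair_iff.2 ⟨le1 _, by simpa using startValue_deco_le d⟩)
      ⟨⟨edge _ _ (startValue_lt_one _), edge _ _ mid1⟩, hcA _ _ _ _ (by simp) (by simp)⟩
  | aaPlus i => exact AA (pair i 1 (startValue .eq)) (fun _ => 1) (fun _ => le1 _) ⟨edge _ _ mid1, rfl⟩
  | aPlusaPlus => exact AA (fun _ => 1) (fun _ => 1) le_rfl ⟨rfl, rfl⟩
  | AC d =>
    exact AC (fun i => startValue (d i).ord) m 0 (startValue_deco_le _)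
      ⟨⟨⟨lowA' _ fun i => startValue_lt_one _, lowC' _ hm⟩, hcC _ _ _ _ rfl rfl⟩, hcC _ _ _ _ rfl rfl⟩
  | ABC i d =>
    exact AC (pair i (startValue .gt) (startValue d.ord)) m (1 - i)
      (by simpa using startValue_deco_le d)
      ⟨⟨⟨lowA' _ (pair_forall (P := (· < 1)).2 ⟨startValue_lt_one _, startValue_lt_one _⟩), .inr (lowC' _ hm)⟩,
        hcC _ _ _ _ (by simp) rfl⟩, hcC _ _ _ _ (by simp) rfl⟩
  | Abc i o =>
    exact AC (pair i (startValue o) (startValue .eq)) (pair i (startValue .eq) 1) (1 - i)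
      (by simpa using le1 _)
      ⟨⟨lowA' _ (pair_forall (P := (· < 1)).2 ⟨startValue_lt_one _, mid1⟩), tope _ _ mid1⟩,
        hcC _ _ _ _ (by simp) (by simp)⟩
  | AcPlus => exact AC m (fun _ => 1) 0 (le1 _) ⟨lowA' _ hm, rfl⟩
  | aBC i d =>
    exact AC (pair i 1 (startValue d.ord)) m (1 - i) (by simpa using startValue_deco_le d)
      ⟨⟨edge _ _ (startValue_lt_one _), .inr (lowC' _ hm)⟩, hcC _ _ _ _ (by simp) rfl⟩
  | abcSame i =>
    exact AC (pair i 1 (startValue .eq)) (pair i (startValue .eq) 1) (1 - i) (by simpa using le1 _)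
      ⟨edge _ _ mid1, tope _ _ mid1⟩
  | abcOther i o =>
    exact AC (pair i 1 (startValue o)) (pair i 1 (startValue .eq)) i (by simp)
      ⟨⟨edge _ _ (startValue_lt_one _), tope' _ _ mid1⟩, hcC _ _ _ _ (by simp) (by simp)⟩
  | acPlus i => exact AC (pair i 1 (startValue .eq)) (fun _ => 1) i (le1 _) ⟨edge _ _ mid1, rfl⟩
  | aPlusbc i =>
    exact AC (fun _ => 1) (pair i (startValue .eq) 1) (1 - i) (by simp) ⟨rfl, tope _ _ mid1⟩
  | aPluscPlus => exact AC (fun _ => 1) (fun _ => 1) 0 le_rfl ⟨rfl, rfl⟩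
  | BCBC => exact CC m m le_rfl ⟨.inr (lowC' _ hm), .inr (lowC' _ hm)⟩
  | BCbc i =>
    exact CC m (pair i (startValue .eq) 1) (le_pair_iff.2 ⟨le_rfl, le1 _⟩)
      ⟨.inr (lowC' _ hm), tope _ _ mid1⟩
  | BCcPlus => exact CC m (fun _ => 1) (fun _ => le1 _) ⟨.inr (lowC' _ hm), rfl⟩
  | bcbc i =>
    exact CC (pair i (startValue .eq) 1) _ le_rfl ⟨tope _ _ mid1, tope _ _ mid1⟩
  | bccPlus i =>
    exact CC (pair i (startValue .eq) 1) (fun _ => 1) (fun _ => le1 _) ⟨tope _ _ mid1, rfl⟩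
  | cPluscPlus => exact CC (fun _ => 1) (fun _ => 1) le_rfl ⟨rfl, rfl⟩

/-! ### Confluence of configurations of points -/

/-- A point of the squares `A` and `C`. -/
def IsCorner (z : D) : Prop := (∃ x, z = D.mk .A x) ∨ ∃ x, z = D.mk .C x

lemma IsCorner.exists_mk {z z' : D} (hz : IsCorner z) (hz' : IsCorner z')
    (h : height z = 0 ↔ height z' = 0) :
    ∃ (c : Cell) (x x' : Fin 2 → I), (c = .A ∨ c = .C) ∧ z = D.mk c x ∧ z' = D.mk c x' := by
  rcases hz with ⟨x, rfl⟩ | ⟨x, rfl⟩ <;> rcases hz' with ⟨x', rfl⟩ | ⟨x', rfl⟩ <;> simp at h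
  · exact ⟨_, x, x', .inl rfl, rfl, rfl⟩
  · exact ⟨_, x, x', .inr rfl, rfl, rfl⟩

lemma coord_mk_of_corner {c : Cell} (hc : c = .A ∨ c = .C) (x : Fin 2 → I) (i : Fin 2) :
    coord (D.mk c x) i = x i := by
  rcases hc with rfl | rfl <;> rfl

lemma moveMap_mk_of_corner {Φ : Fin 2 → ℝ → ℝ} (h : ∀ i, Profile (Φ i)) {c : Cell}
    (hc : c = .A ∨ c = .C) (x : Fin 2 → I) :
    moveMap h (D.mk c x) = D.mk c (squareMap Φ x) := by
  rw [moveMap_apply]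
  rcases hc with rfl | rfl
  · exact move_A h x
  · exact move_C h x

/-- Two configurations of finitely many points of the squares `A` and `C` that have the same order
type can be moved to the same configuration. -/
lemma exists_moveMap_eq {ι : Type} [Fintype ι] {z z' : ι → D} (hz : ∀ k, IsCorner (z k))
    (hz' : ∀ k, IsCorner (z' k)) (hh : ∀ k, height (z k) = 0 ↔ height (z' k) = 0)
    (hcmp : ∀ i k l, cmpCoord i (z k, z l) = cmpCoord i (z' k, z' l))
    (h1 : ∀ i k, coord (z k) i = 1 ↔ coord (z' k) i = 1) :
    ∃ (Φ Φ' : Fin 2 → ℝ → ℝ) (h : ∀ i, Profile (Φ i)) (h' : ∀ i, Profile (Φ' i)),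
      ∀ k, moveMap h (z k) = moveMap h' (z' k) := by
  choose c x x' hc hx hx' using fun k => (hz k).exists_mk (hz' k) (hh k)
  have e : ∀ k i, coord (z k) i = x k i := fun k i => by rw [hx, coord_mk_of_corner (hc k)]
  have e' : ∀ k i, coord (z' k) i = x' k i := fun k i => by rw [hx', coord_mk_of_corner (hc k)]
  obtain ⟨Φ, Φ', h, h', he⟩ := exists_profiles x x' (fun i k l => by
    -- The indices are exchanged so that `<` between members `k` and `l` appears as the comparison
    -- result `.gt`.
    have := hcmp i l k
    have h2 : cmpCoord i (z l, z k) = .gt ↔ cmpCoord i (z' l, z' k) = .gt := by rw [this]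
    rwa [cmpCoord_eq_gt_iff, cmpCoord_eq_gt_iff, e, e, e', e'] at h2) (fun i k => by
    have h2 := h1 i k
    rw [e, e'] at h2
    simpa using h2)
  refine ⟨Φ, Φ', h, h', fun k => ?_⟩
  rw [hx, hx', moveMap_mk_of_corner h (hc k), moveMap_mk_of_corner h' (hc k), he]

lemma exists_moveMap_isCorner {ι : Type} [Finite ι] (z : ι → D) :
    ∃ (Φ : Fin 2 → ℝ → ℝ) (h : ∀ i, Profile (Φ i)), ∀ k, IsCorner (moveMap h (z k)) := by
  obtain ⟨Φ, h, hz⟩ := exists_move_mem_corner z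
  exact ⟨Φ, h, fun k => by rw [moveMap_apply]; exact hz k⟩

/-! ### The order type of a pair is determined by its label -/

/-- The region of the start points of the pairs with a given label. -/
def Label.src : Label → Region
  | AA _ | Aa _ _ | AaPlus | AC _ | ABC _ _ | Abc _ _ | AcPlus => .lowA
  | aa i _ | aaPlus i | aBC i _ | abcSame i | abcOther i _ | acPlus i => .a i
  | aPlusaPlus | aPlusbc _ | aPluscPlus => .aPlus
  | BCBC | BCbc _ | BCcPlus => .e
  | bcbc i | bccPlus i => .top i
  | cPluscPlus => .cPlus

/-- The region of the end points of the pairs with a given label. -/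
def Label.tgt : Label → Region
  | AA _ => .lowA
  | Aa i _ | aa i _ => .a i
  | AaPlus | aaPlus _ | aPlusaPlus => .aPlus
  | AC _ | ABC _ _ | aBC _ _ | BCBC => .e
  | Abc i _ | abcSame i | aPlusbc i | BCbc i | bcbc i => .top i
  | abcOther i _ => .top (1 - i)
  | AcPlus | acPlus _ | aPluscPlus | BCcPlus | bccPlus _ | cPluscPlus => .cPlus

lemma Label.mem_src_tgt {l : Label} {p : D × D} (h : p ∈ l.pairs) :
    p.1 ∈ l.src.set ∧ p.2 ∈ l.tgt.set := by
  obtain ⟨x, y⟩ := p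
  cases l with
  | AA d => exact h.1.1
  | Aa i d => exact h.1
  | AaPlus => exact h
  | aa i d => exact h.1
  | aaPlus i => exact h
  | aPlusaPlus => exact h
  | AC d => exact ⟨h.1.1.1, .inr h.1.1.2⟩
  | ABC i d => exact ⟨h.1.1.1, mem_e_of_mem h.1.1.2⟩
  | Abc i o => exact h.1
  | AcPlus => exact h
  | aBC i d => exact ⟨h.1.1, mem_e_of_mem h.1.2⟩
  | abcSame i => exact h
  | abcOther i o => exact h.1
  | acPlus i => exact h
  | aPlusbc i => exact h
  | aPluscPlus => exact h
  | BCBC => exact h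
  | BCbc i => exact h
  | BCcPlus => exact h
  | bcbc i => exact h
  | bccPlus i => exact h
  | cPluscPlus => exact h

lemma RPair.region_src {p : RPair D} : region p.src = p.label.src :=
  region_eq (Label.mem_src_tgt (RPair.mem_pairs_iff.2 rfl)).1

lemma RPair.region_tgt {p : RPair D} : region p.tgt = p.label.tgt :=
  region_eq (Label.mem_src_tgt (RPair.mem_pairs_iff.2 rfl)).2

/-- The points of the region in the squares `A` and `C` have `i`-th coordinate `1`. -/
def Region.Mark (i : Fin 2) : Region → Prop
  | lowA => False
  | .a k => i = k
  | aPlus => True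
  | e => False
  | top k => i = 1 - k
  | cPlus => True

/-- The region is contained in the square `A`. -/
def Region.InA : Region → Prop
  | lowA => True
  | .a _ => True
  | aPlus => True
  | _ => False

lemma mark_region_iff {z : D} (hz : IsCorner z) (i : Fin 2) :
    (region z).Mark i ↔ coord z i = 1 := by
  have h := mem_region z
  generalize region z = r at *
  rcases hz with ⟨x, rfl⟩ | ⟨x, rfl⟩
  · rw [A_mem_region] at h
    rw [coord_mk_of_corner (.inl rfl), Set.Icc.coe_eq_one]
    cases r with
    | lowA => exact iff_of_false id (h i).ne
    | a k =>
      rcases eq_or_eq_one_sub k i with rfl | rfl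
      · exact iff_of_true rfl h.1
      · exact iff_of_false (one_sub_ne k) h.2.ne
    | aPlus => exact iff_of_true trivial (h i)
    | _ => exact h.elim
  · rw [C_mem_region] at h
    rw [coord_mk_of_corner (.inr rfl), Set.Icc.coe_eq_one]
    cases r with
    | e => exact iff_of_false id (h i).ne
    | top k =>
      rcases eq_or_eq_one_sub k i with rfl | rfl
      · exact iff_of_false (ne_one_sub _) h.2.ne
      · exact iff_of_true rfl h.1
    | cPlus => exact iff_of_true trivial (h i)
    | _ => exact h.elim

lemma inA_region_iff (z : D) : (region z).InA ↔ height z = 0 := by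
  have h := mem_region z
  generalize region z = r at *
  rcases normal z with x | ⟨i, x, h0, h1⟩ | x
  · rw [A_mem_region] at h
    cases r <;> first | exact h.elim | exact iff_of_true trivial (height_A x)
  · rw [B_mem_region h0 h1] at h
    have hne : height (D.mk (.B i) x) ≠ 0 := fun h => h0.ne' (Subtype.ext (by rwa [height_B] at h))
    cases r <;> first | exact h.elim | exact iff_of_false id hne
  · rw [C_mem_region] at h
    have hne : height (D.mk .C x) ≠ 0 := by simp
    cases r <;> first | exact h.elim | exact iff_of_false id hne

lemma region_eq_cPlus_iff {z : D} : region z = .cPlus ↔ z = cPlus :=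
  ⟨fun h => by have := mem_region z; rw [h] at this; exact this, fun h => region_eq h⟩

/-- The comparison of the coordinates that are not determined by the regions. -/
def Label.ord : Label → Fin 2 → Ordering
  | AA d, k => (d k).ord
  | Aa _ d, _ => d.ord
  | aa _ d, _ => d.ord
  | AC d, k => (d k).ord
  | ABC i d, k => if k = i then .gt else d.ord
  | Abc _ o, _ => o
  | aBC _ d, _ => d.ord
  | abcOther _ o, _ => o
  | _, _ => .eq

lemma Label.cmpCoord_eq_ord {l : Label} {p : D × D} (h : p ∈ l.pairs) (hA : l.src.InA) {k : Fin 2}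
    (hs : ¬ l.src.Mark k) (ht : ¬ l.tgt.Mark k) : cmpCoord k p = l.ord k := by
  have two : ∀ {i : Fin 2}, ¬ k = i → k = 1 - i := fun {i} h => (eq_or_eq_one_sub i k).resolve_left h
  have two' : ∀ {i : Fin 2}, ¬ k = 1 - i → k = i :=
    fun {i} h => (eq_or_eq_one_sub i k).resolve_right h
  cases l with
  | AA d =>
    obtain rfl | rfl : k = 0 ∨ k = 1 := by fin_cases k <;> simp
    · exact mem_compare_iff.1 h.1.2
    · exact mem_compare_iff.1 h.2
  | Aa i d => obtain rfl := two ht; exact mem_compare_iff.1 h.2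
  | AaPlus => exact absurd trivial ht
  | aa i d => obtain rfl := two ht; exact mem_compare_iff.1 h.2
  | aaPlus i => exact absurd trivial ht
  | aPlusaPlus => exact absurd trivial ht
  | AC d =>
    obtain rfl | rfl : k = 0 ∨ k = 1 := by fin_cases k <;> simp
    · exact mem_compare_iff.1 h.1.2
    · exact mem_compare_iff.1 h.2
  | ABC i d =>
    rcases eq_or_eq_one_sub i k with rfl | rfl
    · exact (mem_compare_iff.1 h.1.2).trans (if_pos rfl).symm
    · exact (mem_compare_iff.1 h.2).trans (if_neg (one_sub_ne i)).symm
  | Abc i o => obtain rfl := two' ht; exact mem_compare_iff.1 h.2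
  | AcPlus => exact absurd trivial ht
  | aBC i d => obtain rfl := two hs; exact mem_compare_iff.1 h.2
  | abcSame i => exact absurd (two hs) ht
  | abcOther i o => obtain rfl := two hs; exact mem_compare_iff.1 h.2
  | acPlus i => exact absurd trivial ht
  | aPlusbc i => exact absurd trivial hs
  | aPluscPlus => exact absurd trivial hs
  | _ => exact hA.elim

lemma coord_le_one_of_isCorner {z : D} (hz : IsCorner z) (i : Fin 2) : coord z i ≤ 1 := by
  rcases hz with ⟨x, rfl⟩ | ⟨x, rfl⟩
  · rw [coord_mk_of_corner (.inl rfl)]; exact (x i).2.2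
  · rw [coord_mk_of_corner (.inr rfl)]; exact (x i).2.2

/-- The regions determine which coordinates are `1`. If one of the two is, this settles the
comparison, as all coordinates are at most `1`; if none is, the pair starts in `A` and the
comparison is recorded by the label. -/
lemma cmpCoord_eq_of_label_eq {p q : RPair D} (h : p.label = q.label)
    (hr : height p.src = 0 ∨ p.tgt = cPlus) (hp1 : IsCorner p.src) (hp2 : IsCorner p.tgt)
    (hq1 : IsCorner q.src) (hq2 : IsCorner q.tgt) (i : Fin 2) :
    cmpCoord i (p.src, p.tgt) = cmpCoord i (q.src, q.tgt) := by
  have hs : region p.src = region q.src := by rw [RPair.region_src, RPair.region_src, h]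
  have ht : region p.tgt = region q.tgt := by rw [RPair.region_tgt, RPair.region_tgt, h]
  have ms := mark_region_iff hp1 i
  have mt := mark_region_iff hp2 i
  have ms' := mark_region_iff hq1 i
  have mt' := mark_region_iff hq2 i
  rw [← hs] at ms'
  rw [← ht] at mt'
  have key : ∀ {a b : ℝ}, a = 1 ∨ b = 1 → a ≤ 1 → b ≤ 1 → ∀ {a' b' : ℝ}, a' ≤ 1 → b' ≤ 1 →
      (a = 1 ↔ a' = 1) → (b = 1 ↔ b' = 1) → cmp a b = cmp a' b' := by
    intro a b hab ha hb a' b' ha' hb' h1 h2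
    rcases eq_or_ne a 1 with rfl | hne
    · rw [h1.1 rfl]
      rcases eq_or_ne b 1 with rfl | hne'
      · rw [h2.1 rfl]
      · rw [(cmp_eq_gt_iff _ _).2 (lt_of_le_of_ne hb hne'),
          (cmp_eq_gt_iff _ _).2 (lt_of_le_of_ne hb' (h2.not.1 hne'))]
    · obtain rfl := hab.resolve_left hne
      rw [h2.1 rfl, (cmp_eq_lt_iff _ _).2 (lt_of_le_of_ne ha hne),
          (cmp_eq_lt_iff _ _).2 (lt_of_le_of_ne ha' (h1.not.1 hne))]
  by_cases hm : (region p.src).Mark i ∨ (region p.tgt).Mark i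
  · rw [ms, mt] at hm
    exact key hm (coord_le_one_of_isCorner hp1 i) (coord_le_one_of_isCorner hp2 i)
      (coord_le_one_of_isCorner hq1 i) (coord_le_one_of_isCorner hq2 i)
      (ms.symm.trans ms') (mt.symm.trans mt')
  · have hA : p.label.src.InA := by
      rw [← RPair.region_src, inA_region_iff]
      refine hr.resolve_right fun h => hm (.inr ?_)
      rw [region_eq_cPlus_iff.2 h]
      trivial
    rw [RPair.region_src, RPair.region_tgt, not_or] at hm
    rw [Label.cmpCoord_eq_ord (RPair.mem_pairs_iff.2 rfl) hA hm.1 hm.2,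
      Label.cmpCoord_eq_ord (RPair.mem_pairs_iff.2 h.symm) hA hm.1 hm.2]

lemma cmpCoord_self (i : Fin 2) (z : D) : cmpCoord i (z, z) = .eq := cmp_self_eq_eq _

lemma cmpCoord_swap (i : Fin 2) (x y : D) : cmpCoord i (x, y) = (cmpCoord i (y, x)).swap :=
  (cmp_swap _ _).symm

/-- Reachable pairs with the same label, that start in `A` or end in `c⁺`, can be moved to the same
pair. -/
lemma exists_map_eq_of_label_eq {p q : RPair D} (h : p.label = q.label)
    (hr : height p.src = 0 ∨ p.tgt = cPlus) (hp1 : IsCorner p.src) (hp2 : IsCorner p.tgt)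
    (hq1 : IsCorner q.src) (hq2 : IsCorner q.tgt) :
    ∃ (Φ Φ' : Fin 2 → ℝ → ℝ) (h : ∀ i, Profile (Φ i)) (h' : ∀ i, Profile (Φ' i)),
      p.map (moveMap h) = q.map (moveMap h') := by
  have hs : region p.src = region q.src := by rw [RPair.region_src, RPair.region_src, h]
  have ht : region p.tgt = region q.tgt := by rw [RPair.region_tgt, RPair.region_tgt, h]
  have hc := cmpCoord_eq_of_label_eq h hr hp1 hp2 hq1 hq2
  -- The configuration consists of the two points of the pair: `true` for the start, `false` for the
  -- end.
  obtain ⟨Φ, Φ', h, h', he⟩ := exists_moveMap_eq (z := fun b : Bool => cond b p.src p.tgt)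
    (z' := fun b : Bool => cond b q.src q.tgt) (by rintro (_ | _) <;> assumption)
    (by rintro (_ | _) <;> assumption)
    (by
      rintro (_ | _)
      · change height p.tgt = 0 ↔ height q.tgt = 0
        rw [← inA_region_iff, ← inA_region_iff, ht]
      · change height p.src = 0 ↔ height q.src = 0
        rw [← inA_region_iff, ← inA_region_iff, hs])
    (by
      rintro i (_ | _) (_ | _)
      · exact (cmpCoord_self _ _).trans (cmpCoord_self _ _).symm
      · change cmpCoord i (p.tgt, p.src) = cmpCoord i (q.tgt, q.src)
        rw [cmpCoord_swap, hc, ← cmpCoord_swap]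
      · exact hc i
      · exact (cmpCoord_self _ _).trans (cmpCoord_self _ _).symm)
    (by
      rintro i (_ | _)
      · exact (mark_region_iff hp2 i).symm.trans (ht ▸ mark_region_iff hq2 i)
      · exact (mark_region_iff hp1 i).symm.trans (hs ▸ mark_region_iff hq1 i))
  exact ⟨Φ, Φ', h, h', RPair.ext (he true) (he false)⟩

/-! ### Arrows of the component category -/

/-- Equations between morphisms of the component category are stated in the arrow category, as
sources and targets are often equal only propositionally; this lemma replaces transport along such
equalities. -/
lemma arrow_mk_comp_congr {T : Type} [Category.{0} T] {a b c a' b' c' : T} {f : a ⟶ b} {g : b ⟶ c}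
    {f' : a' ⟶ b'} {g' : b' ⟶ c'} (hf : Arrow.mk f = Arrow.mk f') (hg : Arrow.mk g = Arrow.mk g') :
    Arrow.mk (f ≫ g) = Arrow.mk (f' ≫ g') := by
  obtain ⟨rfl, rfl, rfl⟩ := (Arrow.mk_eq_mk_iff _ _).1 hf
  obtain ⟨-, rfl, rfl⟩ := (Arrow.mk_eq_mk_iff _ _).1 hg
  simp

section

variable {X : Type} [TopologicalSpace X] [DSpace X] (F : MorphismProperty TopCat.{0})

/-- The arrow of the component category that is represented by an extension morphism. -/
def arr {p q : RPair X} (e : p ⟶ q) : Arrow (FuturePairComponents X F) :=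
  Arrow.mk ((componentFunctor X F).map e)

/-- The component of a reachable pair. -/
abbrev comp (p : RPair X) : FuturePairComponents X F := (componentFunctor X F).obj p

variable {F}

lemma arr_comp {p q r p' q' r' : RPair X} {e : p ⟶ q} {g : q ⟶ r} {e' : p' ⟶ q'} {g' : q' ⟶ r'}
    (he : arr F e = arr F e') (hg : arr F g = arr F g') : arr F (e ≫ g) = arr F (e' ≫ g') := by
  unfold arr
  rw [Functor.map_comp, Functor.map_comp]
  exact arrow_mk_comp_congr he hg

lemma arr_id_congr {p q : RPair X} (h : comp F p = comp F q) : arr F (𝟙 p) = arr F (𝟙 q) := by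
  unfold arr
  rw [CategoryTheory.Functor.map_id, CategoryTheory.Functor.map_id]
  exact congrArg (fun K => Arrow.mk (𝟙 K)) h

lemma comp_eq_of_arr_left {p q p' q' : RPair X} {e : p ⟶ q} {e' : p' ⟶ q'}
    (h : arr F e = arr F e') : comp F p = comp F p' := congrArg Arrow.leftFunc.obj h

lemma comp_eq_of_arr_right {p q p' q' : RPair X} {e : p ⟶ q} {e' : p' ⟶ q'}
    (h : arr F e = arr F e') : comp F q = comp F q' := congrArg Arrow.rightFunc.obj h

lemma arr_comp_of_left {p q r : RPair X} {j : p ⟶ q} {e : q ⟶ r} (hj : arr F j = arr F (𝟙 p)) :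
    arr F (j ≫ e) = arr F e := by
  have := arr_comp (hj.trans (arr_id_congr (comp_eq_of_arr_right hj).symm)) (rfl : arr F e = _)
  rwa [Category.id_comp] at this

lemma arr_comp_of_right {p q r : RPair X} {j : q ⟶ r} {e : p ⟶ q} (hj : arr F j = arr F (𝟙 q)) :
    arr F (e ≫ j) = arr F e := by
  have := arr_comp (rfl : arr F e = _) hj
  rwa [Category.comp_id] at this

lemma arrow_mk_act (f : DMap X X) (hf : FutureInessential F f) (p : RPair X) :
    ∃ h : comp F p = comp F (p.map f),
      (toQuotCat (Inessential X F)).map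
        ((CategoryTheory.Quotient.functor (MixedRel F)).map (actGen F f hf p)) = eqToHom h := by
  refine ⟨congrArg (fun a => (CategoryTheory.Quotient.functor (QuotRel (Inessential X F))).obj
    ((Paths.of _).obj a)) (Quot.sound ⟨_, .act f hf p⟩), ?_⟩
  refine (CategoryTheory.Quotient.sound _ (QuotRel.collapse _ (.act f hf p))).trans ?_
  rw [eqToHom_map]
  rfl

lemma comp_map {f : DMap X X} (hf : FutureInessential F f) (p : RPair X) :
    comp F (p.map f) = comp F p := (arrow_mk_act f hf p).choose.symm

/-- In the commuting square of the functoriality relation the two sides given by `f` become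
identities, so the other two sides become equal. -/
lemma arr_map {f : DMap X X} (hf : FutureInessential F f) {p q : RPair X} (e : p ⟶ q) :
    arr F (Ext.map f e) = arr F e := by
  have h := CategoryTheory.Quotient.sound _ (MixedRel.act_ext f hf e)
  rw [Functor.map_comp, Functor.map_comp] at h
  have h := congrArg (toQuotCat (Inessential X F)).map h
  rw [Functor.map_comp, Functor.map_comp] at h
  obtain ⟨hp, ep⟩ := arrow_mk_act f hf p
  obtain ⟨hq, eq⟩ := arrow_mk_act f hf q
  have h := congrArg Arrow.mk h
  erw [ep, eq] at h
  erw [Arrow.arrow_mk_comp_eqToHom, Arrow.arrow_mk_eqToHom_comp] at h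
  exact h

/-- The flow relation exchanges an extension in the future for one in the past; with `f` made an
identity, both represent the same morphism. -/
lemma arr_flow {f : DMap X X} (hf : FutureInessential F f) (h : FutureFlow f) (p : RPair X) :
    arr F (h.extFut p) = arr F (h.extPast p) := by
  have h := CategoryTheory.Quotient.sound _ (MixedRel.flow f hf h p)
  rw [Functor.map_comp] at h
  have h := congrArg (toQuotCat (Inessential X F)).map h
  rw [Functor.map_comp] at h
  obtain ⟨hp, ep⟩ := arrow_mk_act f hf p
  have h := congrArg Arrow.mk h
  erw [ep] at h
  erw [Arrow.arrow_mk_eqToHom_comp] at h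
  exact h

lemma exists_comp_eq (K : FuturePairComponents X F) : ∃ p : RPair X, comp F p = K := by
  obtain ⟨a⟩ := K
  induction a using Quot.ind with | mk a =>
  exact ⟨a.as.pair, rfl⟩

/-- Induction over the morphisms of the component category. -/
lemma arrow_induction {P : Arrow (FuturePairComponents X F) → Prop}
    (ext : ∀ {p q : RPair X} (e : p ⟶ q), P (arr F e))
    (mul : ∀ {K L M : FuturePairComponents X F} (m : K ⟶ L) (m' : L ⟶ M),
      P (Arrow.mk m) → P (Arrow.mk m') → P (Arrow.mk (m ≫ m')))
    {K L : FuturePairComponents X F} (m : K ⟶ L) : P (Arrow.mk m) := by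
  have one : ∀ K : FuturePairComponents X F, P (Arrow.mk (𝟙 K)) := fun K => by
    obtain ⟨p, rfl⟩ := exists_comp_eq K
    have := ext (𝟙 p)
    unfold arr at this
    rwa [CategoryTheory.Functor.map_id] at this
  have mixed : ∀ {a b : MixedCat X F} (f : a ⟶ b),
      P (Arrow.mk ((toQuotCat (Inessential X F)).map f)) := by
    intro a b f
    induction f using CategoryTheory.Quotient.induction with | h f =>
    induction f using Paths.induction with
    | id =>
      rw [CategoryTheory.Functor.map_id, CategoryTheory.Functor.map_id]
      exact one _
    | @comp u v w f₀ g hf₀ =>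
      rw [Functor.map_comp, Functor.map_comp]
      refine mul _ _ hf₀ ?_
      change MixedEdge X F v w at g
      cases g with
      | ext e => exact ext e
      | act f hf p =>
        obtain ⟨h, he⟩ := arrow_mk_act f hf p
        have h1 : Arrow.mk (eqToHom h) = Arrow.mk (𝟙 (comp F p)) := by
          have := Arrow.arrow_mk_comp_eqToHom (𝟙 (comp F p)) h
          rwa [Category.id_comp] at this
        have := congrArg Arrow.mk he
        exact (this.trans h1) ▸ one _
  induction m using CategoryTheory.Quotient.induction with | h f =>
  induction f using Paths.induction with
  | id =>
    rw [CategoryTheory.Functor.map_id]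
    exact one _
  | @comp u v w f₀ g hf₀ =>
    rw [Functor.map_comp]
    refine mul _ _ hf₀ ?_
    change QuotEdge _ v w at g
    cases g with
    | mk f => exact mixed f

end

/-! ### Functors on the component category -/

section

variable {C E : Type} [Category.{0} C] [Category.{0} E] (W : MorphismProperty C)

lemma exists_quotCat_lift (G : C ⥤ E)
    (hG : ∀ {a b : C} (f : a ⟶ b), W f → ∃ h : G.obj a = G.obj b, G.map f = eqToHom h) :
    ∃ Φ : QuotCat W ⥤ E, toQuotCat W ⋙ Φ = G := by
  let o : QuotObj W → E := Quot.lift G.obj fun a b ⟨f, hf⟩ => (hG f hf).choose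
  let m : ∀ {a b : QuotObj W}, QuotEdge W a b → (o a ⟶ o b) := fun e =>
    match e with
    | .mk f => G.map f
  let φ : QuotObj W ⥤q E := ⟨o, m⟩
  have hφ : ∀ {a b : C} (f : a ⟶ b), (Paths.lift φ).map (quotGen W f) = G.map f := fun f =>
    Paths.lift_toPath φ (QuotEdge.mk f)
  refine ⟨CategoryTheory.Quotient.lift _ (Paths.lift φ) ?_, ?_⟩
  · intro x y f g h
    cases h with
    | id a => exact (hφ _).trans (G.map_id a)
    | comp f g =>
      exact ((hφ _).trans (G.map_comp f g)).trans
        (((Paths.lift φ).map_comp _ _).trans (congrArg₂ (· ≫ ·) (hφ f) (hφ g))).symm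
    | collapse f hf =>
      exact ((hφ f).trans (hG f hf).choose_spec).trans (eqToHom_map (Paths.lift φ)
        (congrArg (Paths.of (QuotObj W)).obj (Quot.sound ⟨f, hf⟩))).symm
  · exact CategoryTheory.Functor.ext (fun a => rfl) fun a b f =>
      (hφ f).trans ((Category.id_comp _).trans (Category.comp_id _)).symm

variable {X : Type} [TopologicalSpace X] [DSpace X] {F : MorphismProperty TopCat.{0}}

/-- The universal property of the component category. -/
lemma exists_lift (G : RPair X ⥤ E)
    (hobj : ∀ (f : DMap X X), FutureInessential F f → ∀ p, G.obj (p.map f) = G.obj p)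
    (hmap : ∀ (f : DMap X X), FutureInessential F f → ∀ {p q : RPair X} (e : p ⟶ q),
      Arrow.mk (G.map (Ext.map f e)) = Arrow.mk (G.map e))
    (hflow : ∀ (f : DMap X X), FutureInessential F f → ∀ (h : FutureFlow f) (p : RPair X),
      Arrow.mk (G.map (h.extFut p)) = Arrow.mk (G.map (h.extPast p))) :
    ∃ Φ : FuturePairComponents X F ⥤ E, componentFunctor X F ⋙ Φ = G := by
  let φ : MixedPair X F ⥤q E := ⟨fun a => G.obj a.pair, fun e =>
    match e with
    | .ext e => G.map e
    | .act f hf p => eqToHom (hobj f hf p).symm⟩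
  have hext : ∀ {p q : RPair X} (e : p ⟶ q), (Paths.lift φ).map (extGen F e) = G.map e := fun e =>
    Paths.lift_toPath φ (MixedEdge.ext e)
  have hact : ∀ (f : DMap X X) (hf : FutureInessential F f) (p : RPair X),
      (Paths.lift φ).map (actGen F f hf p) = eqToHom (hobj f hf p).symm := fun f hf p =>
    Paths.lift_toPath φ (MixedEdge.act f hf p)
  have hmul : ∀ {a b c : Paths (MixedPair X F)} {f : a ⟶ b} {g : b ⟶ c}
      {f' : (Paths.lift φ).obj a ⟶ (Paths.lift φ).obj b}
      {g' : (Paths.lift φ).obj b ⟶ (Paths.lift φ).obj c}, (Paths.lift φ).map f = f' →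
      (Paths.lift φ).map g = g' → (Paths.lift φ).map (f ≫ g) = f' ≫ g' := fun h h' =>
    ((Paths.lift φ).map_comp _ _).trans (congrArg₂ (· ≫ ·) h h')
  have hmap' : ∀ (f : DMap X X) (hf : FutureInessential F f) {p q : RPair X} (e : p ⟶ q),
      eqToHom (hobj f hf p).symm ≫ G.map (Ext.map f e) = G.map e ≫ eqToHom (hobj f hf q).symm := by
    intro f hf p q e
    obtain ⟨h1, h2, h3⟩ := (Arrow.mk_eq_mk_iff _ _).1 (hmap f hf e)
    rw [h3, eqToHom_trans_assoc]
    simp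
  have hflow' : ∀ (f : DMap X X) (hf : FutureInessential F f) (h : FutureFlow f) (p : RPair X),
      G.map (h.extFut p) = eqToHom (hobj f hf p).symm ≫ G.map (h.extPast p) := by
    intro f hf h p
    obtain ⟨h1, h2, h3⟩ := (Arrow.mk_eq_mk_iff _ _).1 (hflow f hf h p)
    simpa using h3
  obtain ⟨Φ, hΦ⟩ := exists_quotCat_lift (Inessential X F)
    (CategoryTheory.Quotient.lift (MixedRel F) (Paths.lift φ) (by
      intro x y f g h
      cases h with
      | ext_id p => exact (hext _).trans (G.map_id p)
      | ext_comp e e' =>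
        exact ((hext _).trans (G.map_comp e e')).trans (hmul (hext e) (hext e')).symm
      | act_id h p => exact hact _ h p
      | act_comp f g hf hg hgf p =>
        exact (hact _ hgf p).trans ((eqToHom_trans (hobj f hf p).symm
          (hobj g hg (p.map f)).symm).symm.trans (hmul (hact f hf p) (hact g hg _)).symm)
      | act_ext f hf e =>
        exact (hmul (hact f hf _) (hext _)).trans ((hmap' f hf e).trans
          (hmul (hext e) (hact f hf _)).symm)
      | flow f hf h p =>
        exact (hext _).trans ((hflow' f hf h p).trans (hmul (hact f hf p) (hext _)).symm)))
    (by
      rintro _ _ _ ⟨f, hf, p⟩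
      exact ⟨(hobj f hf p).symm, hact f hf p⟩)
  refine ⟨Φ, ?_⟩
  change extFunctor X F ⋙ (toQuotCat (Inessential X F) ⋙ Φ) = G
  rw [hΦ]
  exact CategoryTheory.Functor.ext (fun a => rfl) fun a b f =>
    (hext f).trans ((Category.id_comp _).trans (Category.comp_id _)).symm

end

/-! ### Extensions that represent identities -/

/-- The conditions on the class `F` of maps. -/
structure Admissible (F : MorphismProperty TopCat.{0}) : Prop where
  ge : homotopyEquivalences ≤ F
  le : F ≤ pi0Bijections

variable {F : MorphismProperty TopCat.{0}}

lemma Admissible.inessential (hF : Admissible F) {Φ : Fin 2 → ℝ → ℝ} (h : ∀ i, Profile (Φ i)) :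
    FutureInessential F (moveMap h) := futureInessential_moveMap hF.ge hF.le h

lemma Pi1.nonempty {x y : D} (a : Pi1 x y) : Nonempty (DPath x y) := ⟨a.exists_rep.choose⟩

lemma height_ne_zero_of_reach {x y : D} (hx : height x ≠ 0) (h : Nonempty (DPath x y)) :
    height y ≠ 0 := fun hy => hx (height_eq_zero_of_reach hy h)

/-- Neither part of such an extension begins in `A`, and d-paths that begin outside `A` form a
single class for given end points. -/
lemma hom_eq_of_height {p q : RPair D} (h : height q.src ≠ 0) (e e' : p ⟶ q) : e = e' :=
  Ext.ext (Pi1.eq_of_not (fun hh => h hh.1) _ _) (Pi1.eq_of_not (fun hh =>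
    height_ne_zero_of_reach (height_ne_zero_of_reach h (Ext.past e).nonempty) p.reach hh.1) _ _)

lemma arr_eq_of_height {p q p' q' : RPair D} (hp : p = p') (hq : q = q') (h : height q.src ≠ 0)
    (e : p ⟶ q) (e' : p' ⟶ q') : arr F e = arr F e' := by
  subst hp hq
  rw [hom_eq_of_height h e e']

/-- An extension morphism, for reachable points. -/
def homOf {p q : RPair D} (h : Nonempty (DPath q.src p.src)) (h' : Nonempty (DPath p.tgt q.tgt)) :
    p ⟶ q := (⟨h.some.cls, h'.some.cls⟩ : Ext p q)

/-- A pair of points of the square `C`. -/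
def pairC (x y : Fin 2 → I) (h : x ≤ y) : RPair D := ⟨D.mk .C x, D.mk .C y, reach_CC.2 h⟩

lemma height_pairC {x y : Fin 2 → I} {h : x ≤ y} : height (pairC x y h).src ≠ 0 := by
  change height (D.mk .C x) ≠ 0
  simp

/-- The functions that act by `φ` on the `i`-th coordinate and trivially on the other one. -/
def single (i : Fin 2) (φ : ℝ → ℝ) (k : Fin 2) : ℝ → ℝ := if k = i then φ else id

lemma single_self (i : Fin 2) (φ : ℝ → ℝ) : single i φ i = φ := if_pos rfl

lemma single_other (i : Fin 2) (φ : ℝ → ℝ) : single i φ (1 - i) = id := if_neg (one_sub_ne i)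

lemma profile_single {i : Fin 2} {φ : ℝ → ℝ} (h : Profile φ) (k : Fin 2) :
    Profile (single i φ k) := by
  unfold single; split_ifs; exacts [h, profile_id]

lemma move_single_B {i : Fin 2} {φ : ℝ → ℝ} (h : Profile φ) (s t : I) :
    moveMap (profile_single (i := i) h) (D.mk (.B i) (pair i s t)) = emb i (φ (s + 1)) t := by
  rw [moveMap_apply, move_B, single_self, single_other, pair_self, pair_other]
  · rfl
  · exact profile_single h

lemma vec_eq_pair (i : Fin 2) (s t : I) : vec i s t = pair i s t := by
  funext k
  rcases eq_or_eq_one_sub i k with rfl | rfl <;> simp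

lemma arr_id_map (hF : Admissible F) {Φ : Fin 2 → ℝ → ℝ} (h : ∀ i, Profile (Φ i)) (p : RPair D) :
    arr F (𝟙 (p.map (moveMap h))) = arr F (𝟙 p) :=
  arr_id_congr (comp_map (hF.inessential h) p)

/-- Extensions in the `i`-th direction in the interior of `C`. -/
lemma arr_eq_id_of_coord_lt (hF : Admissible F) {i : Fin 2} {x y x' y' : Fin 2 → I} {hxy : x ≤ y}
    {hxy' : x' ≤ y'} (hx : x' ≤ x) (hy : y ≤ y') (hx' : x' (1 - i) = x (1 - i))
    (hy' : y (1 - i) = y' (1 - i)) (hlt : y' i < 1) (e : pairC x y hxy ⟶ pairC x' y' hxy') :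
    arr F e = arr F (𝟙 (pairC x y hxy)) := by
  -- The number `a` lies above all `i`-th coordinates involved, which leaves room to place the
  -- points in the interior of `B i`.
  obtain ⟨a, ha, ha1⟩ := exists_between (show (y' i : ℝ) < 1 from hlt)
  have ha0 : 0 ≤ a := (y' i).2.1.trans ha.le
  -- The value is chosen such that the first map below, which stretches `B i` by `1 + a`, sends `w
  -- s` to long coordinate `1 + (1 + a) * w s = 2 + s`, the point of `C` with coordinate `s`.
  let w : I → I := fun s => Set.projIcc 0 1 zero_le_one ((1 + s) / (1 + a))
  have hw : ∀ s : I, s ≤ y' i → (w s : ℝ) = (1 + s) / (1 + a) := fun s hs => by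
    have hs' : (s : ℝ) ≤ y' i := hs
    exact coe_projIcc (div_nonneg (by linarith [s.2.1]) (by linarith))
      ((div_le_one (by linarith)).2 (by linarith))
  have hmono : Monotone w := fun s t hst => Set.monotone_projIcc _ (by
    have : (s : ℝ) ≤ t := hst
    gcongr)
  have hw0 : ∀ s : I, s ≤ y' i → 1 / 2 ≤ (w s : ℝ) := fun s hs => by
    rw [hw s hs, div_le_div_iff₀ two_pos (by linarith)]
    linarith [s.2.1]
  have hw1 : ∀ s : I, s ≤ y' i → (w s : ℝ) < 1 := fun s hs => by
    have hs' : (s : ℝ) ≤ y' i := hs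
    rw [hw s hs, div_lt_one (by linarith)]
    linarith
  let u : (Fin 2 → I) → Fin 2 → I := fun z => pair i (w (z i)) (z (1 - i))
  have us : ∀ z, u z i = w (z i) := fun z => pair_self _ _ _
  have uo : ∀ z, u z (1 - i) = z (1 - i) := fun z => pair_other _ _ _
  have hu0 : ∀ z : Fin 2 → I, z i ≤ y' i → 0 < u z i := fun z hz => by
    rw [us, ← Subtype.coe_lt_coe]
    exact lt_of_lt_of_le (by norm_num) (hw0 _ hz)
  have hu1 : ∀ z : Fin 2 → I, z i ≤ y' i → u z i < 1 := fun z hz => by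
    rw [us, ← Subtype.coe_lt_coe]
    exact hw1 _ hz
  have hu : ∀ z z' : Fin 2 → I, z ≤ z' → u z ≤ u z' := fun z z' h =>
    pair_le_iff.2 ⟨by rw [us]; exact hmono (h i), by rw [uo]; exact h _⟩
  have h1 : x i ≤ y' i := (hxy i).trans (hy i)
  have h2 : x' i ≤ y' i := hxy' i
  have reach : ∀ z z' : Fin 2 → I, z i ≤ y' i → z' i ≤ y' i → z ≤ z' →
      Nonempty (DPath (D.mk (.B i) (u z)) (D.mk (.B i) (u z'))) := fun z z' h h' hzz =>
    (reach_BB (hu0 z h) (hu1 z h)).2 (hu z z' hzz)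
  let P : RPair D := ⟨_, _, reach x y h1 (hy i) hxy⟩
  let Q : RPair D := ⟨_, _, reach x' y' h2 le_rfl hxy'⟩
  let e₀ : P ⟶ Q := homOf (reach x' x h2 h1 hx) (reach y y' (hy i) le_rfl hy)
  have hf := profile_profile (squareProfile_affine ha0 ha1) plateauBounds_zero
  -- All values `w s` in use lie in `[1 / 2, w (y' i)]`, and slope `2` makes the plateau at `w (y'
  -- i)` begin at or before `1 / 2`. So the second map gives all points the same `i`-th coordinate.
  have hc : PlateauBounds (w (y' i) : ℝ) 2 := ⟨(w _).2.1, hw1 _ le_rfl, two_pos.le⟩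
  have hg := profile_profile squareProfile_id hc
  have mf : ∀ z : Fin 2 → I, z i ≤ y' i →
      moveMap (profile_single (i := i) hf) (D.mk (.B i) (u z)) = D.mk .C z := fun z hz => by
    have h3 := (w (z i)).2.1
    have h4 := (w (z i)).2.2
    rw [move_single_B hf, profile_B (squareProfile_affine ha0 ha1) (by linarith) (by linarith),
      add_sub_cancel_right, plateau_zero_zero h3, hw _ hz, emb_C]
    · rw [← vec_coords i z]
      congr 2
      · rw [vec_coords]
        field_simp
        ring
      · rw [vec_coords]
    · rw [mul_zero, add_zero, mul_div_cancel₀ _ (by linarith)]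
      linarith [(z i).2.1]
  have mg : ∀ z : Fin 2 → I, z i ≤ y' i → moveMap (profile_single (i := i) hg)
      (D.mk (.B i) (u z)) = D.mk (.B i) (pair i (w (y' i)) (z (1 - i))) := fun z hz => by
    have h3 := (w (z i)).2.1
    have h4 := (w (z i)).2.2
    have h5 : (w (z i) : ℝ) ≤ w (y' i) := hmono hz
    have h6 := hw0 _ hz
    have h7 := (w (y' i)).2.1
    have h8 := (w (y' i)).2.2
    have h9 : plateau (w (y' i)) 2 (w (z i)) = w (y' i) := by
      rw [plateau, min_eq_left (by linarith), max_eq_right h5]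
    rw [move_single_B hg, profile_B squareProfile_id (by linarith) (by linarith),
      add_sub_cancel_right, h9, emb_B (by simp; linarith) (by simp; linarith), ← vec_eq_pair]
    congr 2
    simp
  have eP : P.map (moveMap (profile_single (i := i) hf)) = pairC x y hxy :=
    RPair.ext (mf x h1) (mf y (hy i))
  have eQ : Q.map (moveMap (profile_single (i := i) hf)) = pairC x' y' hxy' :=
    RPair.ext (mf x' h2) (mf y' le_rfl)
  have ePQ : Q.map (moveMap (profile_single (i := i) hg)) =
      P.map (moveMap (profile_single (i := i) hg)) :=
    RPair.ext ((mg x' h2).trans (by rw [hx']; exact (mg x h1).symm))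
      ((mg y' le_rfl).trans (by rw [← hy']; exact (mg y (hy i)).symm))
  have hne : height (Q.map (moveMap (profile_single (i := i) hg))).src ≠ 0 := by
    change height (moveMap (profile_single (i := i) hg) (D.mk (.B i) (u x'))) ≠ 0
    rw [mg x' h2, height_B, pair_self]
    have := hw0 _ (le_refl (y' i))
    linarith
  -- The extension `e₀` inside `B i` is sent to `e` by the first map, and to an endomorphism, hence
  -- an identity, by the second.
  calc arr F e = arr F (Ext.map (moveMap (profile_single (i := i) hf)) e₀) :=
        arr_eq_of_height eP.symm eQ.symm height_pairC _ _
    _ = arr F (Ext.map (moveMap (profile_single (i := i) hg)) e₀) :=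
        (arr_map (hF.inessential _) e₀).trans (arr_map (hF.inessential _) e₀).symm
    _ = arr F (𝟙 (P.map (moveMap (profile_single (i := i) hg)))) :=
        arr_eq_of_height rfl ePQ hne _ _
    _ = arr F (𝟙 (P.map (moveMap (profile_single (i := i) hf)))) :=
        (arr_id_map hF _ P).trans (arr_id_map hF _ P).symm
    _ = arr F (𝟙 _) := by rw [eP]

lemma move_single_C {i : Fin 2} {φ : ℝ → ℝ} (h : SquareProfile φ) (x : Fin 2 → I) (s : I)
    (hs : φ (x i) = s) :
    moveMap (profile_single (i := i) (profile_profile h plateauBounds_zero)) (D.mk .C x) =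
      D.mk .C (pair i s (x (1 - i))) := by
  rw [moveMap_apply, move_C (profile_single (profile_profile h plateauBounds_zero))]
  congr 1
  funext k
  rcases eq_or_eq_one_sub i k with rfl | rfl
  · rw [squareMap, single_self, profile_A plateauBounds_zero (x k).2.1 (x k).2.2, hs, pair_self]
    exact Set.projIcc_val _ _
  · rw [squareMap, single_other, pair_other]
    exact Set.projIcc_val _ _

/-- Extensions in the past in the `i`-th direction, of pairs whose end point is on the boundary. -/
lemma arr_eq_id_of_past (hF : Admissible F) {i : Fin 2} {x y x' : Fin 2 → I} {hxy : x ≤ y}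
    {hxy' : x' ≤ y} (hx : x' ≤ x) (hx' : x' (1 - i) = x (1 - i)) (hlt : x i < 1) (hy : y i = 1)
    (e : pairC x y hxy ⟶ pairC x' y hxy') :
    arr F e = arr F (𝟙 (pairC x y hxy)) := by
  have h0 := (x' i).2.1
  have h1 : (x' i : ℝ) ≤ x i := hx i
  have h2 : (x i : ℝ) < 1 := hlt
  have h3 : (0 : ℝ) < 1 - x' i := by linarith
  -- The constant is the solution of `φ (x' i) = x i`.
  have hφ := squareProfile_affine (a := ((x i : ℝ) - x' i) / (1 - x' i))
    (div_nonneg (by linarith) h3.le) ((div_lt_one h3).2 (by linarith))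
  have h := profile_single (i := i) (profile_profile hφ plateauBounds_zero)
  have mx : moveMap h (D.mk .C x') = D.mk .C x := by
    rw [move_single_C hφ x' (x i), hx', pair_coords]
    field_simp
    ring
  have my : moveMap h (D.mk .C y) = D.mk .C y := by
    rw [move_single_C hφ y (y i), pair_coords]
    rw [hy]
    simp
  let p := pairC x' y hxy'
  have ef : p.map (moveMap h) = pairC x y hxy := RPair.ext mx my
  have eE : p.extendFlow (moveFlow h) = p := RPair.ext rfl my
  -- The flow moves the start point from `x'` to `x` and ends at the same `y`; hence its extension
  -- in the past is `e`, and its extension in the future is an identity.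
  calc arr F e = arr F ((moveFlow h).extPast p) :=
        arr_eq_of_height ef.symm eE.symm (height_pairC (h := hxy')) _ _
    _ = arr F ((moveFlow h).extFut p) := (arr_flow (hF.inessential h) _ p).symm
    _ = arr F (𝟙 p) := arr_eq_of_height rfl eE (height_pairC (h := hxy')) _ _
    _ = arr F (𝟙 (p.map (moveMap h))) := (arr_id_map hF h p).symm
    _ = arr F (𝟙 _) := by rw [ef]

lemma arr_eq_id_of_coord (hF : Admissible F) {i : Fin 2} {x y x' y' : Fin 2 → I} {hxy : x ≤ y}
    {hxy' : x' ≤ y'} (hx : x' ≤ x) (hy : y ≤ y') (hx' : x' (1 - i) = x (1 - i))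
    (hy' : y (1 - i) = y' (1 - i)) (hc : y' i < 1 ∨ (y i = 1 ∧ (x' i = x i ∨ x i < 1)))
    (e : pairC x y hxy ⟶ pairC x' y' hxy') :
    arr F e = arr F (𝟙 (pairC x y hxy)) := by
  rcases hc with hc | ⟨h1, hc⟩
  · exact arr_eq_id_of_coord_lt hF hx hy hx' hy' hc e
  obtain rfl : y = y' := by
    rw [← pair_coords i y, ← pair_coords i y', hy', h1,
      le_antisymm unitInterval.le_one' (h1.symm.le.trans (hy i))]
  rcases hc with hc | hc
  · obtain rfl : x' = x := by rw [← pair_coords i x, ← pair_coords i x', hx', hc]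
    exact arr_eq_of_height rfl rfl height_pairC _ _
  · exact arr_eq_id_of_past hF hx hx' hc h1 e

/-- The extension is factored into one in direction `0` and one in direction `1`. -/
lemma arr_eq_id_of_coords (hF : Admissible F) {x y x' y' : Fin 2 → I} {hxy : x ≤ y}
    {hxy' : x' ≤ y'} (hx : x' ≤ x) (hy : y ≤ y')
    (hc : ∀ i, y' i < 1 ∨ (y i = 1 ∧ (x' i = x i ∨ x i < 1)))
    (e : pairC x y hxy ⟶ pairC x' y' hxy') :
    arr F e = arr F (𝟙 (pairC x y hxy)) := by
  have hm : pair 0 (x' 0) (x (1 - 0)) ≤ pair 0 (y' 0) (y (1 - 0)) :=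
    pair_le_iff.2 ⟨by rw [pair_self]; exact hxy' 0, by rw [pair_other]; exact hxy _⟩
  have h1 : pair 0 (x' 0) (x (1 - 0)) ≤ x := pair_le_iff.2 ⟨hx 0, le_rfl⟩
  have h2 : y ≤ pair 0 (y' 0) (y (1 - 0)) := le_pair_iff.2 ⟨hy 0, le_rfl⟩
  have h3 : x' ≤ pair 0 (x' 0) (x (1 - 0)) := le_pair_iff.2 ⟨le_rfl, hx _⟩
  have h4 : pair 0 (y' 0) (y (1 - 0)) ≤ y' := pair_le_iff.2 ⟨le_rfl, hy _⟩
  let e₁ : pairC x y hxy ⟶ pairC _ _ hm := homOf (reach_CC.2 h1) (reach_CC.2 h2)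
  let e₂ : pairC _ _ hm ⟶ pairC x' y' hxy' := homOf (reach_CC.2 h3) (reach_CC.2 h4)
  have he₁ : arr F e₁ = arr F (𝟙 _) := arr_eq_id_of_coord hF (i := 0) h1 h2 (pair_other _ _ _)
    (pair_other _ _ _).symm (by rw [pair_self, pair_self]; exact hc 0) e₁
  have he₂ : arr F e₂ = arr F (𝟙 (pairC _ _ hm)) := by
    refine arr_eq_id_of_coord hF (i := 1 - 0) h3 h4 ?_ ?_ ?_ e₂
    · exact (pair_self 0 _ _).symm
    · exact pair_self 0 _ _
    · rw [pair_other, pair_other]; exact hc _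
  rw [hom_eq_of_height height_pairC e (e₁ ≫ e₂), arr_comp_of_left he₁, he₂]
  exact arr_id_congr (comp_eq_of_arr_right he₁)

variable {F : MorphismProperty TopCat.{0}}

/-! ### Labels whose components are not determined by order types -/

/-- The labels of the components that consist of pairs of points of `E` and one of the edges
`b₁ ∪ c₂`, `b₂ ∪ c₁`. -/
inductive Label.Thin : Label → Prop
  | BCBC : Thin BCBC
  | BCbc (i : Fin 2) : Thin (BCbc i)
  | bcbc (i : Fin 2) : Thin (bcbc i)

lemma Label.inA_or_eq_cPlus {l : Label} (h : ¬ l.Thin) : l.src.InA ∨ l.tgt = .cPlus := by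
  cases l with
  | BCBC => exact absurd .BCBC h
  | BCbc i => exact absurd (.BCbc i) h
  | bcbc i => exact absurd (.bcbc i) h
  | _ => first | exact .inl trivial | exact .inr rfl

lemma rigid_of_not_thin {p : RPair D} (h : ¬ p.label.Thin) : height p.src = 0 ∨ p.tgt = cPlus := by
  rw [← inA_region_iff, ← region_eq_cPlus_iff, RPair.region_src, RPair.region_tgt]
  exact Label.inA_or_eq_cPlus h

lemma RPair.mem_src_set (p : RPair D) : p.src ∈ p.label.src.set :=
  (Label.mem_src_tgt (RPair.mem_pairs_iff.2 rfl)).1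

lemma RPair.mem_tgt_set (p : RPair D) : p.tgt ∈ p.label.tgt.set :=
  (Label.mem_src_tgt (RPair.mem_pairs_iff.2 rfl)).2

lemma height_src_of_thin {p : RPair D} (h : p.label.Thin) : height p.src ≠ 0 := by
  rw [Ne, ← inA_region_iff, RPair.region_src]
  generalize p.label = l at h
  cases h <;> exact id

lemma ne_of_mem_set {z : D} {r s : Region} (hr : z ∈ r.set) (h : r ≠ s) : z ∉ s.set :=
  fun hs => h (Region.eq_of_mem hr hs)

lemma exists_region_of_height {z : D} (h : height z ≠ 0) :
    z ∈ Region.e.set ∨ (∃ i, z ∈ (Region.top i).set) ∨ z = cPlus := by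
  rw [Ne, ← inA_region_iff] at h
  have hz := mem_region z
  generalize region z = r at *
  cases r with
  | e => exact .inl hz
  | top i => exact .inr (.inl ⟨i, hz⟩)
  | cPlus => exact .inr (.inr hz)
  | _ => exact absurd trivial h

lemma mem_top_of_reach {i : Fin 2} {x y : D} (h : Nonempty (DPath x y)) (hx : x ∈ (Region.top i).set)
    (hy : y ≠ cPlus) : y ∈ (Region.top i).set :=
  (mem_top_or_cPlus hx h).resolve_right hy

lemma mem_e_of_reach {x y : D} (h : Nonempty (DPath x y)) (hx : height x ≠ 0)
    (hy : y ∈ Region.e.set) : x ∈ Region.e.set := by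
  have hy' : y ≠ cPlus := fun h => ne_of_mem_set hy (s := .cPlus) (by simp) h
  rcases exists_region_of_height hx with h' | ⟨i, h'⟩ | rfl
  · exact h'
  · exact absurd (mem_top_of_reach h h' hy') (ne_of_mem_set hy (by simp))
  · exact absurd (eq_cPlus_of_reach h) hy'

lemma mem_e_or_top_of_reach {i : Fin 2} {x y : D} (h : Nonempty (DPath x y)) (hx : height x ≠ 0)
    (hy : y ∈ (Region.top i).set) : x ∈ Region.e.set ∨ x ∈ (Region.top i).set := by
  have hy' : y ≠ cPlus := fun h => ne_of_mem_set hy (s := .cPlus) (by simp) h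
  rcases exists_region_of_height hx with h' | ⟨k, h'⟩ | rfl
  · exact .inl h'
  · have := Region.eq_of_mem (mem_top_of_reach h h' hy') hy
    cases this
    exact .inr h'
  · exact absurd (eq_cPlus_of_reach h) hy'

lemma label_of_mem {p : RPair D} {l : Label} (h : (p.src, p.tgt) ∈ l.pairs) : p.label = l :=
  RPair.mem_pairs_iff.1 h

/-- Going backwards from an end point in `E` one remains in `E` while outside `A`; going forward
from an outer edge one stays on it or arrives at `c⁺`. This leaves only the listed sources. -/
lemma label_of_hom_of_thin {p q : RPair D} (e : p ⟶ q) (h : q.label.Thin) :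
    p.label = q.label ∨ ∃ i, q.label = .BCbc i ∧ (p.label = .BCBC ∨ p.label = .bcbc i) := by
  have h0 := height_src_of_thin h
  have hs := q.mem_src_set
  have ht := q.mem_tgt_set
  have r1 := (Ext.past e).nonempty
  have r2 := (Ext.fut e).nonempty
  have h1 := height_ne_zero_of_reach h0 r1
  have h2 := height_ne_zero_of_reach h1 p.reach
  generalize q.label = l at *
  cases h with
  | BCBC =>
    have := mem_e_of_reach r2 h2 ht
    exact .inl (label_of_mem ⟨mem_e_of_reach p.reach h1 this, this⟩)
  | BCbc i =>
    rcases mem_e_or_top_of_reach r2 h2 ht with h3 | h3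
    · exact .inr ⟨i, rfl, .inl (label_of_mem ⟨mem_e_of_reach p.reach h1 h3, h3⟩)⟩
    rcases mem_e_or_top_of_reach p.reach h1 h3 with h4 | h4
    · exact .inl (label_of_mem ⟨h4, h3⟩)
    · exact .inr ⟨i, rfl, .inr (label_of_mem ⟨h4, h3⟩)⟩
  | bcbc i =>
    have ht' : q.tgt ≠ cPlus := fun h => ne_of_mem_set ht (s := .cPlus) (by simp [Label.tgt]) h
    have hp : p.tgt ≠ cPlus := fun h => ht' (eq_cPlus_of_reach (h ▸ r2))
    have hp' : p.src ≠ cPlus := fun h => hp (eq_cPlus_of_reach (h ▸ p.reach))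
    have h3 := mem_top_of_reach r1 hs hp'
    exact .inl (label_of_mem ⟨h3, mem_top_of_reach p.reach h3 hp⟩)

lemma exists_map_isCorner {ι : Type} [Finite ι] (p : ι → RPair D) :
    ∃ (Φ : Fin 2 → ℝ → ℝ) (h : ∀ i, Profile (Φ i)), ∀ k,
      IsCorner ((p k).map (moveMap h)).src ∧ IsCorner ((p k).map (moveMap h)).tgt := by
  obtain ⟨Φ, h, hz⟩ := exists_moveMap_isCorner fun k : ι × Bool => cond k.2 (p k.1).src (p k.1).tgt
  exact ⟨Φ, h, fun k => ⟨hz (k, true), hz (k, false)⟩⟩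

lemma label_moveMap (hF : Admissible F) {Φ : Fin 2 → ℝ → ℝ} (h : ∀ i, Profile (Φ i)) (p : RPair D) :
    (p.map (moveMap h)).label = p.label :=
  ((hF.inessential h).isFutureMap hF.ge hF.le).label_map p

lemma exists_eq_pairC {p : RPair D} (h : p.label.Thin) (h1 : IsCorner p.src)
    (h2 : IsCorner p.tgt) : ∃ x y h, p = pairC x y h := by
  have h0 := height_src_of_thin h
  have h0' := height_ne_zero_of_reach h0 p.reach
  have key : ∀ {z : D}, IsCorner z → height z ≠ 0 → ∃ x, z = D.mk .C x := by
    rintro z (⟨x, rfl⟩ | hz) h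
    · exact absurd (height_A x) h
    · exact hz
  obtain ⟨x, hx⟩ := key h1 h0
  obtain ⟨y, hy⟩ := key h2 h0'
  have hr := p.reach
  rw [hx, hy] at hr
  exact ⟨x, y, reach_CC.1 hr, RPair.ext hx hy⟩

lemma arr_eq_id_of_pairC (hF : Admissible F) {x y x' y' : Fin 2 → I} {hxy : x ≤ y} {hxy' : x' ≤ y'}
    (ht : (pairC x y hxy).label.Thin) (hl : (pairC x y hxy).label = (pairC x' y' hxy').label)
    (e : pairC x y hxy ⟶ pairC x' y' hxy') : arr F e = arr F (𝟙 (pairC x y hxy)) := by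
  have m1 : Region.HasC x _ := C_mem_region.1 (pairC x y hxy).mem_src_set
  have m2 : Region.HasC y _ := C_mem_region.1 (pairC x y hxy).mem_tgt_set
  have m3 : Region.HasC x' _ := C_mem_region.1 (pairC x' y' hxy').mem_src_set
  have m4 : Region.HasC y' _ := C_mem_region.1 (pairC x' y' hxy').mem_tgt_set
  rw [← hl] at m3 m4
  refine arr_eq_id_of_coords hF (reach_CC.1 (Ext.past e).nonempty)
    (reach_CC.1 (Ext.fut e).nonempty) (fun k => ?_) e
  generalize (pairC x y hxy).label = l at *
  cases ht with
  | BCBC => exact .inl (m4 k)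
  | BCbc i =>
    rcases eq_or_eq_one_sub i k with rfl | rfl
    · exact .inl m4.2
    · exact .inr ⟨m2.1, .inr (m1 _)⟩
  | bcbc i =>
    rcases eq_or_eq_one_sub i k with rfl | rfl
    · exact .inl m4.2
    · exact .inr ⟨m2.1, .inl (m3.1.trans m1.1.symm)⟩

/-- Extensions inside one of these components represent identities. -/
lemma arr_eq_id_of_thin (hF : Admissible F) {p q : RPair D} (ht : p.label.Thin)
    (hl : p.label = q.label) (e : p ⟶ q) : arr F e = arr F (𝟙 p) := by
  obtain ⟨Φ, h, hc⟩ := exists_map_isCorner fun b : Bool => cond b p q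
  have hp := label_moveMap hF h p
  have hq := label_moveMap hF h q
  rw [← arr_map (hF.inessential h) e, ← arr_id_map hF h p]
  have hcp : IsCorner (p.map (moveMap h)).src ∧ IsCorner (p.map (moveMap h)).tgt := hc true
  have hcq : IsCorner (q.map (moveMap h)).src ∧ IsCorner (q.map (moveMap h)).tgt := hc false
  generalize Ext.map (moveMap h) e = e'
  obtain ⟨x, y, hxy, hp'⟩ := exists_eq_pairC (by rwa [hp]) hcp.1 hcp.2
  obtain ⟨x', y', hxy', hq'⟩ := exists_eq_pairC (by rwa [hq, ← hl]) hcq.1 hcq.2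
  generalize p.map (moveMap h) = P at *
  generalize q.map (moveMap h) = Q at *
  subst hp' hq'
  exact arr_eq_id_of_pairC hF (by rwa [hp]) (by rw [hp, hq, hl]) e'

/-- Two extensions with the same target, whose sources have the same label, represent the same
morphism. -/
lemma arr_eq_of_label_eq_of_tgt (hF : Admissible F) {p p' r : RPair D} (hr : r.label.Thin)
    (hl : p.label = p'.label) (e : p ⟶ r) (e' : p' ⟶ r) : arr F e = arr F e' := by
  have h0 := height_src_of_thin hr
  rcases label_of_hom_of_thin e hr with h | ⟨i, hi, h | h⟩
  · have key : ∀ {p : RPair D} (e : p ⟶ r), p.label = r.label → arr F e = arr F (𝟙 r) :=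
      fun e h => by
        have := arr_eq_id_of_thin hF (by rwa [h]) h e
        exact this.trans (arr_id_congr (comp_eq_of_arr_right this).symm)
    rw [key e h, key e' (hl ▸ h)]
  · let s : RPair D := ⟨r.src, r.src, ⟨DPath.refl _⟩⟩
    have key : ∀ {p : RPair D} (e : p ⟶ r), p.label = .BCBC →
        arr F e = arr F (homOf ⟨DPath.refl _⟩ r.reach : s ⟶ r) := by
      intro p e h
      have hp : p.src ∈ Region.e.set := by have := p.mem_src_set; rwa [h] at this
      have hr : r.src ∈ Region.e.set := by have := r.mem_src_set; rwa [hi] at this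
      have r1 := (Ext.past e).nonempty
      obtain ⟨r2⟩ := (Ext.fut e).nonempty
      obtain ⟨r3⟩ := p.reach
      let p₀ : RPair D := ⟨p.src, p.src, ⟨DPath.refl _⟩⟩
      let p₁ : RPair D := ⟨r.src, p.src, r1⟩
      have l₀ : p₀.label = .BCBC := label_of_mem ⟨hp, hp⟩
      have l₁ : p₁.label = .BCBC := label_of_mem ⟨hr, hp⟩
      have ls : s.label = .BCBC := label_of_mem ⟨hr, hr⟩
      let a : p₀ ⟶ p := homOf ⟨DPath.refl _⟩ ⟨r3⟩
      let b : p₀ ⟶ p₁ := homOf r1 ⟨DPath.refl _⟩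
      let c : p₁ ⟶ r := homOf ⟨DPath.refl _⟩ ⟨r3.trans r2⟩
      let d : s ⟶ p₁ := homOf ⟨DPath.refl _⟩ r1
      rw [← arr_comp_of_left (e := e) (arr_eq_id_of_thin hF (l₀ ▸ .BCBC) (l₀.trans h.symm) a),
        hom_eq_of_height h0 (a ≫ e) (b ≫ c),
        arr_comp_of_left (e := c) (arr_eq_id_of_thin hF (l₀ ▸ .BCBC) (l₀.trans l₁.symm) b),
        ← arr_comp_of_left (e := c) (arr_eq_id_of_thin hF (ls ▸ .BCBC) (ls.trans l₁.symm) d)]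
      rw [hom_eq_of_height h0 (d ≫ c)]
    rw [key e h, key e' (hl ▸ h)]
  · let s : RPair D := ⟨r.tgt, r.tgt, ⟨DPath.refl _⟩⟩
    have key : ∀ {p : RPair D} (e : p ⟶ r), p.label = .bcbc i →
        arr F e = arr F (homOf r.reach ⟨DPath.refl _⟩ : s ⟶ r) := by
      intro p e h
      have hp : p.tgt ∈ (Region.top i).set := by have := p.mem_tgt_set; rwa [h] at this
      have hr : r.tgt ∈ (Region.top i).set := by have := r.mem_tgt_set; rwa [hi] at this
      obtain ⟨r1⟩ := (Ext.past e).nonempty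
      have r2 := (Ext.fut e).nonempty
      obtain ⟨r3⟩ := p.reach
      let p₀ : RPair D := ⟨p.tgt, p.tgt, ⟨DPath.refl _⟩⟩
      let p₁ : RPair D := ⟨p.tgt, r.tgt, r2⟩
      have l₀ : p₀.label = .bcbc i := label_of_mem ⟨hp, hp⟩
      have l₁ : p₁.label = .bcbc i := label_of_mem ⟨hp, hr⟩
      have ls : s.label = .bcbc i := label_of_mem ⟨hr, hr⟩
      let a : p₀ ⟶ p := homOf ⟨r3⟩ ⟨DPath.refl _⟩
      let b : p₀ ⟶ p₁ := homOf ⟨DPath.refl _⟩ r2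
      let c : p₁ ⟶ r := homOf ⟨r1.trans r3⟩ ⟨DPath.refl _⟩
      let d : s ⟶ p₁ := homOf r2 ⟨DPath.refl _⟩
      rw [← arr_comp_of_left (e := e) (arr_eq_id_of_thin hF (l₀ ▸ .bcbc i) (l₀.trans h.symm) a),
        hom_eq_of_height h0 (a ≫ e) (b ≫ c),
        arr_comp_of_left (e := c) (arr_eq_id_of_thin hF (l₀ ▸ .bcbc i) (l₀.trans l₁.symm) b),
        ← arr_comp_of_left (e := c) (arr_eq_id_of_thin hF (ls ▸ .bcbc i) (ls.trans l₁.symm) d)]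
      rw [hom_eq_of_height h0 (d ≫ c)]
    rw [key e h, key e' (hl ▸ h)]

lemma Region.hasC_inf {x x' : Fin 2 → I} {r : Region} (h : r.HasC x) (h' : r.HasC x') :
    r.HasC (x ⊓ x') := by
  cases r with
  | e => exact fun i => inf_lt_of_left_lt (h i)
  | top i => exact ⟨by rw [Pi.inf_apply, h.1, h'.1, inf_idem], inf_lt_of_left_lt h.2⟩
  | cPlus => exact fun i => by rw [Pi.inf_apply, h i, h' i, inf_idem]
  | _ => exact h

lemma Region.hasC_sup {x x' : Fin 2 → I} {r : Region} (h : r.HasC x) (h' : r.HasC x') :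
    r.HasC (x ⊔ x') := by
  cases r with
  | e => exact fun i => sup_lt_iff.2 ⟨h i, h' i⟩
  | top i => exact ⟨by rw [Pi.sup_apply, h.1, h'.1, sup_idem], sup_lt_iff.2 ⟨h.2, h'.2⟩⟩
  | cPlus => exact fun i => by rw [Pi.sup_apply, h i, h' i, sup_idem]
  | _ => exact h

/-- Take the infimum of the start points and the supremum of the end points in `C`; the regions
outside `A` are closed under these operations. -/
lemma exists_common_extension {q q' : RPair D} (ht : q.label.Thin) (hl : q.label = q'.label)
    (h1 : IsCorner q.src) (h2 : IsCorner q.tgt) (h1' : IsCorner q'.src) (h2' : IsCorner q'.tgt) :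
    ∃ r : RPair D, r.label = q.label ∧ Nonempty (q ⟶ r) ∧ Nonempty (q' ⟶ r) := by
  obtain ⟨x, y, hxy, hq⟩ := exists_eq_pairC ht h1 h2
  obtain ⟨x', y', hxy', hq'⟩ := exists_eq_pairC (hl ▸ ht) h1' h2'
  have m1 := q.mem_src_set
  have m2 := q.mem_tgt_set
  have m3 := q'.mem_src_set
  have m4 := q'.mem_tgt_set
  rw [← hl] at m3 m4
  generalize q.label = l at *
  subst hq hq'
  have m5 := Region.hasC_inf (C_mem_region.1 m1) (C_mem_region.1 m3)
  have m6 := Region.hasC_sup (C_mem_region.1 m2) (C_mem_region.1 m4)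
  rw [← C_mem_region] at m5 m6
  refine ⟨pairC (x ⊓ x') (y ⊔ y') (inf_le_left.trans (hxy.trans le_sup_left)), ?_,
    ⟨homOf (reach_CC.2 inf_le_left) (reach_CC.2 le_sup_left)⟩,
    ⟨homOf (reach_CC.2 inf_le_right) (reach_CC.2 le_sup_right)⟩⟩
  cases ht <;> exact label_of_mem ⟨m5, m6⟩

/-- The targets embed in a common target by extensions that represent identities, which reduces the
claim to extensions with the same target. -/
lemma arr_eq_of_label_eq (hF : Admissible F) {p q p' q' : RPair D} (hq : q.label.Thin)
    (hp : p.label = p'.label) (hl : q.label = q'.label) (e : p ⟶ q) (e' : p' ⟶ q') :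
    arr F e = arr F e' := by
  obtain ⟨Φ, h, hc⟩ := exists_map_isCorner fun b : Bool => cond b q q'
  rw [← arr_map (hF.inessential h) e, ← arr_map (hF.inessential h) e']
  have l1 := label_moveMap hF h q
  have l2 := label_moveMap hF h q'
  obtain ⟨r, hr, ⟨j⟩, ⟨j'⟩⟩ := exists_common_extension (q := q.map (moveMap h))
    (q' := q'.map (moveMap h)) (by rwa [l1]) (by rw [l1, l2, hl]) (hc true).1 (hc true).2
    (hc false).1 (hc false).2
  rw [← arr_comp_of_right (e := Ext.map (moveMap h) e)
      (arr_eq_id_of_thin hF (by rwa [l1]) hr.symm j),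
    ← arr_comp_of_right (e := Ext.map (moveMap h) e')
      (arr_eq_id_of_thin hF (by rwa [l2, ← hl]) (by rw [hr, l1, l2, hl]) j')]
  exact arr_eq_of_label_eq_of_tgt hF (by rwa [hr, l1])
    (by rw [label_moveMap hF h, label_moveMap hF h, hp]) _ _

/-! ### The objects and morphisms of the component category of `D` -/

lemma comp_eq_of_label_eq (hF : Admissible F) {p q : RPair D} (h : p.label = q.label) :
    comp F p = comp F q := by
  by_cases ht : p.label.Thin
  · exact comp_eq_of_arr_left (arr_eq_of_label_eq hF ht h h (𝟙 p) (𝟙 q))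
  · obtain ⟨Φ, h₁, hc⟩ := exists_map_isCorner fun b : Bool => cond b p q
    have l1 := label_moveMap hF h₁ p
    have l2 := label_moveMap hF h₁ q
    obtain ⟨Φ', Φ'', h₂, h₃, he⟩ := exists_map_eq_of_label_eq (p := p.map (moveMap h₁))
      (q := q.map (moveMap h₁)) (by rw [l1, l2, h]) (rigid_of_not_thin (by rwa [l1]))
      (hc true).1 (hc true).2 (hc false).1 (hc false).2
    have := congrArg (comp F) he
    rwa [comp_map (hF.inessential h₂), comp_map (hF.inessential h₃),
      comp_map (hF.inessential h₁), comp_map (hF.inessential h₁)] at this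

/-- The label of the pairs in a component. -/
def labelComp (hF : Admissible F) (K : FuturePairComponents D F) : Label :=
  Quot.lift (fun a : MixedCat D F => RPair.label a.as.pair) (by
    rintro _ _ ⟨_, ⟨f, hf, p⟩⟩
    exact ((hf.isFutureMap hF.ge hF.le).label_map p).symm) K.as

lemma comp_eq_iff (hF : Admissible F) {p q : RPair D} : comp F p = comp F q ↔ p.label = q.label :=
  ⟨fun h => congrArg (labelComp hF) h, comp_eq_of_label_eq hF⟩

/-- Extensions that are composable in the component category are represented by composable
extensions. -/
lemma exists_composable (hF : Admissible F) {p q q' r : RPair D} (e : p ⟶ q) (e' : q' ⟶ r)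
    (h : q.label = q'.label) : ∃ (p₁ q₁ r₁ : RPair D) (e₁ : p₁ ⟶ q₁) (e₁' : q₁ ⟶ r₁),
      arr F e₁ = arr F e ∧ arr F e₁' = arr F e' := by
  by_cases ht : q.label.Thin
  -- A morphism into a thin component depends only on labels, so the first extension may be replaced
  -- by any extension into `q'` whose source has the label of `p`.
  · suffices hs : ∃ (p₁ : RPair D) (_ : p₁ ⟶ q'), p₁.label = p.label by
      obtain ⟨p₁, e₁, h₁⟩ := hs
      exact ⟨p₁, q', r, e₁, e', arr_eq_of_label_eq hF (h ▸ ht) h₁ h.symm e₁ e, rfl⟩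
    rcases label_of_hom_of_thin e ht with h' | ⟨i, hi, h' | h'⟩
    · exact ⟨q', 𝟙 q', (h'.trans h).symm⟩
    · have hq : q'.src ∈ Region.e.set := by have := q'.mem_src_set; rwa [← h, hi] at this
      let s : RPair D := ⟨q'.src, q'.src, ⟨DPath.refl _⟩⟩
      have hs : s.label = .BCBC := label_of_mem ⟨hq, hq⟩
      exact ⟨s, homOf ⟨DPath.refl _⟩ q'.reach, hs.trans h'.symm⟩
    · have hq : q'.tgt ∈ (Region.top i).set := by have := q'.mem_tgt_set; rwa [← h, hi] at this
      let s : RPair D := ⟨q'.tgt, q'.tgt, ⟨DPath.refl _⟩⟩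
      have hs : s.label = .bcbc i := label_of_mem ⟨hq, hq⟩
      exact ⟨s, homOf q'.reach ⟨DPath.refl _⟩, hs.trans h'.symm⟩
  -- Otherwise the two middle pairs can be moved to the same pair, and the extensions are carried
  -- along.
  · obtain ⟨Φ, h₁, hc⟩ := exists_map_isCorner fun b : Bool => cond b q q'
    have l1 := label_moveMap hF h₁ q
    have l2 := label_moveMap hF h₁ q'
    obtain ⟨Φ', Φ'', h₂, h₃, he⟩ := exists_map_eq_of_label_eq (p := q.map (moveMap h₁))
      (q := q'.map (moveMap h₁)) (by rw [l1, l2, h]) (rigid_of_not_thin (by rwa [l1]))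
      (hc true).1 (hc true).2 (hc false).1 (hc false).2
    have a1 := (arr_map (hF.inessential h₂) (Ext.map (moveMap h₁) e)).trans
      (arr_map (hF.inessential h₁) e)
    have a2 := (arr_map (hF.inessential h₃) (Ext.map (moveMap h₁) e')).trans
      (arr_map (hF.inessential h₁) e')
    generalize Ext.map (moveMap h₂) (Ext.map (moveMap h₁) e) = e₁ at a1
    generalize Ext.map (moveMap h₃) (Ext.map (moveMap h₁) e') = e₂ at a2
    generalize (q.map (moveMap h₁)).map (moveMap h₂) = q₁ at *
    subst he
    exact ⟨_, _, _, e₁, e₂, a1, a2⟩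

/-- Every morphism is represented by an extension. -/
lemma exists_arr_eq (hF : Admissible F) {K L : FuturePairComponents D F} (m : K ⟶ L) :
    ∃ (p q : RPair D) (e : p ⟶ q), arr F e = Arrow.mk m := by
  refine arrow_induction (P := fun a => ∃ (p q : RPair D) (e : p ⟶ q), arr F e = a)
    (fun e => ⟨_, _, e, rfl⟩) ?_ m
  rintro K L M m m' ⟨p, q, e, he⟩ ⟨q', r, e', he'⟩
  have h : comp F q = comp F q' :=
    (congrArg Arrow.rightFunc.obj he).trans (congrArg Arrow.leftFunc.obj he').symm
  obtain ⟨p₁, q₁, r₁, e₁, e₁', h₁, h₁'⟩ := exists_composable hF e e' ((comp_eq_iff hF).1 h)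
  refine ⟨p₁, r₁, e₁ ≫ e₁', ?_⟩
  unfold arr
  rw [Functor.map_comp]
  exact arrow_mk_comp_congr (h₁.trans he) (h₁'.trans he')

/-! ### Finiteness -/

instance : Finite Region :=
  Finite.of_surjective (Sum.elim Region.a (Sum.elim Region.top
    ![Region.lowA, Region.aPlus, Region.e, Region.cPlus])) fun r =>
    match r with
    | .lowA => ⟨.inr (.inr 0), rfl⟩
    | .a i => ⟨.inl i, rfl⟩
    | .aPlus => ⟨.inr (.inr 1), rfl⟩
    | .e => ⟨.inr (.inr 2), rfl⟩
    | .top i => ⟨.inr (.inl i), rfl⟩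
    | .cPlus => ⟨.inr (.inr 3), rfl⟩

instance : Finite Ordering :=
  Finite.of_surjective ![Ordering.lt, Ordering.eq, Ordering.gt] fun o =>
    match o with
    | .lt => ⟨0, rfl⟩
    | .eq => ⟨1, rfl⟩
    | .gt => ⟨2, rfl⟩

/-- Every label is realized by a reachable pair, hence comes from one of finitely many codes. -/
instance : Finite Label :=
  Finite.of_surjective (fun c : Region × Region × (Fin 2 → Ordering) => Label.ofCode c.1 c.2.1 c.2.2)
    fun l => by
      obtain ⟨p, hp⟩ := exists_label_eq l
      exact ⟨⟨region p.src, region p.tgt, fun i => cmpCoord i (p.src, p.tgt)⟩, hp⟩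

lemma arr_eq_of_inStrip {p q p' q' : RPair D} (hp : p = p') (hq : q = q') {e : p ⟶ q} {e' : p' ⟶ q'}
    {i k : Fin 2} (h1 : (Ext.past e).InStrip i) (h1' : (Ext.past e').InStrip i)
    (h2 : (Ext.fut e).InStrip k) (h2' : (Ext.fut e').InStrip k) : arr F e = arr F e' := by
  subst hp hq
  rw [Ext.ext (h1.eq h1') (h2.eq h2') (x := e) (y := e')]

/-- The source and target points of the source and target of an extension. -/
def corners (p q : RPair D) (k : Bool × Bool) : D :=
  cond k.2 (cond k.1 p q).src (cond k.1 p q).tgt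

lemma finite_hom (hF : Admissible F) (K L : FuturePairComponents D F) : Finite (K ⟶ L) := by
  have rep : ∀ m : K ⟶ L, ∃ (p q : RPair D) (e : p ⟶ q), arr F e = Arrow.mk m ∧
      ∀ k, IsCorner (corners p q k) := by
    intro m
    obtain ⟨p, q, e, he⟩ := exists_arr_eq hF m
    obtain ⟨Φ, h, hc⟩ := exists_map_isCorner fun b : Bool => cond b p q
    refine ⟨_, _, Ext.map (moveMap h) e, (arr_map (hF.inessential h) e).trans he, ?_⟩
    rintro ⟨_ | _, _ | _⟩
    exacts [(hc false).2, (hc false).1, (hc true).2, (hc true).1]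
  choose p q e he hc using rep
  -- The invariants are the order type of the four points and the strips of the past and future
  -- parts. If they agree for two morphisms, moves turn the chosen representatives into the same
  -- extension.
  refine Finite.of_injective (β := (Bool × Bool → Prop) × (Fin 2 → Bool × Bool → Bool × Bool → Ordering) ×
    (Fin 2 → Bool × Bool → Prop) × (Fin 2 → Prop) × (Fin 2 → Prop))
    (fun m => ⟨fun k => height (corners (p m) (q m) k) = 0,
      fun i k l => cmpCoord i (corners (p m) (q m) k, corners (p m) (q m) l),
      fun i k => coord (corners (p m) (q m) k) i = 1,
      fun i => (Ext.past (e m)).InStrip i, fun i => (Ext.fut (e m)).InStrip i⟩) ?_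
  intro m m' hm
  simp only [Prod.mk.injEq] at hm
  obtain ⟨hh, hcmp, h1, hpast, hfut⟩ := hm
  obtain ⟨Φ, Φ', h, h', hz⟩ := exists_moveMap_eq (hc m) (hc m')
    (fun k => iff_of_eq (congrFun hh k)) (fun i k l => congrFun (congrFun (congrFun hcmp i) k) l)
    (fun i k => iff_of_eq (congrFun (congrFun h1 i) k))
  obtain ⟨i, hi⟩ := (Ext.past (e m)).exists_inStrip
  obtain ⟨k, hk⟩ := (Ext.fut (e m)).exists_inStrip
  have hi' : (Ext.past (e m')).InStrip i := (iff_of_eq (congrFun hpast i)).1 hi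
  have hk' : (Ext.fut (e m')).InStrip k := (iff_of_eq (congrFun hfut k)).1 hk
  have hp : (p m).map (moveMap h) = (p m').map (moveMap h') :=
    RPair.ext (hz (true, true)) (hz (true, false))
  have hq : (q m).map (moveMap h) = (q m').map (moveMap h') :=
    RPair.ext (hz (false, true)) (hz (false, false))
  have key : arr F (Ext.map (moveMap h) (e m)) = arr F (Ext.map (moveMap h') (e m')) :=
    arr_eq_of_inStrip hp hq (hi.map_of_move h (moveMap_apply h)) (hi'.map_of_move h' (moveMap_apply h'))
      (hk.map_of_move h (moveMap_apply h)) (hk'.map_of_move h' (moveMap_apply h'))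
  rw [arr_map (hF.inessential h), arr_map (hF.inessential h'), he, he] at key
  obtain ⟨_, _, hmm⟩ := (Arrow.mk_eq_mk_iff _ _).1 key
  simpa using hmm

/-! ### The main results -/

/-- The bijection between labels and components. -/
def labelEquiv (hF : Admissible F) : Label ≃ FuturePairComponents D F where
  toFun l := comp F (exists_label_eq l).choose
  invFun := labelComp hF
  left_inv l := (exists_label_eq l).choose_spec
  right_inv K := by
    obtain ⟨p, rfl⟩ := exists_comp_eq K
    exact comp_eq_of_label_eq hF (exists_label_eq _).choose_spec

lemma comp_eq_labelEquiv_iff (hF : Admissible F) (l : Label) (p : RPair D) :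
    comp F p = labelEquiv hF l ↔ (p.src, p.tgt) ∈ l.pairs := by
  rw [RPair.mem_pairs_iff, ← (labelEquiv hF).symm_apply_eq]
  rfl

lemma not_equivalent_point (hF : Admissible F) :
    ¬ Nonempty (FuturePairComponents D F ≌ Discrete PUnit.{1}) := by
  rintro ⟨E⟩
  obtain ⟨p, hp⟩ := exists_label_eq .cPluscPlus
  obtain ⟨q, hq⟩ := exists_label_eq .aPlusaPlus
  -- In a category equivalent to the point there is a morphism between any two objects; this one
  -- would require a d-path from `c⁺` to `a⁺`.
  let m : comp F p ⟶ comp F q := E.functor.preimage (eqToHom (Subsingleton.elim _ _))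
  obtain ⟨p', q', e, he⟩ := exists_arr_eq hF m
  have hp' : p'.label = .cPluscPlus :=
    ((comp_eq_iff hF).1 (congrArg Arrow.leftFunc.obj he)).trans hp
  have hq' : q'.label = .aPlusaPlus :=
    ((comp_eq_iff hF).1 (congrArg Arrow.rightFunc.obj he)).trans hq
  have h1 : p'.tgt = cPlus := (RPair.mem_pairs_iff.2 hp').2
  have h2 : q'.tgt = aPlus := (RPair.mem_pairs_iff.2 hq').2
  have h3 := eq_cPlus_of_reach (h1 ▸ (Ext.fut e).nonempty)
  rw [h2] at h3
  exact D.mk_A_ne_C h3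

lemma futureInessential_congr {F' : MorphismProperty TopCat.{0}} (hF : Admissible F)
    (hF' : Admissible F') {f : DMap D D} (hf : FutureInessential F f) : FutureInessential F' f := by
  obtain ⟨h, hh⟩ := hf
  exact ⟨h, fun t => (isPsp_iff hF'.ge hF'.le).2 ((isPsp_iff hF.ge hF.le).1 (hh t))⟩

lemma exists_comparison {F' : MorphismProperty TopCat.{0}} (hF : Admissible F)
    (hF' : Admissible F') : ∃ Φ : FuturePairComponents D F ⥤ FuturePairComponents D F',
      componentFunctor D F ⋙ Φ = componentFunctor D F' :=
  exists_lift _ (fun _ hf p => comp_map (futureInessential_congr hF hF' hf) p)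
    (fun _ hf _ _ e => arr_map (futureInessential_congr hF hF' hf) e)
    (fun _ hf h p => arr_flow (futureInessential_congr hF hF' hf) h p)

/-- Every arrow comes from an extension, so a functor on the component category is determined by its
composite with `componentFunctor`. -/
lemma eq_id_of_comp (hF : Admissible F) (Θ : FuturePairComponents D F ⥤ FuturePairComponents D F)
    (h : componentFunctor D F ⋙ Θ = componentFunctor D F) : Θ = 𝟭 _ := by
  refine Arrow.functor_ext fun K L m => ?_
  obtain ⟨p, q, e, he⟩ := exists_arr_eq hF m
  rw [← he]
  exact congrArg (fun G : RPair D ⥤ FuturePairComponents D F => G.mapArrow.obj (Arrow.mk e)) h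

end DirTop

end

theorem mainTheorem4 :
    (∀ F : MorphismProperty TopCat.{0}, homotopyEquivalences ≤ F → F ≤ pi0Bijections →
      (∃ comp : Label ≃ FuturePairComponents D F, ∀ (l : Label) (p : RPair D),
        (componentFunctor D F).obj p = comp l ↔ (p.src, p.tgt) ∈ l.pairs) ∧
      (∀ (K L : FuturePairComponents D F) (m : K ⟶ L), ∃ (p q : RPair D) (e : p ⟶ q),
        Arrow.mk ((componentFunctor D F).map e) = Arrow.mk m) ∧
      Finite (FuturePairComponents D F) ∧
      (∀ K L : FuturePairComponents D F, Finite (K ⟶ L)) ∧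
      ¬ Nonempty (FuturePairComponents D F ≌ Discrete PUnit.{1})) ∧
    (∀ F F' : MorphismProperty TopCat.{0}, homotopyEquivalences ≤ F → F ≤ pi0Bijections →
      homotopyEquivalences ≤ F' → F' ≤ pi0Bijections →
      ∃ (Φ : FuturePairComponents D F ⥤ FuturePairComponents D F')
        (Ψ : FuturePairComponents D F' ⥤ FuturePairComponents D F),
        Φ ⋙ Ψ = 𝟭 _ ∧ Ψ ⋙ Φ = 𝟭 _ ∧ componentFunctor D F ⋙ Φ = componentFunctor D F') := by
  refine ⟨fun F h1 h2 => ?_, fun F F' h1 h2 h1' h2' => ?_⟩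
  · have hF : Admissible F := ⟨h1, h2⟩
    exact ⟨⟨labelEquiv hF, comp_eq_labelEquiv_iff hF⟩, fun K L m => exists_arr_eq hF m,
      Finite.of_equiv Label (labelEquiv hF), finite_hom hF, not_equivalent_point hF⟩
  · have hF : Admissible F := ⟨h1, h2⟩
    have hF' : Admissible F' := ⟨h1', h2'⟩
    obtain ⟨Φ, hΦ⟩ := exists_comparison hF hF'
    obtain ⟨Ψ, hΨ⟩ := exists_comparison hF' hF
    refine ⟨Φ, Ψ, eq_id_of_comp hF _ ?_, eq_id_of_comp hF' _ ?_, hΦ⟩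
    · rw [← Functor.assoc, hΦ, hΨ]
    · rw [← Functor.assoc, hΨ, hΦ]
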